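/- Let $A$ and $B$ be finite-dimensional quantum systems (finite-dimensional complex Hilbert spaces) and let $\log$ denote the logarithm to base $2$. For density operators $\rho$ (positive semi-definite, unit trace), positive semi-definite operators $\sigma$ on the same space and $\alpha\in(0,1)\cup(1,\infty)$, put $$D_\alpha(\rho\|\sigma)=\frac1{\alpha-1}\log\operatorname{tr}\{\rho^\alpha\sigma^{1-\alpha}\},\qquad \widetilde D_\alpha(\rho\|\sigma)=\frac1{\alpha-1}\log\operatorname{tr}\Big\{\big(\sigma^{\frac{1-\alpha}{2\alpha}}\rho\,\sigma^{\frac{1-\alpha}{2\alpha}}\big)^\alpha\Big\}$$ if the kernel of $\sigma$ lies inside the kernel of $\rho$, or if $\alpha<1$ and $\rho\sigma\neq0$; both are $+\infty$ otherwise. Powers are taken on the support. For $\alpha\in\{0,1,\infty\}$, $D_\alpha$ and $\widetilde D_\alpha$ are defined as the corresponding limits. For a state $\rho_{AB}$ (a density operator on $A\otimes B$) with marginal $\rho_B=\operatorname{tr}_A\rho_{AB}$, and $\alpha\in[0,\infty]$, define $$H^\downarrow_\alpha(A|B)_\rho=-D_\alpha(\rho_{AB}\|1_A\otimes\rho_B),\qquad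 H^\uparrow_\alpha(A|B)_\rho=\sup_{\sigma_B}-D_\alpha(\rho_{AB}\|1_A\otimes\sigma_B),$$ $$\widetilde H^\downarrow_\alpha(A|B)_\rho=-\widetilde D_\alpha(\rho_{AB}\|1_A\otimes\rho_B),\qquad \widetilde H^\uparrow_\alpha(A|B)_\rho=\sup_{\sigma_B}-\widetilde D_\alpha(\rho_{AB}\|1_A\otimes\sigma_B),$$ where the suprema are over all density operators $\sigma_B$ on $B$. Then for every state $\rho_{AB}$ and every $\alpha\in[\frac12,\infty]$ (with $\frac1\infty=0$), $$H^\uparrow_\alpha(A|B)_\rho\le\widetilde H^\uparrow_\alpha(A|B)_\rho\le H^\uparrow_{2-\frac1\alpha}(A|B)_\rho,$$ $$H^\downarrow_\alpha(A|B)_\rho\le H^\uparrow_\alpha(A|B)_\rho\le H^\downarrow_{2-\frac1\alpha}(A|B)_\rho,$$ $$\widetilde H^\downarrow_\alpha(A|B)_\rho\le\widetilde H^\uparrow_\alpha(A|B)_\rho\le\widetilde H^\downarrow_{2-\frac1\alpha}(A|B)_\rho,$$ $$H^\downarrow_\alpha(A|B)_\rho\le\widetilde H^\downarrow_\alpha(A|B)_\rho\le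 H^\downarrow_{2-\frac1\alpha}(A|B)_\rho.$$ -/

import Mathlib

open Filter Topology
open scoped ENNReal Kronecker Matrix ComplexOrder

noncomputable section

namespace QRenyi

variable {a b d : Type*} [Fintype a] [DecidableEq a] [Fintype b] [DecidableEq b]
  [Fintype d] [DecidableEq d]

/-- Density operators (states): positive semi-definite operators of unit trace on the
finite-dimensional Hilbert space with orthonormal basis indexed by `d`. -/
def IsState (ρ : Matrix d d ℂ) : Prop :=
  ρ.PosSemidef ∧ ρ.trace = 1

/-- `ρ ≪ σ`: the kernel of `σ` lies inside the kernel of `ρ`. -/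
def IsDominatedBy (ρ σ : Matrix d d ℂ) : Prop :=
  ∀ v : d → ℂ, σ *ᵥ v = 0 → ρ *ᵥ v = 0

/-- The real power `X ^ p` of a positive semi-definite matrix, by functional calculus.
For `p ≠ 0` it is taken on the support of `X` and vanishes on the kernel, because
`(0 : ℝ) ^ p = 0` for every real `p ≠ 0`, negative ones included. -/
def mpow (X : Matrix d d ℂ) (p : ℝ) : Matrix d d ℂ :=
  cfc (fun x : ℝ => x ^ p) X

/-- The marginal `ρ_B = tr_A ρ_AB` of a bipartite operator. -/
def marginalB (ρ : Matrix (a × b) (a × b) ℂ) : Matrix b b ℂ :=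
  Matrix.of fun j k => ∑ i, ρ (i, j) (i, k)

/-- The quantum Rényi relative entropy
`D_α(ρ‖σ) = (α - 1)⁻¹ log₂ tr (ρ ^ α σ ^ (1 - α))` at a real order `α ∈ (0, 1) ∪ (1, ∞)`.
If `ρ ≪ σ` fails, the formula is kept for `α < 1` as long as `ρ` and `σ` are not orthogonal
(exactly then is the trace nonzero), and the value is `+∞` otherwise. -/
def divReal (ρ σ : Matrix d d ℂ) (α : ℝ) : EReal :=
  open Classical in
  if IsDominatedBy ρ σ ∨ (α < 1 ∧ ρ * σ ≠ 0) then
    (((α - 1)⁻¹ * Real.logb 2 (mpow ρ α * mpow σ (1 - α)).trace.re : ℝ) : EReal)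
  else ⊤

/-- The (sandwiched) quantum Rényi divergence
`D̃_α(ρ‖σ) = (α - 1)⁻¹ log₂ tr ((σ ^ ((1 - α) / 2α) ρ σ ^ ((1 - α) / 2α)) ^ α)` at a real order
`α ∈ (0, 1) ∪ (1, ∞)`, with the same conventions if `ρ ≪ σ` fails. -/
def sandwichedReal (ρ σ : Matrix d d ℂ) (α : ℝ) : EReal :=
  open Classical in
  if IsDominatedBy ρ σ ∨ (α < 1 ∧ ρ * σ ≠ 0) then
    (((α - 1)⁻¹ * Real.logb 2
      (mpow (mpow σ ((1 - α) / (2 * α)) * ρ * mpow σ ((1 - α) / (2 * α))) α).trace.re : ℝ)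
        : EReal)
  else ⊤

/-- Extension of a family indexed by the real orders in `(0, 1) ∪ (1, ∞)` to all orders in
`[0, ∞]`: at the orders `0`, `1` and `∞` it is the corresponding limit. -/
def extendOrder (D : ℝ → EReal) (α : ℝ≥0∞) : EReal :=
  open Classical in
  if α = 0 then limUnder (𝓝[>] (0 : ℝ)) D
  else if α = 1 then limUnder (𝓝[≠] (1 : ℝ)) D
  else if α = ∞ then limUnder atTop D
  else D α.toReal

/-- `D_α(ρ‖σ)` for `α ∈ [0, ∞]`. -/
def renyiDiv (α : ℝ≥0∞) (ρ σ : Matrix d d ℂ) : EReal :=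
  extendOrder (divReal ρ σ) α

/-- `D̃_α(ρ‖σ)` for `α ∈ [0, ∞]`. -/
def sandwichedDiv (α : ℝ≥0∞) (ρ σ : Matrix d d ℂ) : EReal :=
  extendOrder (sandwichedReal ρ σ) α

/-- `H_α^↓(A|B)_ρ = -D_α(ρ_AB ‖ 1_A ⊗ ρ_B)`. -/
def condDown (α : ℝ≥0∞) (ρ : Matrix (a × b) (a × b) ℂ) : EReal :=
  -renyiDiv α ρ ((1 : Matrix a a ℂ) ⊗ₖ marginalB ρ)

/-- `H_α^↑(A|B)_ρ = sup_σ -D_α(ρ_AB ‖ 1_A ⊗ σ_B)`, over all states `σ_B`. -/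
def condUp (α : ℝ≥0∞) (ρ : Matrix (a × b) (a × b) ℂ) : EReal :=
  ⨆ (σ : Matrix b b ℂ) (_ : IsState σ), -renyiDiv α ρ ((1 : Matrix a a ℂ) ⊗ₖ σ)

/-- `H̃_α^↓(A|B)_ρ = -D̃_α(ρ_AB ‖ 1_A ⊗ ρ_B)`. -/
def sandwichedCondDown (α : ℝ≥0∞) (ρ : Matrix (a × b) (a × b) ℂ) : EReal :=
  -sandwichedDiv α ρ ((1 : Matrix a a ℂ) ⊗ₖ marginalB ρ)

/-- `H̃_α^↑(A|B)_ρ = sup_σ -D̃_α(ρ_AB ‖ 1_A ⊗ σ_B)`, over all states `σ_B`. -/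
def sandwichedCondUp (α : ℝ≥0∞) (ρ : Matrix (a × b) (a × b) ℂ) : EReal :=
  ⨆ (σ : Matrix b b ℂ) (_ : IsState σ), -sandwichedDiv α ρ ((1 : Matrix a a ℂ) ⊗ₖ σ)

end QRenyi

end

/-! Negation reverses the order, so everything follows from four comparisons of divergences: D̃_α ≤
D_α and D_{2-1/α} ≤ D̃_α for fixed arguments, and, for every state σ_B, D_{2-1/α}(ρ‖1⊗ρ_B) ≤
D_α(ρ‖1⊗σ_B) together with its sandwiched analogue. The inequalities between ↓ and ↑ at equal order
only use the candidate σ_B = ρ_B.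

The first comparison is the Araki-Lieb-Thirring inequality (`araki_lieb_thirring`). It comes from
log-majorization: the product of the k largest squared singular values is the squared modulus of a
determinant, which the three lines theorem controls. For the second, put Z = ρ^{1/2} σ^{(1-α)/α}
ρ^{1/2}. The sandwiched trace is tr Z^α, and Hölder's inequality for Z against a power of the state
ρ produces the Petz trace at order 2-1/α. Below order 1 the reverse Hölder inequality takes over,
and the sign of 1/(α-1) changes with it.

The comparisons with the marginal rest on duality: `complement ρ` plays the marginal on A and the
purifying system C of a purification of ρ. Optimizing over σ_B by Hölder leaves tr (tr_A ρ^α)^{1/α},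
a sandwiched trace of the complement relative to 1⊗ρ at order 1/α. Araki-Lieb-Thirring compares it
with a Petz trace, which equals the Petz trace of ρ relative to 1⊗ρ_B at order 2-1/α. In the
sandwiched case Hölder is used twice, with an auxiliary state τ on C chosen as the equality case.

The orders 0, 1, ∞ are limits, whose existence must be proved: a derivative and a squeeze at 1,
monotonicity in the order at ∞ and, for the sandwiched family, at 0. For α = ∞ and α = 1/2 the order
2-1/α is 2 and 0, and the inequality passes to the limit by means of one-sided continuous bounds. -/

set_option linter.unusedSectionVars false

noncomputable section

namespace QRenyi

/-! ### Functional calculus of Hermitian matrices in eigenbases; real powers and supports. -/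

section Spectral

variable {n m k : Type*} [Fintype n] [DecidableEq n] [Fintype m] [DecidableEq m]
  [Fintype k] [DecidableEq k]

/-- The unitary matrix of eigenvectors, as a plain matrix. -/
def eigU {A : Matrix n n ℂ} (hA : A.IsHermitian) : Matrix n n ℂ := hA.eigenvectorUnitary

variable {A : Matrix n n ℂ} {B : Matrix m m ℂ}

theorem eigU_conjTranspose_mul (hA : A.IsHermitian) : (eigU hA)ᴴ * eigU hA = 1 :=
  Unitary.coe_star_mul_self _

theorem eigU_mul_conjTranspose (hA : A.IsHermitian) : eigU hA * (eigU hA)ᴴ = 1 :=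
  Unitary.coe_mul_star_self _

theorem cfc_eq_conj (hA : A.IsHermitian) (f : ℝ → ℝ) :
    cfc f A = eigU hA * Matrix.diagonal (fun i => (f (hA.eigenvalues i) : ℂ)) * (eigU hA)ᴴ := by
  rw [hA.cfc_eq, Matrix.IsHermitian.cfc, Unitary.conjStarAlgAut_apply]
  rfl

theorem eq_conj (hA : A.IsHermitian) :
    A = eigU hA * Matrix.diagonal (fun i => (hA.eigenvalues i : ℂ)) * (eigU hA)ᴴ := by
  conv_lhs => rw [← cfc_id ℝ A hA.isSelfAdjoint]
  exact cfc_eq_conj hA id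

theorem eigU_conjTranspose_mul_cfc (hA : A.IsHermitian) (f : ℝ → ℝ) :
    (eigU hA)ᴴ * cfc f A =
      Matrix.diagonal (fun i => (f (hA.eigenvalues i) : ℂ)) * (eigU hA)ᴴ := by
  rw [cfc_eq_conj hA, ← Matrix.mul_assoc, ← Matrix.mul_assoc, eigU_conjTranspose_mul,
    Matrix.one_mul]

theorem cfc_mul_eigU (hA : A.IsHermitian) (f : ℝ → ℝ) :
    cfc f A * eigU hA =
      eigU hA * Matrix.diagonal (fun i => (f (hA.eigenvalues i) : ℂ)) := by
  rw [cfc_eq_conj hA, Matrix.mul_assoc, eigU_conjTranspose_mul, Matrix.mul_one]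

theorem ext_of_eigU (hA : A.IsHermitian) (hB : B.IsHermitian) {M N : Matrix n m ℂ}
    (h : (eigU hA)ᴴ * M * eigU hB = (eigU hA)ᴴ * N * eigU hB) : M = N := by
  have key : ∀ M : Matrix n m ℂ, eigU hA * ((eigU hA)ᴴ * M * eigU hB) * (eigU hB)ᴴ = M := by
    intro M
    rw [Matrix.mul_assoc ((eigU hA)ᴴ), ← Matrix.mul_assoc (eigU hA), eigU_mul_conjTranspose,
      Matrix.one_mul, Matrix.mul_assoc, eigU_mul_conjTranspose, Matrix.mul_one]
  rw [← key M, h, key N]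

theorem eigU_sandwich_cfc_left (hA : A.IsHermitian) (hB : B.IsHermitian) (M : Matrix n m ℂ)
    (f : ℝ → ℝ) (i : n) (j : m) :
    ((eigU hA)ᴴ * (cfc f A * M) * eigU hB) i j =
      f (hA.eigenvalues i) * ((eigU hA)ᴴ * M * eigU hB) i j := by
  rw [← Matrix.mul_assoc, eigU_conjTranspose_mul_cfc, Matrix.mul_assoc, Matrix.mul_assoc,
    Matrix.diagonal_mul, Matrix.mul_assoc]

theorem eigU_sandwich_cfc_right (hA : A.IsHermitian) (hB : B.IsHermitian) (M : Matrix n m ℂ)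
    (f : ℝ → ℝ) (i : n) (j : m) :
    ((eigU hA)ᴴ * (M * cfc f B) * eigU hB) i j =
      ((eigU hA)ᴴ * M * eigU hB) i j * f (hB.eigenvalues j) := by
  rw [Matrix.mul_assoc, Matrix.mul_assoc M, cfc_mul_eigU, ← Matrix.mul_assoc M,
    ← Matrix.mul_assoc, Matrix.mul_diagonal, Matrix.mul_assoc]

/-- Functional calculus respects intertwining operators. -/
theorem cfc_mul_eq_mul_cfc (hA : A.IsHermitian) (hB : B.IsHermitian) {M : Matrix n m ℂ}
    (h : A * M = M * B) (f : ℝ → ℝ) : cfc f A * M = M * cfc f B := by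
  apply ext_of_eigU hA hB
  ext i j
  rw [eigU_sandwich_cfc_left, eigU_sandwich_cfc_right]
  -- In the eigenbases, AM = MB reads λ_i m_ij = m_ij μ_j, so m_ij = 0 unless λ_i = μ_j.
  have h1 := eigU_sandwich_cfc_left hA hB M id i j
  have h2 := eigU_sandwich_cfc_right hA hB M id i j
  rw [cfc_id ℝ A hA.isSelfAdjoint, h] at h1
  rw [cfc_id ℝ B hB.isSelfAdjoint, h1] at h2
  simp only [id] at h2
  by_cases h0 : ((eigU hA)ᴴ * M * eigU hB) i j = 0
  · simp [h0]
  · have : (hA.eigenvalues i : ℂ) = hB.eigenvalues j := by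
      rw [mul_comm] at h2
      exact mul_left_cancel₀ h0 h2
    rw [Complex.ofReal_inj.mp this, mul_comm]

/-- The squared overlaps of the eigenbases of two Hermitian matrices, through `M`. -/
def overlap (hA : A.IsHermitian) (hB : B.IsHermitian) (M : Matrix n m ℂ) (p : n × m) : ℝ :=
  Complex.normSq (((eigU hA)ᴴ * M * eigU hB) p.1 p.2)

theorem overlap_nonneg (hA : A.IsHermitian) (hB : B.IsHermitian) (M : Matrix n m ℂ)
    (p : n × m) : 0 ≤ overlap hA hB M p := Complex.normSq_nonneg _

/-- Reduces traces in two non-commuting matrices to scalar sums with nonnegative weights, so that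
trace versions of Hölder and Jensen become scalar inequalities. -/
theorem trace_cfc_mul_cfc (hA : A.IsHermitian) (hB : B.IsHermitian) (M : Matrix n m ℂ)
    (f g : ℝ → ℝ) :
    (cfc f A * M * cfc g B * Mᴴ).trace =
      ((∑ p : n × m, overlap hA hB M p * (f (hA.eigenvalues p.1) * g (hB.eigenvalues p.2)) : ℝ)
        : ℂ) := by
  set W := (eigU hA)ᴴ * M * eigU hB with hW
  have h1 : (cfc f A * M * cfc g B * Mᴴ).trace =
      (Matrix.diagonal (fun i => (f (hA.eigenvalues i) : ℂ)) * W *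
        Matrix.diagonal (fun i => (g (hB.eigenvalues i) : ℂ)) * Wᴴ).trace := by
    rw [cfc_eq_conj hA, cfc_eq_conj hB, hW]
    simp only [Matrix.conjTranspose_mul, Matrix.conjTranspose_conjTranspose, Matrix.mul_assoc]
    rw [Matrix.trace_mul_comm]
    simp only [Matrix.mul_assoc]
  rw [h1, Matrix.trace]
  simp only [Matrix.diag_apply, Matrix.mul_apply (N := Wᴴ), Matrix.mul_diagonal,
    Matrix.diagonal_mul, Matrix.conjTranspose_apply]
  rw [Fintype.sum_prod_type]
  push_cast
  refine Finset.sum_congr rfl fun i _ => Finset.sum_congr rfl fun j _ => ?_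
  simp only [overlap, ← hW]
  rw [Complex.normSq_eq_conj_mul_self]
  simp only [Complex.star_def]
  ring

theorem isHermitian_cfc (f : ℝ → ℝ) (A : Matrix n n ℂ) : (cfc f A).IsHermitian :=
  cfc_predicate f A

theorem continuousOn_spectrum (A : Matrix n n ℂ) (f : ℝ → ℝ) :
    ContinuousOn f (spectrum ℝ A) := A.finite_real_spectrum.continuousOn f

theorem cfc_congr_eigenvalues (hA : A.IsHermitian) {f g : ℝ → ℝ}
    (h : ∀ i, f (hA.eigenvalues i) = g (hA.eigenvalues i)) : cfc f A = cfc g A := by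
  rw [cfc_eq_conj hA, cfc_eq_conj hA]
  simp only [h]

theorem cfc_mul_cfc (f g : ℝ → ℝ) (A : Matrix n n ℂ) :
    cfc f A * cfc g A = cfc (fun x => f x * g x) A :=
  (cfc_mul f g A (continuousOn_spectrum A f) (continuousOn_spectrum A g)).symm

theorem posSemidef_cfc (hA : A.IsHermitian) {f : ℝ → ℝ} (h : ∀ i, 0 ≤ f (hA.eigenvalues i)) :
    (cfc f A).PosSemidef := by
  rw [cfc_eq_conj hA]
  refine Matrix.PosSemidef.mul_mul_conjTranspose_same (Matrix.PosSemidef.diagonal ?_) _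
  intro i
  simpa using h i

/-- The projection onto the support of a Hermitian matrix. -/
def supp (A : Matrix n n ℂ) : Matrix n n ℂ := cfc (fun x : ℝ => if x = 0 then (0 : ℝ) else 1) A

theorem isHermitian_supp (A : Matrix n n ℂ) : (supp A).IsHermitian := isHermitian_cfc _ _

theorem isHermitian_mpow (A : Matrix n n ℂ) (p : ℝ) : (mpow A p).IsHermitian :=
  isHermitian_cfc _ _

theorem posSemidef_mpow (hA : A.PosSemidef) (p : ℝ) : (mpow A p).PosSemidef :=
  posSemidef_cfc hA.1 fun i => Real.rpow_nonneg (hA.eigenvalues_nonneg i) p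

theorem mpow_one (hA : A.PosSemidef) : mpow A 1 = A := by
  unfold mpow
  simp only [Real.rpow_one]
  exact cfc_id' ℝ A hA.1.isSelfAdjoint

/-- Since 0 ^ 0 = 1, the power 0 is the identity and not the support projection. This is the origin
of the side conditions on exponents below. -/
theorem mpow_zero (hA : A.PosSemidef) : mpow A 0 = 1 := by
  unfold mpow
  simp only [Real.rpow_zero]
  exact cfc_const_one ℝ A hA.1.isSelfAdjoint

theorem mpow_mul_mpow (hA : A.PosSemidef) {p q : ℝ} (h : p + q ≠ 0) :
    mpow A p * mpow A q = mpow A (p + q) := by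
  unfold mpow
  rw [cfc_mul_cfc]
  exact cfc_congr_eigenvalues hA.1 fun i =>
    (Real.rpow_add' (hA.eigenvalues_nonneg i) h).symm

theorem mpow_mul_mpow_neg (hA : A.PosSemidef) {p : ℝ} (h : p ≠ 0) :
    mpow A p * mpow A (-p) = supp A := by
  unfold mpow supp
  rw [cfc_mul_cfc]
  refine cfc_congr_eigenvalues hA.1 fun i => ?_
  split_ifs with h0
  · simp [h0, h]
  · rw [← Real.rpow_add (lt_of_le_of_ne (hA.eigenvalues_nonneg i) (Ne.symm h0))]
    simp

theorem mpow_mul_supp (hA : A.PosSemidef) {p : ℝ} (h : p ≠ 0) :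
    mpow A p * supp A = mpow A p := by
  unfold mpow supp
  rw [cfc_mul_cfc]
  refine cfc_congr_eigenvalues hA.1 fun i => ?_
  split_ifs with h0
  · simp [h0, h]
  · simp

theorem supp_mul_mpow (hA : A.PosSemidef) {p : ℝ} (h : p ≠ 0) :
    supp A * mpow A p = mpow A p := by
  have := congrArg Matrix.conjTranspose (mpow_mul_supp hA h)
  rwa [Matrix.conjTranspose_mul, (isHermitian_mpow A p).eq, (isHermitian_supp A).eq] at this

theorem self_mul_supp (hA : A.PosSemidef) : A * supp A = A := by
  have := mpow_mul_supp hA one_ne_zero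
  rwa [mpow_one hA] at this

theorem mpow_mpow (hA : A.PosSemidef) (p q : ℝ) : mpow (mpow A p) q = mpow A (p * q) := by
  unfold mpow
  rw [← cfc_comp' (fun x : ℝ => x ^ q) (fun x : ℝ => x ^ p) A
    ((A.finite_real_spectrum.image _).continuousOn _) (continuousOn_spectrum A _)
    hA.1.isSelfAdjoint]
  exact cfc_congr_eigenvalues hA.1 fun i => (Real.rpow_mul (hA.eigenvalues_nonneg i) p q).symm

theorem mpow_smul (hA : A.PosSemidef) {c : ℝ} (hc : 0 ≤ c) (p : ℝ) :
    mpow ((c : ℂ) • A) p = ((c ^ p : ℝ) : ℂ) • mpow A p := by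
  unfold mpow
  have h1 : ((c : ℂ) • A) = cfc (fun x : ℝ => c * x) A := by
    rw [cfc_const_mul c (fun x => x) A (continuousOn_spectrum A _),
      cfc_id' ℝ A hA.1.isSelfAdjoint]
    rfl
  have h2 : ((c ^ p : ℝ) : ℂ) • cfc (fun x : ℝ => x ^ p) A =
      cfc (fun x : ℝ => c ^ p * x ^ p) A := by
    rw [cfc_const_mul (c ^ p) (fun x => x ^ p) A (continuousOn_spectrum A _)]
    rfl
  rw [h1, h2, ← cfc_comp' (fun x : ℝ => x ^ p) (fun x : ℝ => c * x) A
    ((A.finite_real_spectrum.image _).continuousOn _) (continuousOn_spectrum A _)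
    hA.1.isSelfAdjoint]
  exact cfc_congr_eigenvalues hA.1 fun i => Real.mul_rpow hc (hA.eigenvalues_nonneg i)

/-- Makes the kernel inclusion algebraic: σ annihilates 1 - supp σ, and supp σ = σ⁻¹σ with the
inverse taken on the support. -/
theorem isDominatedBy_iff {ρ σ : Matrix n n ℂ} (hσ : σ.PosSemidef) :
    IsDominatedBy ρ σ ↔ ρ * supp σ = ρ := by
  constructor
  · intro h
    have h1 : σ * (1 - supp σ) = 0 := by rw [mul_sub, self_mul_supp hσ, mul_one, sub_self]
    have h2 : ρ * (1 - supp σ) = 0 := by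
      apply Matrix.ext_of_mulVec_single
      intro i
      rw [← Matrix.mulVec_mulVec, h, Matrix.zero_mulVec]
      rw [Matrix.mulVec_mulVec, h1, Matrix.zero_mulVec]
    rw [mul_sub, mul_one, sub_eq_zero] at h2
    exact h2.symm
  · intro h v hv
    have h1 : supp σ = mpow σ (-1) * σ := by
      have := mpow_mul_mpow_neg hσ (p := -1) (by norm_num)
      rw [neg_neg, mpow_one hσ] at this
      exact this.symm
    rw [← h, h1, ← Matrix.mulVec_mulVec, ← Matrix.mulVec_mulVec, hv, Matrix.mulVec_zero,
      Matrix.mulVec_zero]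

/-- M intertwines MMᴴ and MᴴM. -/
theorem mpow_mul_self_conjTranspose (M : Matrix n m ℂ) (p : ℝ) :
    mpow (M * Mᴴ) p * M = M * mpow (Mᴴ * M) p :=
  cfc_mul_eq_mul_cfc (Matrix.isHermitian_mul_conjTranspose_self M)
    (Matrix.isHermitian_conjTranspose_mul_self M) (Matrix.mul_assoc _ _ _) _

/-- The two products share their nonzero eigenvalues; here one factor is split off, moved through M
by the intertwining relation and cycled around the trace. -/
theorem trace_mpow_mul_conjTranspose (M : Matrix n m ℂ) {p : ℝ} (hp : p ≠ 0) :
    (mpow (M * Mᴴ) p).trace = (mpow (Mᴴ * M) p).trace := by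
  have h1 := Matrix.posSemidef_self_mul_conjTranspose M
  have h2 := Matrix.posSemidef_conjTranspose_mul_self M
  have e1 : mpow (M * Mᴴ) p = mpow (M * Mᴴ) (p - 1) * (M * Mᴴ) := by
    conv_rhs => rw [← mpow_one h1, mpow_mpow h1, one_mul, mpow_mul_mpow h1 (by simpa using hp)]
    congr 1; ring
  have e2 : mpow (Mᴴ * M) p = mpow (Mᴴ * M) (p - 1) * (Mᴴ * M) := by
    conv_rhs => rw [← mpow_one h2, mpow_mpow h2, one_mul, mpow_mul_mpow h2 (by simpa using hp)]
    congr 1; ring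
  rw [e1, e2, ← Matrix.mul_assoc, mpow_mul_self_conjTranspose, Matrix.mul_assoc,
    Matrix.trace_mul_comm, Matrix.mul_assoc]

/-- If `A M` is supported on the support of `B`, the eigenvalues at which the overlap does not
vanish are related accordingly. -/
theorem overlap_eq_zero (hA : A.IsHermitian) (hB : B.IsHermitian) {M : Matrix n m ℂ}
    (h : A * M * supp B = A * M) {p : n × m} (hp : hB.eigenvalues p.2 = 0) :
    hA.eigenvalues p.1 * overlap hA hB M p = 0 := by
  have h1 := eigU_sandwich_cfc_left hA hB M id p.1 p.2
  rw [cfc_id ℝ A hA.isSelfAdjoint, ← h] at h1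
  unfold supp at h1
  rw [eigU_sandwich_cfc_right, hp] at h1
  simp only [if_true, id, Complex.ofReal_zero, mul_zero, zero_eq_mul] at h1
  rcases h1 with h1 | h1
  · rw [Complex.ofReal_eq_zero.mp h1, zero_mul]
  · rw [overlap, h1, map_zero, mul_zero]

end Spectral

/-! ### From weak log-majorization to sums of powers. -/

section Majorization

/-- Abel summation: antitone nonnegative weights preserve nonnegativity of partial sums. -/
theorem sum_mul_nonneg_of_antitone {w d : ℕ → ℝ} {N : ℕ}
    (hw : ∀ i j, i ≤ j → j < N → w j ≤ w i) (hw0 : ∀ i, i < N → 0 ≤ w i)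
    (hd : ∀ k, k ≤ N → 0 ≤ ∑ i ∈ Finset.range k, d i) :
    0 ≤ ∑ i ∈ Finset.range N, w i * d i := by
  have key : ∀ k, k + 1 ≤ N →
      w k * ∑ i ∈ Finset.range (k + 1), d i ≤ ∑ i ∈ Finset.range (k + 1), w i * d i := by
    intro k
    induction k with
    | zero => intro _; simp
    | succ k ih =>
      intro hk
      have h1 := ih (by omega)
      rw [Finset.sum_range_succ (n := k + 1), Finset.sum_range_succ (n := k + 1)]
      have h2 := mul_le_mul_of_nonneg_right (hw k (k + 1) (by omega) (by omega))
        (hd (k + 1) (by omega))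
      linarith
  rcases N with _ | N
  · simp
  · exact (mul_nonneg (hw0 N (by omega)) (hd _ le_rfl)).trans (key N le_rfl)

/-- Weak log-majorization implies the inequality between the sums of `q`-th powers. -/
theorem sum_rpow_le_of_prod_le {x y : ℕ → ℝ} {q : ℝ} (hq : 0 < q) (N : ℕ)
    (hx : ∀ i j, i ≤ j → j < N → x j ≤ x i) (hx0 : ∀ i, 0 ≤ x i) (hy : ∀ i, 0 < y i)
    (h : ∀ k, k ≤ N → (∀ i < k, 0 < x i) →
      ∏ i ∈ Finset.range k, x i ≤ ∏ i ∈ Finset.range k, y i) :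
    ∑ i ∈ Finset.range N, x i ^ q ≤ ∑ i ∈ Finset.range N, y i ^ q := by
  induction N with
  | zero => simp
  | succ N ih =>
    -- If the smallest x vanishes, its term can be dropped; otherwise all x are positive and
    -- logarithms are available.
    rcases (hx0 N).eq_or_lt with h0 | h0
    · rw [Finset.sum_range_succ, Finset.sum_range_succ, ← h0, Real.zero_rpow hq.ne']
      have := ih (fun i j hij hj => hx i j hij (by omega)) (fun k hk => h k (by omega))
      have := Real.rpow_nonneg (hy N).le q
      linarith
    · have hpos : ∀ i, i < N + 1 → 0 < x i := fun i hi =>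
        h0.trans_le (hx i N (by omega) (by omega))
      -- Convexity of exp gives y^q - x^q ≥ q x^q (log y - log x). The weights q x^q are antitone,
      -- and the partial sums of the log differences are nonnegative by hypothesis.
      have habel := sum_mul_nonneg_of_antitone (N := N + 1) (w := fun i => q * x i ^ q)
        (d := fun i => Real.log (y i) - Real.log (x i)) ?_ ?_ ?_
      · rw [← sub_nonneg, ← Finset.sum_sub_distrib]
        refine habel.trans (Finset.sum_le_sum fun i hi => ?_)
        have hxi := hpos i (Finset.mem_range.mp hi)
        rw [Real.rpow_def_of_pos hxi, Real.rpow_def_of_pos (hy i)]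
        have h1 := Real.add_one_le_exp ((Real.log (y i) - Real.log (x i)) * q)
        have h2 : Real.exp (Real.log (y i) * q) = Real.exp (Real.log (x i) * q) *
            Real.exp ((Real.log (y i) - Real.log (x i)) * q) := by
          rw [← Real.exp_add]; congr 1; ring
        rw [h2]
        have h3 := mul_le_mul_of_nonneg_left h1 (Real.exp_pos (Real.log (x i) * q)).le
        linarith
      · intro i j hij hj
        have := Real.rpow_le_rpow (hx0 j) (hx i j hij hj) hq.le
        exact mul_le_mul_of_nonneg_left this hq.le
      · intro i _
        exact mul_nonneg hq.le (Real.rpow_nonneg (hx0 i) q)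
      · intro k hk
        have h1 := h k hk fun i hi => hpos i (by omega)
        have hp : ∀ i ∈ Finset.range k, x i ≠ 0 := fun i hi =>
          (hpos i (by have := Finset.mem_range.mp hi; omega)).ne'
        rw [Finset.sum_sub_distrib, sub_nonneg, ← Real.log_prod hp,
          ← Real.log_prod fun i _ => (hy i).ne']
        exact Real.log_le_log (Finset.prod_pos fun i hi =>
          (hpos i (by have := Finset.mem_range.mp hi; omega))) h1

end Majorization

/-! ### Determinants of compressions by contractions. -/

section Determinant

variable {n k l : Type*} [Fintype n] [DecidableEq n] [Fintype k] [DecidableEq k]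
  [Fintype l] [DecidableEq l]

open scoped MatrixOrder

theorem one_le_det_one_add {N : Matrix n n ℂ} (hN : N.PosSemidef) : 1 ≤ (1 + N).det := by
  have h1 : (1 + N) = eigU hN.1 *
      Matrix.diagonal (fun i => ((1 + hN.1.eigenvalues i : ℝ) : ℂ)) * (eigU hN.1)ᴴ := by
    have h2 : (fun i => ((1 + hN.1.eigenvalues i : ℝ) : ℂ)) =
      fun i => (1 : ℂ) + (hN.1.eigenvalues i : ℂ) := by ext; push_cast; rfl
    rw [h2, ← Matrix.diagonal_add, Matrix.diagonal_one, mul_add, add_mul, Matrix.mul_one,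
      eigU_mul_conjTranspose]
    conv_lhs => rw [eq_conj hN.1]
  rw [h1, Matrix.det_mul_comm, ← Matrix.mul_assoc, eigU_conjTranspose_mul, Matrix.one_mul,
    Matrix.det_diagonal, ← Complex.ofReal_prod, ← Complex.ofReal_one, Complex.real_le_real]
  calc (1 : ℝ) = ∏ _i : n, (1 : ℝ) := by simp
    _ ≤ _ := Finset.prod_le_prod (fun _ _ => zero_le_one) fun i _ => by
      linarith [hN.eigenvalues_nonneg i]

/-- For invertible A with root S one has B = S(1 + N)S with N ≥ 0, and det(1 + N) ≥ 1. -/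
theorem det_le_det_of_le {A B : Matrix n n ℂ} (hA : A.PosSemidef) (h : A ≤ B) :
    A.det ≤ B.det := by
  have hB : B.PosSemidef := Matrix.nonneg_iff_posSemidef.mp (hA.nonneg.trans h)
  by_cases h0 : A.det = 0
  · rw [h0]; exact hB.det_nonneg
  · set S := mpow A (1 / 2) with hS
    have hSS : S * S = A := by
      rw [hS, mpow_mul_mpow hA (by norm_num)]
      norm_num
      exact mpow_one hA
    have hdet : S.det * S.det = A.det := by rw [← Matrix.det_mul, hSS]
    have hu : IsUnit S.det := by
      rw [isUnit_iff_ne_zero]; intro h1; apply h0; rw [← hdet, h1, zero_mul]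
    have hSh : Sᴴ = S := (isHermitian_mpow A _).eq
    set N := S⁻¹ * (B - A) * S⁻¹ with hN
    have hNp : N.PosSemidef := by
      have := Matrix.PosSemidef.mul_mul_conjTranspose_same h S⁻¹
      rwa [Matrix.conjTranspose_nonsing_inv, hSh] at this
    have hBeq : B = S * (1 + N) * S := by
      rw [mul_add, add_mul, Matrix.mul_one, hSS, hN]
      have : S * (S⁻¹ * (B - A) * S⁻¹) * S = (S * S⁻¹) * (B - A) * (S⁻¹ * S) := by
        simp only [Matrix.mul_assoc]
      rw [this, Matrix.mul_nonsing_inv _ hu, Matrix.nonsing_inv_mul _ hu]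
      simp
    rw [hBeq, Matrix.det_mul, Matrix.det_mul, mul_right_comm, hdet]
    exact le_mul_of_one_le_right hA.det_nonneg (one_le_det_one_add hNp)

/-- Contractions between finite-dimensional Hilbert spaces. -/
def IsContraction (M : Matrix n k ℂ) : Prop := Mᴴ * M ≤ 1

theorem conjTranspose_mul_mul_mono {A B : Matrix n n ℂ} (h : A ≤ B) (M : Matrix n k ℂ) :
    Mᴴ * A * M ≤ Mᴴ * B * M := by
  rw [Matrix.le_iff] at h ⊢
  have := h.conjTranspose_mul_mul_same M
  rwa [Matrix.mul_sub, Matrix.sub_mul] at this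

theorem IsContraction.mul {M : Matrix n k ℂ} {N : Matrix k l ℂ} (hM : IsContraction M)
    (hN : IsContraction N) : IsContraction (M * N) := by
  have h1 := conjTranspose_mul_mul_mono hM N
  rw [Matrix.mul_one] at h1
  refine le_trans (le_of_eq ?_) (h1.trans hN)
  rw [Matrix.conjTranspose_mul]
  simp only [Matrix.mul_assoc]

theorem isContraction_of_isometry {V : Matrix n k ℂ} (h : Vᴴ * V = 1) : IsContraction V :=
  h.le

/-- P = MMᴴ satisfies P² = M(MᴴM)Mᴴ ≤ P, so its eigenvalues satisfy λ² ≤ λ and hence λ ≤ 1. -/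
theorem IsContraction.conjTranspose {M : Matrix n k ℂ} (h : IsContraction M) :
    IsContraction Mᴴ := by
  rw [IsContraction, Matrix.conjTranspose_conjTranspose]
  set P := M * Mᴴ with hP
  have hPp : P.PosSemidef := Matrix.posSemidef_self_mul_conjTranspose M
  have h1 : P * P ≤ P := by
    have := conjTranspose_mul_mul_mono h Mᴴ
    rw [Matrix.conjTranspose_conjTranspose, Matrix.mul_one] at this
    refine le_trans (le_of_eq ?_) this
    simp only [hP, Matrix.mul_assoc]
  set U := eigU hPp.1
  set D := Matrix.diagonal (fun i => (hPp.1.eigenvalues i : ℂ)) with hD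
  have hPU : P = U * D * Uᴴ := eq_conj hPp.1
  have hUU : Uᴴ * U = 1 := eigU_conjTranspose_mul hPp.1
  have h2 := conjTranspose_mul_mul_mono h1 U
  have e1 : Uᴴ * P * U = D := by
    rw [hPU]
    have : Uᴴ * (U * D * Uᴴ) * U = (Uᴴ * U) * D * (Uᴴ * U) := by simp only [Matrix.mul_assoc]
    rw [this, hUU, Matrix.one_mul, Matrix.mul_one]
  have e2 : Uᴴ * (P * P) * U = D * D := by
    have : Uᴴ * (P * P) * U = (Uᴴ * P * (U * Uᴴ) * P * U) := by
      rw [eigU_mul_conjTranspose hPp.1]; simp only [Matrix.mul_assoc, Matrix.one_mul]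
    rw [this]
    have : Uᴴ * P * (U * Uᴴ) * P * U = (Uᴴ * P * U) * (Uᴴ * P * U) := by
      simp only [Matrix.mul_assoc]
    rw [this, e1]
  rw [e1, e2, Matrix.le_iff, hD, Matrix.diagonal_mul_diagonal, Matrix.diagonal_sub,
    Matrix.posSemidef_diagonal_iff] at h2
  have h3 : P ≤ U * 1 * Uᴴ := by
    conv_lhs => rw [hPU]
    rw [Matrix.le_iff, ← Matrix.sub_mul, ← Matrix.mul_sub, hD, ← Matrix.diagonal_one,
      Matrix.diagonal_sub]
    refine Matrix.PosSemidef.mul_mul_conjTranspose_same (Matrix.PosSemidef.diagonal ?_) _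
    intro i
    have h4 := h2 i
    rw [← Complex.ofReal_mul, ← Complex.ofReal_sub, Complex.zero_le_real] at h4
    have h5 := hPp.eigenvalues_nonneg i
    have h6 : hPp.1.eigenvalues i ≤ 1 := by nlinarith
    show (0 : ℂ) ≤ 1 - (hPp.1.eigenvalues i : ℂ)
    rw [← Complex.ofReal_one, ← Complex.ofReal_sub, Complex.zero_le_real]
    linarith
  rwa [Matrix.mul_one, eigU_mul_conjTranspose] at h3

theorem det_conjTranspose_mul_self_le_one {M : Matrix n k ℂ} (hM : IsContraction M) :
    (Mᴴ * M).det ≤ 1 := by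
  have := det_le_det_of_le (Matrix.posSemidef_conjTranspose_mul_self M) hM
  rwa [Matrix.det_one] at this

theorem normSq_det (M : Matrix k k ℂ) : ((Complex.normSq M.det : ℝ) : ℂ) = (Mᴴ * M).det := by
  rw [Matrix.det_mul, Matrix.det_conjTranspose, Complex.normSq_eq_conj_mul_self]
  rfl

/-- Compressions by a contraction onto a `k`-dimensional space have determinant at most the
product of the `k` largest eigenvalues. -/
theorem det_compression_le {H : Matrix n n ℂ} (hH : H.PosSemidef) (e : k ↪ n) {ν : n → ℝ} {c : ℝ}
    (hc : 0 < c) (hν : ∀ i, hH.1.eigenvalues i ≤ ν i) (h1 : ∀ i, c ≤ ν i)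
    (h2 : ∀ i, i ∉ Set.range e → ν i = c) {W : Matrix n k ℂ} (hW : IsContraction W) :
    (Wᴴ * H * W).det ≤ ((∏ i, ν (e i) : ℝ) : ℂ) := by
  set U := eigU hH.1 with hU
  -- Enlarging the eigenvalues to ν gives H ≤ c(1 + U_k G² U_kᴴ), a multiple of the identity up to a
  -- correction living on the k selected eigenvectors, with G² = ν/c - 1.
  set g : k → ℝ := fun i => Real.sqrt (ν (e i) / c - 1) with hg
  have hg2 : ∀ i, g i * g i = ν (e i) / c - 1 := fun i => by
    rw [hg, Real.mul_self_sqrt]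
    rw [sub_nonneg, one_le_div hc]
    exact h1 _
  set Uk : Matrix n k ℂ := U.submatrix id e with hUk
  have hUkiso : Ukᴴ * Uk = 1 := by
    ext i j
    have := congrFun (congrFun (eigU_conjTranspose_mul hH.1) (e i)) (e j)
    rw [Matrix.mul_apply] at this ⊢
    simp only [Matrix.conjTranspose_apply, hUk, Matrix.submatrix_apply, id] at this ⊢
    rw [this, Matrix.one_apply, Matrix.one_apply]
    simp
  set G : Matrix k k ℂ := Matrix.diagonal fun i => (g i : ℂ) with hG
  have hGh : Gᴴ = G := by
    rw [hG, Matrix.diagonal_conjTranspose]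
    congr 1; ext i; simp
  have hUν : U * Matrix.diagonal (fun i => (ν i : ℂ)) * Uᴴ =
      (c : ℂ) • (1 + Uk * (G * G) * Ukᴴ) := by
    rw [hG, Matrix.diagonal_mul_diagonal]
    ext i j
    rw [Matrix.mul_apply, Matrix.smul_apply, Matrix.add_apply, Matrix.mul_apply,
      ← eigU_mul_conjTranspose hH.1, Matrix.mul_apply]
    simp only [Matrix.mul_diagonal, Matrix.conjTranspose_apply, hUk, Matrix.submatrix_apply, id,
      ← hU, smul_eq_mul]
    have h3 : ∑ x, U i (e x) * ((g x : ℂ) * (g x : ℂ)) * star (U j (e x)) =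
        ∑ x, U i x * (ν x / c - 1 : ℂ) * star (U j x) := by
      have : ∀ x, ((g x : ℂ) * (g x : ℂ)) = (ν (e x) / c - 1 : ℂ) := by
        intro x; exact_mod_cast hg2 x
      simp only [this]
      rw [← Finset.sum_map Finset.univ e (fun x => U i x * (ν x / c - 1 : ℂ) * star (U j x))]
      refine Finset.sum_subset (Finset.subset_univ _) fun x _ hx => ?_
      have hx' : x ∉ Set.range e := by simpa using hx
      rw [h2 x hx', div_self (by exact_mod_cast hc.ne')]
      simp
    rw [h3, ← Finset.sum_add_distrib, Finset.mul_sum]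
    refine Finset.sum_congr rfl fun x _ => ?_
    have hc' : (c : ℂ) ≠ 0 := by exact_mod_cast hc.ne'
    field_simp
    ring
  have hle : H ≤ (c : ℂ) • (1 + Uk * (G * G) * Ukᴴ) := by
    rw [← hUν]
    conv_lhs => rw [eq_conj hH.1]
    rw [Matrix.le_iff, ← sub_mul, ← mul_sub, Matrix.diagonal_sub]
    refine Matrix.PosSemidef.mul_mul_conjTranspose_same (Matrix.PosSemidef.diagonal ?_) _
    intro i
    simpa using hν i
  have hT : IsContraction (Ukᴴ * W) := (isContraction_of_isometry hUkiso).conjTranspose.mul hW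
  set T := Ukᴴ * W with hTdef
  have hle2 : Wᴴ * H * W ≤ (c : ℂ) • (1 + (G * T)ᴴ * (G * T)) := by
    refine (conjTranspose_mul_mul_mono hle W).trans ?_
    have : Wᴴ * ((c : ℂ) • (1 + Uk * (G * G) * Ukᴴ)) * W =
        (c : ℂ) • (Wᴴ * W + (G * T)ᴴ * (G * T)) := by
      rw [Matrix.mul_smul, Matrix.smul_mul, Matrix.mul_add, Matrix.add_mul, Matrix.mul_one,
        Matrix.conjTranspose_mul, hGh, hTdef, Matrix.conjTranspose_mul,
        Matrix.conjTranspose_conjTranspose]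
      simp only [Matrix.mul_assoc]
    rw [this, Matrix.le_iff, ← smul_sub, add_sub_add_right_eq_sub]
    exact Matrix.PosSemidef.smul hW (by exact_mod_cast hc.le)
  refine (det_le_det_of_le (hH.conjTranspose_mul_mul_same W) hle2).trans ?_
  -- Sylvester's identity replaces 1 + (GT)ᴴ(GT) by 1 + G T Tᴴ G. This is at most the diagonal
  -- matrix 1 + G², because T is a contraction.
  rw [Matrix.det_smul, Matrix.det_one_add_mul_comm]
  have hle3 : 1 + G * T * (G * T)ᴴ ≤ 1 + G * G := by
    have hTT : T * Tᴴ ≤ 1 := by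
      have := hT.conjTranspose
      rwa [IsContraction, Matrix.conjTranspose_conjTranspose] at this
    have := conjTranspose_mul_mul_mono hTT G
    rw [Matrix.conjTranspose_mul]
    rw [hGh] at this ⊢
    simp only [Matrix.mul_assoc, Matrix.mul_one] at this ⊢
    rw [Matrix.le_iff] at this ⊢
    rwa [add_sub_add_left_eq_sub]
  have hpsd : (1 + G * T * (G * T)ᴴ).PosSemidef :=
    Matrix.PosSemidef.one.add (Matrix.posSemidef_self_mul_conjTranspose _)
  have h4 := det_le_det_of_le hpsd hle3
  have h5 : (1 + G * G).det = ∏ i, ((ν (e i) / c : ℝ) : ℂ) := by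
    rw [hG, Matrix.diagonal_mul_diagonal, ← Matrix.diagonal_one, Matrix.diagonal_add,
      Matrix.det_diagonal]
    refine Finset.prod_congr rfl fun i _ => ?_
    have : ((g i : ℂ) * (g i : ℂ)) = ((ν (e i) / c - 1 : ℝ) : ℂ) := by exact_mod_cast hg2 i
    rw [this]; push_cast; ring
  rw [h5] at h4
  refine (mul_le_mul_of_nonneg_left h4 (by exact_mod_cast (pow_pos hc _).le)).trans
    (le_of_eq ?_)
  rw [← Complex.ofReal_prod, ← Complex.ofReal_pow, ← Complex.ofReal_mul]
  congr 1
  rw [Finset.prod_div_distrib, Finset.prod_const, Finset.card_univ, mul_div_assoc',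
    mul_div_cancel_left₀ _ (pow_pos hc _).ne']

end Determinant

/-! ### Ordered eigenvalues, complex powers and bounded analytic functions on the strip. -/

section ThreeLines

variable {n k : Type*} [Fintype n] [DecidableEq n] [Fintype k] [DecidableEq k]

open scoped MatrixOrder

theorem trace_cfc {A : Matrix n n ℂ} (hA : A.IsHermitian) (f : ℝ → ℝ) :
    (cfc f A).trace = ((∑ i, f (hA.eigenvalues i) : ℝ) : ℂ) := by
  rw [cfc_eq_conj hA, Matrix.trace_mul_comm, ← Matrix.mul_assoc, eigU_conjTranspose_mul,
    Matrix.one_mul, Matrix.trace_diagonal, Complex.ofReal_sum]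

/-- The eigenvalues in decreasing order, extended by zero. -/
def sortedEig {A : Matrix n n ℂ} (hA : A.IsHermitian) (i : ℕ) : ℝ :=
  if h : i < Fintype.card n then hA.eigenvalues₀ ⟨i, h⟩ else 0

/-- The enumeration of the eigenvalues in decreasing order. -/
def eigEquiv (n : Type*) [Fintype n] [DecidableEq n] : Fin (Fintype.card n) ≃ n :=
  Fintype.equivOfCardEq (Fintype.card_fin _)

theorem eigenvalues_eigEquiv {A : Matrix n n ℂ} (hA : A.IsHermitian) (i : Fin (Fintype.card n)) :
    hA.eigenvalues (eigEquiv n i) = sortedEig hA i := by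
  simp [sortedEig, Matrix.IsHermitian.eigenvalues, eigEquiv]

theorem sum_sortedEig {A : Matrix n n ℂ} (hA : A.IsHermitian) (f : ℝ → ℝ) :
    ∑ i ∈ Finset.range (Fintype.card n), f (sortedEig hA i) = ∑ i, f (hA.eigenvalues i) := by
  rw [← (eigEquiv n).sum_comp, Finset.sum_range]
  simp only [eigenvalues_eigEquiv]

theorem sortedEig_antitone {A : Matrix n n ℂ} (hA : A.IsHermitian) (i j : ℕ) (hij : i ≤ j)
    (hj : j < Fintype.card n) : sortedEig hA j ≤ sortedEig hA i := by
  rw [sortedEig, sortedEig, dif_pos hj, dif_pos (hij.trans_lt hj)]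
  exact hA.eigenvalues₀_antitone (by simpa using hij)

theorem sortedEig_nonneg {A : Matrix n n ℂ} (hA : A.PosSemidef) (i : ℕ) :
    0 ≤ sortedEig hA.1 i := by
  by_cases h : i < Fintype.card n
  · have := eigenvalues_eigEquiv hA.1 ⟨i, h⟩
    rw [← this]
    exact hA.eigenvalues_nonneg _
  · rw [sortedEig, dif_neg h]

/-- The indices of the `k` largest eigenvalues. -/
def topEig (n : Type*) [Fintype n] [DecidableEq n] {k : ℕ} (hk : k ≤ Fintype.card n) :
    Fin k ↪ n :=
  (Fin.castLEEmb hk).trans (eigEquiv n).toEmbedding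

theorem eigenvalues_topEig {A : Matrix n n ℂ} (hA : A.IsHermitian) {k : ℕ}
    (hk : k ≤ Fintype.card n) (i : Fin k) :
    hA.eigenvalues (topEig n hk i) = sortedEig hA i :=
  eigenvalues_eigEquiv hA _

/-- The cutoff ε keeps the constant c of `det_compression_le` positive even when fewer than k
eigenvalues are nonzero. -/
theorem det_compression_le_prod_sortedEig {H : Matrix n n ℂ} (hH : H.PosSemidef) {k : ℕ}
    (hk : k ≤ Fintype.card n) {ε : ℝ} (hε : 0 < ε) {W : Matrix n (Fin k) ℂ}
    (hW : IsContraction W) :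
    (Wᴴ * H * W).det ≤ ((∏ i ∈ Finset.range k, max (sortedEig hH.1 i) ε : ℝ) : ℂ) := by
  rcases k with _ | k
  · simp
  · set c := max (sortedEig hH.1 k) ε with hc
    have h1 := det_compression_le hH (topEig n hk) (ν := fun j => max (hH.1.eigenvalues j) c)
      (c := c) (lt_max_of_lt_right hε) (fun i => le_max_left _ _) (fun i => le_max_right _ _)
      ?_ hW
    · refine h1.trans (le_of_eq ?_)
      rw [Finset.prod_range]
      congr 1
      refine Finset.prod_congr rfl fun i _ => ?_
      rw [eigenvalues_topEig, hc, ← max_assoc, max_eq_left (sortedEig_antitone hH.1 i k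
        (by omega) (by omega))]
    · intro j hj
      obtain ⟨i, rfl⟩ := (eigEquiv n).surjective j
      have hik : k ≤ (i : ℕ) := by
        by_contra! hlt
        exact hj ⟨⟨i, by omega⟩, rfl⟩
      simp only [eigenvalues_eigEquiv]
      exact max_eq_right ((sortedEig_antitone hH.1 k i hik i.2).trans (le_max_left _ _))

/-- Isometries realizing the product of the `k` largest squared singular values. -/
theorem exists_isometry_det_eq (X : Matrix n n ℂ) {k : ℕ} (hk : k ≤ Fintype.card n)
    (hpos : ∀ i < k, 0 < sortedEig (Matrix.isHermitian_conjTranspose_mul_self X) i) :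
    ∃ V W : Matrix n (Fin k) ℂ, Vᴴ * V = 1 ∧ Wᴴ * W = 1 ∧
      Complex.normSq (Vᴴ * X * W).det =
        ∏ i ∈ Finset.range k, sortedEig (Matrix.isHermitian_conjTranspose_mul_self X) i := by
  set hH := Matrix.isHermitian_conjTranspose_mul_self X
  set e := topEig n hk
  set W : Matrix n (Fin k) ℂ := (eigU hH).submatrix id e with hWdef
  set r : Fin k → ℝ := fun i => Real.sqrt (sortedEig hH i) with hr
  have hrpos : ∀ i, 0 < r i := fun i => Real.sqrt_pos.mpr (hpos i i.2)
  have hrr : ∀ i : Fin k, r i * r i = sortedEig hH i := fun i => Real.mul_self_sqrt (hpos i i.2).le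
  have key : ∀ f : ℝ → ℝ, Wᴴ * (cfc f (Xᴴ * X)) * W =
      Matrix.diagonal fun i : Fin k => (f (sortedEig hH i) : ℂ) := by
    intro f
    have h1 : (eigU hH)ᴴ * cfc f (Xᴴ * X) * eigU hH =
        Matrix.diagonal (fun i => (f (hH.eigenvalues i) : ℂ)) := by
      rw [eigU_conjTranspose_mul_cfc, Matrix.mul_assoc, eigU_conjTranspose_mul, Matrix.mul_one]
    have h2 : Wᴴ * (cfc f (Xᴴ * X)) * W =
        ((eigU hH)ᴴ * cfc f (Xᴴ * X) * eigU hH).submatrix e e := by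
      rw [hWdef, Matrix.conjTranspose_submatrix]
      rfl
    rw [h2, h1, Matrix.submatrix_diagonal_embedding]
    congr 1
    ext i
    simp only [Function.comp]
    rw [eigenvalues_topEig]
  have hW : Wᴴ * W = 1 := by
    have := key (fun _ => 1)
    rw [cfc_const_one ℝ _ hH.isSelfAdjoint, Matrix.mul_one] at this
    rw [this]; simp
  have hWH : Wᴴ * (Xᴴ * X) * W = Matrix.diagonal fun i : Fin k => (sortedEig hH i : ℂ) := by
    have := key id
    rwa [cfc_id ℝ _ hH.isSelfAdjoint] at this
  set D : Matrix (Fin k) (Fin k) ℂ := Matrix.diagonal fun i => ((r i)⁻¹ : ℂ) with hD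
  have hDh : Dᴴ = D := by
    rw [hD, Matrix.diagonal_conjTranspose]; congr 1; ext i; simp
  have hr0 : ∀ i, (r i : ℂ) ≠ 0 := fun i => by exact_mod_cast (hrpos i).ne'
  have hrrc : ∀ i : Fin k, (sortedEig hH i : ℂ) = r i * r i := fun i => by
    rw [← Complex.ofReal_mul, hrr]
  -- W holds right singular vectors; X W divided by the singular values holds the matching left
  -- ones.
  refine ⟨X * W * D, W, ?_, hW, ?_⟩
  · have : (X * W * D)ᴴ * (X * W * D) = D * (Wᴴ * (Xᴴ * X) * W) * D := by
      rw [Matrix.conjTranspose_mul, Matrix.conjTranspose_mul, hDh]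
      simp only [Matrix.mul_assoc]
    rw [this, hWH, hD, Matrix.diagonal_mul_diagonal, Matrix.diagonal_mul_diagonal,
      ← Matrix.diagonal_one]
    congr 1; ext i
    rw [hrrc]
    have := hr0 i
    field_simp
  · have : (X * W * D)ᴴ * X * W = D * (Wᴴ * (Xᴴ * X) * W) := by
      rw [Matrix.conjTranspose_mul, Matrix.conjTranspose_mul, hDh]
      simp only [Matrix.mul_assoc]
    rw [this, hWH, hD, Matrix.diagonal_mul_diagonal, Matrix.det_diagonal, map_prod,
      Finset.prod_range]
    refine Finset.prod_congr rfl fun i _ => ?_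
    rw [hrrc, ← mul_assoc, inv_mul_cancel₀ (hr0 i), one_mul, Complex.normSq_ofReal, hrr]

/-- Complex powers on the support; an entire function of the exponent. -/
def epow {A : Matrix n n ℂ} (hA : A.IsHermitian) (z : ℂ) : Matrix n n ℂ :=
  eigU hA * Matrix.diagonal (fun i => if hA.eigenvalues i = 0 then 0 else
    Complex.exp (z * Real.log (hA.eigenvalues i))) * (eigU hA)ᴴ

theorem epow_add {A : Matrix n n ℂ} (hA : A.IsHermitian) (z w : ℂ) :
    epow hA (z + w) = epow hA z * epow hA w := by
  have : epow hA z * epow hA w = eigU hA * (Matrix.diagonal (fun i =>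
      if hA.eigenvalues i = 0 then 0 else Complex.exp (z * Real.log (hA.eigenvalues i))) *
      (((eigU hA)ᴴ * eigU hA) * Matrix.diagonal (fun i => if hA.eigenvalues i = 0 then 0 else
      Complex.exp (w * Real.log (hA.eigenvalues i))))) * (eigU hA)ᴴ := by
    simp only [epow, Matrix.mul_assoc]
  rw [this, eigU_conjTranspose_mul, Matrix.one_mul, Matrix.diagonal_mul_diagonal, epow]
  congr 3
  ext i
  split_ifs
  · simp
  · rw [← Complex.exp_add]; ring_nf

theorem epow_ofReal {A : Matrix n n ℂ} (hA : A.PosSemidef) {x : ℝ} (hx : x ≠ 0) :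
    epow hA.1 (x : ℂ) = mpow A x := by
  rw [mpow, cfc_eq_conj hA.1, epow]
  congr 3
  ext i
  split_ifs with h
  · rw [h, Real.zero_rpow hx]; simp
  · rw [Real.rpow_def_of_pos (lt_of_le_of_ne (hA.eigenvalues_nonneg i) (Ne.symm h))]
    push_cast
    rw [mul_comm]

/-- On the imaginary axis the scalars have modulus 1 on the support and are 0 on the kernel, so the
power is a partial isometry. -/
theorem isContraction_epow {A : Matrix n n ℂ} (hA : A.IsHermitian) {z : ℂ} (hz : z.re = 0) :
    IsContraction (epow hA z) := by
  have h1 : (epow hA z)ᴴ * epow hA z = eigU hA * Matrix.diagonal (fun i =>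
      if hA.eigenvalues i = 0 then (0 : ℂ) else 1) * (eigU hA)ᴴ := by
    rw [epow, Matrix.conjTranspose_mul, Matrix.conjTranspose_mul,
      Matrix.conjTranspose_conjTranspose]
    have : ∀ D E : Matrix n n ℂ, eigU hA * (D * (eigU hA)ᴴ) * (eigU hA * E * (eigU hA)ᴴ) =
      eigU hA * (D * (((eigU hA)ᴴ * eigU hA) * E)) * (eigU hA)ᴴ := by
        intro D E; simp only [Matrix.mul_assoc]
    rw [this, eigU_conjTranspose_mul, Matrix.one_mul, Matrix.diagonal_conjTranspose,
      Matrix.diagonal_mul_diagonal]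
    congr 3
    ext i
    simp only [Pi.star_apply]
    split_ifs
    · simp
    · rw [Complex.star_def, ← Complex.normSq_eq_conj_mul_self, Complex.normSq_eq_norm_sq,
        Complex.norm_exp]
      simp [hz]
  rw [IsContraction, h1, Matrix.le_iff]
  have h2 : (1 : Matrix n n ℂ) = eigU hA * Matrix.diagonal (fun _ => 1) * (eigU hA)ᴴ := by
    rw [Matrix.diagonal_one, Matrix.mul_one, eigU_mul_conjTranspose]
  rw [h2, ← Matrix.sub_mul, ← Matrix.mul_sub, Matrix.diagonal_sub]
  refine Matrix.PosSemidef.mul_mul_conjTranspose_same (Matrix.PosSemidef.diagonal ?_) _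
  intro i
  simp only [Pi.zero_apply]
  split_ifs <;> simp

/-- Entire functions that are bounded on the strip `0 ≤ re z ≤ 1`. -/
def stripBounded : Subalgebra ℂ (ℂ → ℂ) where
  carrier := {f | Differentiable ℂ f ∧ ∃ C : ℝ, ∀ z : ℂ, 0 ≤ z.re → z.re ≤ 1 → ‖f z‖ ≤ C}
  mul_mem' := by
    rintro f g ⟨hf, C, hC⟩ ⟨hg, D, hD⟩
    refine ⟨hf.mul hg, C * D, fun z h0 h1 => ?_⟩
    rw [Pi.mul_apply, norm_mul]
    exact mul_le_mul (hC z h0 h1) (hD z h0 h1) (norm_nonneg _) ((norm_nonneg _).trans (hC z h0 h1))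
  add_mem' := by
    rintro f g ⟨hf, C, hC⟩ ⟨hg, D, hD⟩
    exact ⟨hf.add hg, C + D, fun z h0 h1 =>
      (norm_add_le _ _).trans (add_le_add (hC z h0 h1) (hD z h0 h1))⟩
  algebraMap_mem' := fun r => ⟨differentiable_const r, ‖r‖, fun _ _ _ => le_rfl⟩

theorem const_mem_stripBounded (c : ℂ) : (fun _ => c) ∈ stripBounded :=
  stripBounded.algebraMap_mem c

theorem sum_mem_stripBounded {ι : Type*} (s : Finset ι) {f : ι → ℂ → ℂ}
    (h : ∀ i ∈ s, f i ∈ stripBounded) : (fun z => ∑ i ∈ s, f i z) ∈ stripBounded := by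
  have := stripBounded.sum_mem h
  convert this using 1
  ext z; simp

theorem matrix_mul_mem_stripBounded {n k l : Type*} [Fintype k] {F : ℂ → Matrix n k ℂ}
    {G : ℂ → Matrix k l ℂ} (hF : ∀ i j, (fun z => F z i j) ∈ stripBounded)
    (hG : ∀ i j, (fun z => G z i j) ∈ stripBounded) (i : n) (j : l) :
    (fun z => (F z * G z) i j) ∈ stripBounded := by
  simp only [Matrix.mul_apply]
  exact sum_mem_stripBounded _ fun x _ => stripBounded.mul_mem (hF i x) (hG x j)

theorem det_mem_stripBounded {F : ℂ → Matrix k k ℂ}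
    (hF : ∀ i j, (fun z => F z i j) ∈ stripBounded) : (fun z => (F z).det) ∈ stripBounded := by
  simp only [Matrix.det_apply']
  refine sum_mem_stripBounded (f := fun (σ : Equiv.Perm k) z =>
    ((Equiv.Perm.sign σ : ℤ) : ℂ) * ∏ i, F z (σ i) i) _ fun σ _ => ?_
  have h1 : (fun z => ∏ i, F z (σ i) i) ∈ stripBounded := by
    have := stripBounded.prod_mem (t := Finset.univ) fun (i : k) _ => hF (σ i) i
    convert this using 1
    ext z; simp
  exact stripBounded.mul_mem (const_mem_stripBounded _) h1

/-- The argument z / 2 makes the edge re z = 1 of the unit strip correspond to square roots. -/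
theorem epow_mem_stripBounded {A : Matrix n n ℂ} (hA : A.IsHermitian) (i j : n) :
    (fun z => epow hA (z / 2) i j) ∈ stripBounded := by
  unfold epow
  refine matrix_mul_mem_stripBounded (F := fun z => eigU hA * Matrix.diagonal (fun i =>
      if hA.eigenvalues i = 0 then 0 else Complex.exp (z / 2 * Real.log (hA.eigenvalues i))))
    (G := fun _ => (eigU hA)ᴴ) (matrix_mul_mem_stripBounded (F := fun _ => eigU hA)
    (fun _ _ => const_mem_stripBounded _) ?_) (fun _ _ => const_mem_stripBounded _) i j
  intro i j
  by_cases hij : i = j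
  · subst hij
    simp only [Matrix.diagonal_apply_eq]
    split_ifs with h
    · exact const_mem_stripBounded 0
    · refine ⟨by fun_prop, Real.exp |Real.log (hA.eigenvalues i)|, fun z h0 h1 => ?_⟩
      rw [Complex.norm_exp, Real.exp_le_exp]
      have : (z / 2 * (Real.log (hA.eigenvalues i) : ℂ)).re =
          z.re / 2 * Real.log (hA.eigenvalues i) := by
        rw [Complex.re_mul_ofReal]; simp
      rw [this]
      refine (le_abs_self _).trans ?_
      rw [abs_mul]
      refine mul_le_of_le_one_left (abs_nonneg _) ?_
      rw [abs_of_nonneg (by linarith)]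
      linarith
  · simp only [Matrix.diagonal_apply_ne _ hij]
    exact const_mem_stripBounded 0

end ThreeLines

/-! ### The Araki-Lieb-Thirring inequality. -/

section ArakiLiebThirring

variable {n k : Type*} [Fintype n] [DecidableEq n] [Fintype k] [DecidableEq k]

open scoped MatrixOrder

theorem normSq_det_le_one {G : Matrix k k ℂ} (hG : IsContraction G) :
    Complex.normSq G.det ≤ 1 := by
  have := det_conjTranspose_mul_self_le_one hG
  rwa [← normSq_det, ← Complex.ofReal_one, Complex.real_le_real] at this

/-- A contraction on the left only decreases the Gram matrix, so it can be discarded. -/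
theorem normSq_det_le {C : Matrix k n ℂ} {Y : Matrix n n ℂ} {W : Matrix n k ℂ}
    (hC : IsContraction C) {b : ℝ} (h : (Wᴴ * (Yᴴ * Y) * W).det ≤ (b : ℂ)) :
    Complex.normSq (C * Y * W).det ≤ b := by
  have h1 : (C * Y * W)ᴴ * (C * Y * W) ≤ Wᴴ * (Yᴴ * Y) * W := by
    have := conjTranspose_mul_mul_mono hC (Y * W)
    rw [Matrix.mul_one] at this
    simpa only [Matrix.conjTranspose_mul, Matrix.mul_assoc] using this
  have h2 := (det_le_det_of_le (Matrix.posSemidef_conjTranspose_mul_self _) h1).trans h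
  rwa [← normSq_det, Complex.real_le_real] at h2

/-- The log-majorization behind the Araki-Lieb-Thirring inequality. -/
theorem prod_sortedEig_le {a b : Matrix n n ℂ} (ha : a.PosSemidef) (hb : b.PosSemidef)
    {θ : ℝ} (h0 : 0 < θ) (h1 : θ ≤ 1) {ε : ℝ} (hε : 0 < ε) {k : ℕ} (hk : k ≤ Fintype.card n)
    (hpos : ∀ i < k, 0 < sortedEig
      (Matrix.isHermitian_conjTranspose_mul_self (mpow a (θ / 2) * mpow b (θ / 2))) i) :
    ∏ i ∈ Finset.range k, sortedEig
      (Matrix.isHermitian_conjTranspose_mul_self (mpow a (θ / 2) * mpow b (θ / 2))) i ≤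
    ∏ i ∈ Finset.range k, (max (sortedEig (Matrix.isHermitian_conjTranspose_mul_self
      (mpow a (1 / 2) * mpow b (1 / 2))) i) ε) ^ θ := by
  obtain ⟨V, W, hV, hW, hVW⟩ := exists_isometry_det_eq (mpow a (θ / 2) * mpow b (θ / 2)) hk hpos
  rw [← hVW]
  set Y := mpow a (1 / 2) * mpow b (1 / 2) with hY
  have hYp := Matrix.posSemidef_conjTranspose_mul_self Y
  set P := ∏ i ∈ Finset.range k, max (sortedEig hYp.1 i) ε with hP
  have hPpos : 0 < P := Finset.prod_pos fun i _ => lt_max_of_lt_right hε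
  -- f is the analytic interpolation: |f(θ)|² is the product to be bounded, f is the determinant of
  -- a contraction on re z = 0, and on re z = 1 it is controlled by the singular values of Y.
  set f : ℂ → ℂ := fun z => (Vᴴ * epow ha.1 (z / 2) * epow hb.1 (z / 2) * W).det with hf
  have hVc : IsContraction Vᴴ := (isContraction_of_isometry hV).conjTranspose
  have hWc : IsContraction W := isContraction_of_isometry hW
  have hfm : f ∈ stripBounded := by
    refine det_mem_stripBounded fun i j => ?_
    refine matrix_mul_mem_stripBounded
      (F := fun z => Vᴴ * epow ha.1 (z / 2) * epow hb.1 (z / 2)) (G := fun _ => W)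
      (matrix_mul_mem_stripBounded (F := fun z => Vᴴ * epow ha.1 (z / 2))
        (matrix_mul_mem_stripBounded (F := fun _ => Vᴴ) (fun _ _ => const_mem_stripBounded _)
          (epow_mem_stripBounded ha.1)) (epow_mem_stripBounded hb.1))
      (fun _ _ => const_mem_stripBounded _) i j
  obtain ⟨hd, C, hC⟩ := hfm
  have hleft : ∀ z : ℂ, z.re = 0 → ‖f z‖ ≤ 1 := by
    intro z hz
    have hz2 : (z / 2).re = 0 := by simp [hz]
    have := normSq_det_le_one (((hVc.mul (isContraction_epow ha.1 hz2)).mul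
      (isContraction_epow hb.1 hz2)).mul hWc)
    rw [Complex.normSq_eq_norm_sq] at this
    exact (sq_le_one_iff₀ (norm_nonneg _)).mp this
  have hright : ∀ z : ℂ, z.re = 1 → ‖f z‖ ≤ Real.sqrt P := by
    intro z hz
    -- The imaginary powers split off as contractions on the outer sides, leaving Y in the middle.
    set w : ℂ := z / 2 - (1 / 2 : ℝ) with hw
    have hw2 : w.re = 0 := by rw [hw, Complex.sub_re]; simp [hz]
    have e1 : epow ha.1 (z / 2) = epow ha.1 w * mpow a (1 / 2) := by
      rw [← epow_ofReal ha (by norm_num), ← epow_add, hw]; congr 1; ring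
    have e2 : epow hb.1 (z / 2) = mpow b (1 / 2) * epow hb.1 w := by
      rw [← epow_ofReal hb (by norm_num), ← epow_add, hw]; congr 1; ring
    have e3 : f z = ((Vᴴ * epow ha.1 w) * Y * (epow hb.1 w * W)).det := by
      simp only [hf, e1, e2, hY, Matrix.mul_assoc]
    have h2 := det_compression_le_prod_sortedEig hYp hk hε
      ((isContraction_epow hb.1 hw2).mul hWc)
    have h3 := normSq_det_le (hVc.mul (isContraction_epow ha.1 hw2)) h2
    rw [← e3, Complex.normSq_eq_norm_sq] at h3
    exact Real.le_sqrt_of_sq_le h3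
  have h3l := Complex.HadamardThreeLines.norm_le_interp_of_mem_verticalClosedStrip₀₁' f
    (z := (θ : ℂ)) (a := 1) (b := Real.sqrt P)
    (by simp only [Complex.HadamardThreeLines.verticalClosedStrip, Set.mem_preimage,
          Complex.ofReal_re, Set.mem_Icc]; exact ⟨h0.le, h1⟩)
    hd.diffContOnCl
    (by
      refine ⟨C, ?_⟩
      rintro _ ⟨z, hz, rfl⟩
      exact hC z hz.1 hz.2)
    (fun z hz => hleft z hz) (fun z hz => hright z hz)
  rw [Complex.ofReal_re, Real.one_rpow, one_mul] at h3l
  have hfθ : f θ = (Vᴴ * (mpow a (θ / 2) * mpow b (θ / 2)) * W).det := by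
    have : (θ : ℂ) / 2 = ((θ / 2 : ℝ) : ℂ) := by push_cast; ring
    simp only [hf]
    rw [this, epow_ofReal ha (by positivity), epow_ofReal hb (by positivity)]
    simp only [Matrix.mul_assoc]
  rw [← hfθ, Complex.normSq_eq_norm_sq, Real.finsetProd_rpow _ _ fun i _ =>
    (lt_max_of_lt_right hε).le]
  calc ‖f θ‖ ^ 2 ≤ (Real.sqrt P ^ θ) ^ 2 := by gcongr
    _ = P ^ θ := by
      rw [← Real.rpow_natCast, ← Real.rpow_mul (Real.sqrt_nonneg _), mul_comm,
        Real.rpow_mul (Real.sqrt_nonneg _), Real.rpow_natCast, Real.sq_sqrt hPpos.le]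

theorem trace_mpow_eq {A : Matrix n n ℂ} (hA : A.IsHermitian) (p : ℝ) :
    (mpow A p).trace.re = ∑ i, hA.eigenvalues i ^ p := by
  rw [mpow, trace_cfc hA, Complex.ofReal_re]

/-- The **Araki-Lieb-Thirring inequality**. -/
theorem araki_lieb_thirring {a b : Matrix n n ℂ} (ha : a.PosSemidef) (hb : b.PosSemidef)
    {θ q : ℝ} (h0 : 0 < θ) (h1 : θ ≤ 1) (hq : 0 < q) :
    (mpow (mpow b (θ / 2) * mpow a θ * mpow b (θ / 2)) q).trace.re ≤
      (mpow (mpow b (1 / 2) * a * mpow b (1 / 2)) (θ * q)).trace.re := by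
  have key : ∀ t : ℝ, 0 < t → (mpow a (t / 2) * mpow b (t / 2))ᴴ *
      (mpow a (t / 2) * mpow b (t / 2)) = mpow b (t / 2) * mpow a t * mpow b (t / 2) := by
    intro t ht
    rw [Matrix.conjTranspose_mul, (isHermitian_mpow a _).eq, (isHermitian_mpow b _).eq]
    have : mpow a t = mpow a (t / 2) * mpow a (t / 2) := by
      rw [mpow_mul_mpow ha (by linarith)]; congr 1; ring
    rw [this]
    simp only [Matrix.mul_assoc]
  have k1 := key θ h0
  have k2 := key 1 one_pos
  rw [mpow_one ha] at k2
  rw [← k1, ← k2]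
  have hX := Matrix.posSemidef_conjTranspose_mul_self (mpow a (θ / 2) * mpow b (θ / 2))
  have hY := Matrix.posSemidef_conjTranspose_mul_self (mpow a (1 / 2) * mpow b (1 / 2))
  rw [trace_mpow_eq hX.1, trace_mpow_eq hY.1, ← sum_sortedEig hX.1 (fun x => x ^ q),
    ← sum_sortedEig hY.1 (fun x => x ^ (θ * q))]
  -- The cutoff ε, needed for positivity in the majorization step, is removed by a limit.
  have hlim : Tendsto (fun ε : ℝ => ∑ i ∈ Finset.range (Fintype.card n),
      (max (sortedEig hY.1 i) ε) ^ (θ * q)) (𝓝[>] 0)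
      (𝓝 (∑ i ∈ Finset.range (Fintype.card n), sortedEig hY.1 i ^ (θ * q))) := by
    refine tendsto_finsetSum _ fun i _ => ?_
    have h2 : Tendsto (fun ε : ℝ => max (sortedEig hY.1 i) ε) (𝓝[>] 0)
        (𝓝 (max (sortedEig hY.1 i) 0)) :=
      ((continuous_const.max continuous_id).tendsto 0).mono_left nhdsWithin_le_nhds
    rw [max_eq_left (sortedEig_nonneg hY i)] at h2
    exact h2.rpow_const (Or.inr (by positivity))
  refine ge_of_tendsto hlim ?_
  filter_upwards [self_mem_nhdsWithin] with ε hε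
  have hε : 0 < ε := hε
  have := sum_rpow_le_of_prod_le hq (Fintype.card n) (x := sortedEig hX.1)
    (y := fun i => max (sortedEig hY.1 i) ε ^ θ) (sortedEig_antitone hX.1)
    (sortedEig_nonneg hX) (fun i => Real.rpow_pos_of_pos (lt_max_of_lt_right hε) θ)
    (fun k hk hpos => prod_sortedEig_le ha hb h0 h1 hε hk hpos)
  refine this.trans (le_of_eq (Finset.sum_congr rfl fun i _ => ?_))
  rw [← Real.rpow_mul (lt_max_of_lt_right hε).le]

end ArakiLiebThirring

/-! ### Hölder and reverse Hölder inequalities for traces, with their equality case. -/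

section Holder

variable {n m : Type*} [Fintype n] [DecidableEq n] [Fintype m] [DecidableEq m]

/-- Weighted Hölder inequality. -/
theorem sum_mul_rpow_mul_rpow_le {ι : Type*} (S : Finset ι) {c u v : ι → ℝ}
    (hc : ∀ i ∈ S, 0 ≤ c i) (hu : ∀ i ∈ S, 0 ≤ u i) (hv : ∀ i ∈ S, 0 ≤ v i)
    {p : ℝ} (h0 : 0 < p) (h1 : p < 1) :
    ∑ i ∈ S, c i * (u i ^ p * v i ^ (1 - p)) ≤
      (∑ i ∈ S, c i * u i) ^ p * (∑ i ∈ S, c i * v i) ^ (1 - p) := by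
  set A := ∑ i ∈ S, c i * u i with hA
  set B := ∑ i ∈ S, c i * v i with hB
  have hA0 : 0 ≤ A := Finset.sum_nonneg fun i hi => mul_nonneg (hc i hi) (hu i hi)
  have hB0 : 0 ≤ B := Finset.sum_nonneg fun i hi => mul_nonneg (hc i hi) (hv i hi)
  have hp' : 0 < 1 - p := by linarith
  rcases hA0.eq_or_lt with hA' | hA'
  · have := (Finset.sum_eq_zero_iff_of_nonneg fun i hi => mul_nonneg (hc i hi) (hu i hi)).mp
      (hA ▸ hA'.symm)
    rw [← hA', Real.zero_rpow h0.ne', zero_mul]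
    refine le_of_eq (Finset.sum_eq_zero fun i hi => ?_)
    rcases mul_eq_zero.mp (this i hi) with h | h <;> simp [h, h0.ne']
  rcases hB0.eq_or_lt with hB' | hB'
  · have := (Finset.sum_eq_zero_iff_of_nonneg fun i hi => mul_nonneg (hc i hi) (hv i hi)).mp
      (hB ▸ hB'.symm)
    rw [← hB', Real.zero_rpow hp'.ne', mul_zero]
    refine le_of_eq (Finset.sum_eq_zero fun i hi => ?_)
    rcases mul_eq_zero.mp (this i hi) with h | h <;> simp [h, hp'.ne']
  have key : ∀ i ∈ S, c i * (u i ^ p * v i ^ (1 - p)) ≤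
      A ^ p * B ^ (1 - p) * (p * (c i * u i / A) + (1 - p) * (c i * v i / B)) := by
    intro i hi
    have h2 := Real.geom_mean_le_arith_mean2_weighted h0.le hp'.le
      (div_nonneg (hu i hi) hA0) (div_nonneg (hv i hi) hB0) (by ring)
    rw [Real.div_rpow (hu i hi) hA0, Real.div_rpow (hv i hi) hB0] at h2
    have hAp := Real.rpow_pos_of_pos hA' p
    have hBp := Real.rpow_pos_of_pos hB' (1 - p)
    have h3 := mul_le_mul_of_nonneg_left h2
      (mul_nonneg (hc i hi) (mul_nonneg hAp.le hBp.le))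
    refine (le_of_eq ?_).trans (h3.trans (le_of_eq ?_))
    · field_simp
    · field_simp
  refine (Finset.sum_le_sum key).trans (le_of_eq ?_)
  rw [← Finset.mul_sum, Finset.sum_add_distrib, ← Finset.mul_sum, ← Finset.mul_sum,
    ← Finset.sum_div, ← Finset.sum_div, ← hA, ← hB, div_self hA'.ne', div_self hB'.ne']
  ring

theorem trace_mpow_mul_mpow {A : Matrix n n ℂ} {B : Matrix m m ℂ} (hA : A.IsHermitian)
    (hB : B.IsHermitian) (M : Matrix n m ℂ) (p q : ℝ) :
    (mpow A p * M * mpow B q * Mᴴ).trace.re =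
      ∑ r : n × m, overlap hA hB M r * (hA.eigenvalues r.1 ^ p * hB.eigenvalues r.2 ^ q) := by
  rw [mpow, mpow, trace_cfc_mul_cfc hA hB, Complex.ofReal_re]

/-- Inserting B ^ 0 = 1 puts a trace in A alone on the same pairs and weights as the mixed traces.
-/
theorem trace_mpow_left {A B : Matrix n n ℂ} (hA : A.PosSemidef) (hB : B.PosSemidef) (p : ℝ) :
    (mpow A p).trace.re = ∑ r : n × n, overlap hA.1 hB.1 1 r * hA.1.eigenvalues r.1 ^ p := by
  have := trace_mpow_mul_mpow hA.1 hB.1 1 p 0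
  rw [mpow_zero hB] at this
  simpa using this

theorem trace_mpow_right {A B : Matrix n n ℂ} (hA : A.PosSemidef) (hB : B.PosSemidef) (p : ℝ) :
    (mpow B p).trace.re = ∑ r : n × n, overlap hA.1 hB.1 1 r * hB.1.eigenvalues r.2 ^ p := by
  have := trace_mpow_mul_mpow hA.1 hB.1 1 0 p
  rw [mpow_zero hA] at this
  simpa using this

theorem trace_mul_mpow {A B : Matrix n n ℂ} (hA : A.PosSemidef) (hB : B.PosSemidef) (p : ℝ) :
    (A * mpow B p).trace.re = ∑ r : n × n, overlap hA.1 hB.1 1 r *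
      (hA.1.eigenvalues r.1 * hB.1.eigenvalues r.2 ^ p) := by
  have := trace_mpow_mul_mpow hA.1 hB.1 1 1 p
  rw [mpow_one hA] at this
  simpa using this

/-- Hölder's inequality for traces. -/
theorem trace_mul_mpow_le {X T : Matrix n n ℂ} (hX : X.PosSemidef) (hT : IsState T) {s : ℝ}
    (h0 : 0 < s) (h1 : s < 1) :
    (X * mpow T s).trace.re ≤ ((mpow X (1 / (1 - s))).trace.re) ^ (1 - s) := by
  have hTt : (mpow T 1).trace.re = 1 := by rw [mpow_one hT.1, hT.2, Complex.one_re]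
  rw [trace_mpow_right hX hT.1] at hTt
  simp only [Real.rpow_one] at hTt
  rw [trace_mul_mpow hX hT.1, trace_mpow_left hX hT.1]
  have := sum_mul_rpow_mul_rpow_le Finset.univ (c := overlap hX.1 hT.1.1 1)
    (u := fun r => hT.1.1.eigenvalues r.2)
    (v := fun r => hX.1.eigenvalues r.1 ^ (1 / (1 - s))) (fun i _ => overlap_nonneg _ _ _ i)
    (fun i _ => hT.1.eigenvalues_nonneg _)
    (fun i _ => Real.rpow_nonneg (hX.eigenvalues_nonneg _) _) h0 h1
  rw [hTt, Real.one_rpow, one_mul] at this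
  refine (le_of_eq (Finset.sum_congr rfl fun r _ => ?_)).trans this
  rw [← Real.rpow_mul (hX.eigenvalues_nonneg _), one_div_mul_cancel (by linarith), Real.rpow_one,
    mul_comm (hX.1.eigenvalues r.1)]

/-- The reverse Hölder inequality for traces. -/
theorem le_trace_mul_mpow_neg {X T : Matrix n n ℂ} (hX : X.PosSemidef) (hT : IsState T)
    (hXT : X * supp T = X) {s : ℝ} (h0 : 0 < s) :
    ((mpow X (1 / (1 + s))).trace.re) ^ (1 + s) ≤ (X * mpow T (-s)).trace.re := by
  have hTt : (mpow T 1).trace.re = 1 := by rw [mpow_one hT.1, hT.2, Complex.one_re]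
  rw [trace_mpow_right hX hT.1] at hTt
  simp only [Real.rpow_one] at hTt
  have hs : 0 < 1 + s := by linarith
  have hK : 0 ≤ (X * mpow T (-s)).trace.re := by
    rw [trace_mul_mpow hX hT.1]
    exact Finset.sum_nonneg fun r _ => mul_nonneg (overlap_nonneg _ _ _ _)
      (mul_nonneg (hX.eigenvalues_nonneg _) (Real.rpow_nonneg (hT.1.eigenvalues_nonneg _) _))
  have hN : 0 ≤ (mpow X (1 / (1 + s))).trace.re := by
    rw [trace_mpow_eq hX.1]
    exact Finset.sum_nonneg fun r _ => Real.rpow_nonneg (hX.eigenvalues_nonneg _) _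
  have key : (mpow X (1 / (1 + s))).trace.re ≤ (X * mpow T (-s)).trace.re ^ (1 / (1 + s)) := by
    rw [trace_mul_mpow hX hT.1, trace_mpow_left hX hT.1]
    have hp1 : 1 / (1 + s) < 1 := by rw [div_lt_one hs]; linarith
    -- With p = 1/(1+s), x^p = (x t^{-s})^p t^{1-p}; the weighted sum of the t is tr T = 1.
    have := sum_mul_rpow_mul_rpow_le Finset.univ (c := overlap hX.1 hT.1.1 1)
      (u := fun r => hX.1.eigenvalues r.1 * hT.1.1.eigenvalues r.2 ^ (-s))
      (v := fun r => hT.1.1.eigenvalues r.2) (fun i _ => overlap_nonneg _ _ _ i)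
      (fun i _ => mul_nonneg (hX.eigenvalues_nonneg _)
        (Real.rpow_nonneg (hT.1.eigenvalues_nonneg _) _))
      (fun i _ => hT.1.eigenvalues_nonneg _) (p := 1 / (1 + s)) (by positivity) hp1
    rw [hTt, Real.one_rpow, mul_one] at this
    refine (le_of_eq (Finset.sum_congr rfl fun r _ => ?_)).trans this
    -- At t = 0 this factorization fails, but there the support condition forces x = 0 or a
    -- vanishing overlap.
    rcases (hT.1.eigenvalues_nonneg r.2).eq_or_lt with h | h
    · have h3 := overlap_eq_zero hX.1 hT.1.1 (M := 1) (p := r) (by simpa using hXT) h.symm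
      rcases mul_eq_zero.mp h3 with h4 | h4
      · have : (1 / (1 + s)) ≠ 0 := by positivity
        rw [h4, Real.zero_rpow this, zero_mul, Real.zero_rpow this]; ring
      · rw [h4]; ring
    · rw [Real.mul_rpow (hX.eigenvalues_nonneg _) (Real.rpow_nonneg h.le _), mul_assoc,
        ← Real.rpow_mul h.le, ← Real.rpow_add h]
      have : -s * (1 / (1 + s)) + (1 - 1 / (1 + s)) = 0 := by field_simp; ring
      rw [this, Real.rpow_zero, mul_one]
  calc _ ≤ ((X * mpow T (-s)).trace.re ^ (1 / (1 + s))) ^ (1 + s) :=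
        Real.rpow_le_rpow hN key hs.le
    _ = _ := by rw [← Real.rpow_mul hK, one_div_mul_cancel hs.ne', Real.rpow_one]

theorem trace_mpow_nonneg {X : Matrix n n ℂ} (hX : X.PosSemidef) (p : ℝ) :
    0 ≤ (mpow X p).trace.re := by
  rw [trace_mpow_eq hX.1]
  exact Finset.sum_nonneg fun r _ => Real.rpow_nonneg (hX.eigenvalues_nonneg _) _

theorem eq_zero_of_eigenvalues {X : Matrix n n ℂ} (hX : X.IsHermitian)
    (h : ∀ i, hX.eigenvalues i = 0) : X = 0 :=
  hX.eigenvalues_eq_zero_iff.mp (funext h)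

theorem trace_mpow_pos {X : Matrix n n ℂ} (hX : X.PosSemidef) (h : X ≠ 0) (p : ℝ) :
    0 < (mpow X p).trace.re := by
  rw [trace_mpow_eq hX.1]
  have : ∃ i, hX.1.eigenvalues i ≠ 0 := by
    by_contra! h1
    exact h (eq_zero_of_eigenvalues hX.1 h1)
  obtain ⟨i, hi⟩ := this
  exact Finset.sum_pos' (fun r _ => Real.rpow_nonneg (hX.eigenvalues_nonneg _) _)
    ⟨i, Finset.mem_univ _, Real.rpow_pos_of_pos
      (lt_of_le_of_ne (hX.eigenvalues_nonneg i) (Ne.symm hi)) _⟩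

/-- The state proportional to a power of `X`. -/
def powState (X : Matrix n n ℂ) (r : ℝ) : Matrix n n ℂ :=
  (((mpow X r).trace.re⁻¹ : ℝ) : ℂ) • mpow X r

theorem isState_powState {X : Matrix n n ℂ} (hX : X.PosSemidef) (h : X ≠ 0) (r : ℝ) :
    IsState (powState X r) := by
  have hp := trace_mpow_pos hX h r
  refine ⟨(posSemidef_mpow hX r).smul (by exact_mod_cast (inv_pos.mpr hp).le), ?_⟩
  have hreal : (mpow X r).trace = ((mpow X r).trace.re : ℂ) := by
    rw [mpow, trace_cfc hX.1, Complex.ofReal_re]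
  rw [powState, Matrix.trace_smul, hreal, smul_eq_mul, ← Complex.ofReal_mul, Complex.ofReal_re,
    inv_mul_cancel₀ hp.ne', Complex.ofReal_one]

theorem mpow_powState {X : Matrix n n ℂ} (hX : X.PosSemidef) (r p : ℝ) :
    mpow (powState X r) p =
      (((mpow X r).trace.re ^ (-p) : ℝ) : ℂ) • mpow X (r * p) := by
  have hp := trace_mpow_nonneg hX r
  rw [powState, mpow_smul (posSemidef_mpow hX r) (inv_nonneg.mpr hp), mpow_mpow hX,
    Real.inv_rpow hp, Real.rpow_neg hp]

/-- The equality case of both Hölder inequalities: the condition on r means r = 1/(1-p), the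
exponent on X occurring there. -/
theorem trace_mul_mpow_powState {X : Matrix n n ℂ} (hX : X.PosSemidef) (h : X ≠ 0) {r p : ℝ}
    (hr : 1 + r * p = r) (hr0 : r ≠ 0) :
    (X * mpow (powState X r) p).trace.re = (mpow X r).trace.re ^ (1 - p) := by
  have hp := trace_mpow_pos hX h r
  have h1 : X * mpow X (r * p) = mpow X r := by
    conv_lhs => rw [← mpow_one hX, mpow_mpow hX, one_mul]
    rw [mpow_mul_mpow hX (by rw [hr]; exact hr0), hr]
  rw [mpow_powState hX, Matrix.mul_smul, h1, Matrix.trace_smul, smul_eq_mul,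
    Complex.re_ofReal_mul, sub_eq_neg_add, Real.rpow_add hp, Real.rpow_one]

/-- The power 1/r of the state is a positive multiple of X, so both have the same support. -/
theorem mul_supp_powState {X : Matrix n n ℂ} (hX : X.PosSemidef) (h : X ≠ 0) {r : ℝ}
    (hr : r ≠ 0) : X * supp (powState X r) = X := by
  have hp := trace_mpow_pos hX h r
  have hs := isState_powState hX h r
  have h1 := mpow_powState hX r (1 / r)
  rw [mul_one_div_cancel hr, mpow_one hX] at h1
  have h2 := mpow_mul_supp hs.1 (one_div_ne_zero hr)
  rw [h1, Matrix.smul_mul] at h2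
  exact smul_right_injective _ (by
    exact_mod_cast (Real.rpow_pos_of_pos hp _).ne') h2

end Holder

/-! ### Comparison of the Petz and sandwiched traces. -/

section Traces

variable {n m : Type*} [Fintype n] [DecidableEq n] [Fintype m] [DecidableEq m]

/-- The trace functional in the definition of `D_α`. -/
def petzQ (ρ σ : Matrix n n ℂ) (α : ℝ) : ℝ := (mpow ρ α * mpow σ (1 - α)).trace.re

/-- The trace functional in the definition of the sandwiched divergence. -/
def sandQ (ρ σ : Matrix n n ℂ) (α : ℝ) : ℝ :=
  (mpow (mpow σ ((1 - α) / (2 * α)) * ρ * mpow σ ((1 - α) / (2 * α))) α).trace.re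

variable {ρ σ : Matrix n n ℂ}

theorem mpow_half_mul_self (hρ : ρ.PosSemidef) (p : ℝ) (hp : p ≠ 0) :
    mpow ρ (p / 2) * mpow ρ (p / 2) = mpow ρ p := by
  rw [mpow_mul_mpow hρ (by simpa using hp)]; congr 1; ring

theorem sqrt_mul_self (hρ : ρ.PosSemidef) : mpow ρ (1 / 2) * mpow ρ (1 / 2) = ρ := by
  rw [mpow_half_mul_self hρ 1 one_ne_zero, mpow_one hρ]

/-- The operator `ρ^{1/2} σ^u ρ^{1/2}`. -/
def sandOp (ρ σ : Matrix n n ℂ) (u : ℝ) : Matrix n n ℂ :=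
  mpow ρ (1 / 2) * mpow σ u * mpow ρ (1 / 2)

theorem posSemidef_sandOp (hσ : σ.PosSemidef) (u : ℝ) :
    (sandOp ρ σ u).PosSemidef := by
  have := (posSemidef_mpow hσ u).mul_mul_conjTranspose_same (mpow ρ (1 / 2))
  rwa [(isHermitian_mpow ρ _).eq] at this

theorem trace_mpow_sandwich (hρ : ρ.PosSemidef) (hσ : σ.PosSemidef) {u p : ℝ} (hu : u ≠ 0)
    (hp : p ≠ 0) :
    (mpow (mpow σ (u / 2) * ρ * mpow σ (u / 2)) p).trace = (mpow (sandOp ρ σ u) p).trace := by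
  have h := trace_mpow_mul_conjTranspose (mpow σ (u / 2) * mpow ρ (1 / 2)) hp
  rw [Matrix.conjTranspose_mul, (isHermitian_mpow ρ _).eq, (isHermitian_mpow σ _).eq] at h
  have e1 : mpow σ (u / 2) * mpow ρ (1 / 2) * (mpow ρ (1 / 2) * mpow σ (u / 2)) =
      mpow σ (u / 2) * ρ * mpow σ (u / 2) := by
    conv_rhs => rw [← sqrt_mul_self hρ]
    simp only [Matrix.mul_assoc]
  have e2 : mpow ρ (1 / 2) * mpow σ (u / 2) * (mpow σ (u / 2) * mpow ρ (1 / 2)) =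
      sandOp ρ σ u := by
    rw [sandOp, ← mpow_half_mul_self hσ u hu]
    simp only [Matrix.mul_assoc]
  rw [e1, e2] at h
  exact h

/-- In this form the outer power acts on an operator depending linearly on a power of σ, as Hölder's
inequality requires. -/
theorem sandQ_eq (hρ : ρ.PosSemidef) (hσ : σ.PosSemidef) {α : ℝ} (h0 : α ≠ 0) (h1 : α ≠ 1) :
    sandQ ρ σ α = (mpow (sandOp ρ σ ((1 - α) / α)) α).trace.re := by
  rw [← trace_mpow_sandwich hρ hσ (div_ne_zero (sub_ne_zero.mpr h1.symm) h0) h0, sandQ,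
    div_div, mul_comm α 2]

/-- Araki-Lieb-Thirring with a = ρ^α, b = σ^{1-α}, θ = 1/α and q = α. -/
theorem sandQ_le_petzQ (hρ : ρ.PosSemidef) (hσ : σ.PosSemidef) {α : ℝ} (h : 1 < α) :
    sandQ ρ σ α ≤ petzQ ρ σ α := by
  have h0 : 0 < α := by linarith
  have := araki_lieb_thirring (posSemidef_mpow hρ α) (posSemidef_mpow hσ (1 - α))
    (θ := 1 / α) (q := α) (by positivity) (by rw [div_le_one h0]; exact h.le) h0
  rw [mpow_mpow hσ, mpow_mpow hσ, mpow_mpow hρ, mul_one_div_cancel h0.ne', mpow_one hρ,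
    one_div_mul_cancel h0.ne', mul_one_div, mpow_one] at this
  · have e1 : (1 - α) * (1 / α / 2) = (1 - α) / (2 * α) := by field_simp
    rw [e1] at this
    rw [sandQ, petzQ]
    refine this.trans (le_of_eq ?_)
    rw [Matrix.trace_mul_comm, ← Matrix.mul_assoc,
      mpow_half_mul_self hσ _ (by linarith), Matrix.trace_mul_comm]
  · have := (posSemidef_mpow hρ α).mul_mul_conjTranspose_same (mpow σ ((1 - α) / 2))
    rwa [(isHermitian_mpow σ _).eq] at this

/-- Araki-Lieb-Thirring with a = ρ, b = σ^{(1-α)/α}, θ = α and q = 1. -/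
theorem petzQ_le_sandQ (hρ : ρ.PosSemidef) (hσ : σ.PosSemidef) {α : ℝ} (h0 : 0 < α)
    (h1 : α < 1) : petzQ ρ σ α ≤ sandQ ρ σ α := by
  have := araki_lieb_thirring hρ (posSemidef_mpow hσ ((1 - α) / α))
    (θ := α) (q := 1) h0 h1.le one_pos
  rw [mpow_mpow hσ, mpow_mpow hσ, mul_one, mpow_one] at this
  · have e1 : (1 - α) / α * (α / 2) = (1 - α) / 2 := by field_simp
    have e2 : (1 - α) / α * (1 / 2) = (1 - α) / (2 * α) := by field_simp
    rw [e1, e2] at this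
    rw [sandQ, petzQ]
    refine le_trans (le_of_eq ?_) this
    rw [Matrix.trace_mul_comm (mpow σ ((1 - α) / 2) * mpow ρ α), ← Matrix.mul_assoc,
      mpow_half_mul_self hσ _ (by linarith), Matrix.trace_mul_comm]
  · have := (posSemidef_mpow hρ α).mul_mul_conjTranspose_same
      (mpow (mpow σ ((1 - α) / α)) (α / 2))
    rw [(isHermitian_mpow _ _).eq, mpow_mpow hσ] at this
    exact this

/-- The three factors are merged at once because two of the exponents may cancel, and then their
product is the support projection rather than the power 0. -/
theorem mpow_mul_mpow_mul_mpow (hρ : ρ.PosSemidef) {p q r : ℝ} (h : p + q + r ≠ 0) :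
    mpow ρ p * mpow ρ q * mpow ρ r = mpow ρ (p + q + r) := by
  unfold mpow
  rw [cfc_mul_cfc, cfc_mul_cfc]
  refine cfc_congr_eigenvalues hρ.1 fun i => ?_
  rcases (hρ.eigenvalues_nonneg i).eq_or_lt with h0 | h0
  · rw [← h0, Real.zero_rpow h]
    by_cases hp : p = 0
    · by_cases hq : q = 0
      · have : r ≠ 0 := by rintro rfl; simp [hp, hq] at h
        rw [Real.zero_rpow this, mul_zero]
      · rw [Real.zero_rpow hq, mul_zero, zero_mul]
    · rw [Real.zero_rpow hp, zero_mul, zero_mul]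
  · rw [Real.rpow_add h0, Real.rpow_add h0]

theorem trace_sandOp_mul_self (hρ : ρ.PosSemidef) (u : ℝ) {v : ℝ} (hv : 1 + v ≠ 0) :
    (sandOp ρ σ u * mpow ρ v).trace = (mpow ρ (1 + v) * mpow σ u).trace := by
  have : mpow ρ (1 + v) = mpow ρ (1 / 2) * mpow ρ v * mpow ρ (1 / 2) := by
    rw [mpow_mul_mpow_mul_mpow hρ (by convert hv using 1; ring)]; congr 1; ring
  rw [this, sandOp]
  have : mpow ρ (1 / 2) * mpow σ u * mpow ρ (1 / 2) * mpow ρ v =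
    mpow ρ (1 / 2) * mpow σ u * (mpow ρ (1 / 2) * mpow ρ v) := by simp only [Matrix.mul_assoc]
  rw [this, Matrix.trace_mul_comm, ← Matrix.mul_assoc]

theorem sandOp_mul_supp (hρ : ρ.PosSemidef) (u : ℝ) :
    sandOp ρ σ u * supp ρ = sandOp ρ σ u := by
  rw [sandOp, Matrix.mul_assoc, mpow_mul_supp hρ (by norm_num)]

theorem petzQ_nonneg (hρ : ρ.PosSemidef) (hσ : σ.PosSemidef) (α : ℝ) : 0 ≤ petzQ ρ σ α := by
  have := trace_mpow_mul_mpow hρ.1 hσ.1 1 α (1 - α)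
  simp only [Matrix.mul_one, Matrix.conjTranspose_one] at this
  rw [petzQ, this]
  exact Finset.sum_nonneg fun r _ => mul_nonneg (overlap_nonneg _ _ _ _)
    (mul_nonneg (Real.rpow_nonneg (hρ.eigenvalues_nonneg _) _)
      (Real.rpow_nonneg (hσ.eigenvalues_nonneg _) _))

/-- Hölder for ρ^{1/2} σ^{(1-α)/α} ρ^{1/2} against ρ^{1-1/α}: the powers of ρ combine to ρ^{2-1/α},
and (1-α)/α = 1 - (2-1/α). -/
theorem petzQ_rpow_le_sandQ (hρ : IsState ρ) (hσ : σ.PosSemidef) {α : ℝ} (h : 1 < α) :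
    petzQ ρ σ (2 - 1 / α) ^ α ≤ sandQ ρ σ α := by
  have h0 : 0 < α := by linarith
  have hs1 : 1 / α < 1 := by rw [div_lt_one h0]; exact h
  have := trace_mul_mpow_le (posSemidef_sandOp (ρ := ρ) hσ ((1 - α) / α)) hρ (s := 1 - 1 / α)
    (by linarith) (by have : 0 < 1 / α := by positivity
                      linarith)
  rw [trace_sandOp_mul_self hρ.1 _ (by linarith), sub_sub_cancel, one_div_one_div,
    ← sandQ_eq hρ.1 hσ h0.ne' h.ne'] at this
  have e : (1 - α) / α = 1 - (2 - 1 / α) := by field_simp; ring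
  have e2 : 1 + (1 - 1 / α) = 2 - 1 / α := by ring
  rw [e, e2] at this
  have hS : 0 ≤ sandQ ρ σ α := by
    rw [sandQ_eq hρ.1 hσ h0.ne' h.ne']
    exact trace_mpow_nonneg (posSemidef_sandOp hσ _) _
  calc _ ≤ (sandQ ρ σ α ^ (1 / α)) ^ α :=
        Real.rpow_le_rpow (petzQ_nonneg hρ.1 hσ _) this h0.le
    _ = _ := by rw [← Real.rpow_mul hS, one_div_mul_cancel h0.ne', Real.rpow_one]

/-- The same pairing with ρ^{1-1/α}, now a negative power, so the reverse Hölder inequality applies.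
-/
theorem sandQ_le_petzQ_rpow (hρ : IsState ρ) (hσ : σ.PosSemidef) {α : ℝ} (h0 : 1 / 2 < α)
    (h1 : α < 1) : sandQ ρ σ α ≤ petzQ ρ σ (2 - 1 / α) ^ α := by
  have hα : 0 < α := by linarith
  have hs1 : 1 < 1 / α := by rw [lt_div_iff₀ hα]; linarith
  have hs2 : 1 / α < 2 := by rw [div_lt_iff₀ hα]; linarith
  have := le_trace_mul_mpow_neg (posSemidef_sandOp (ρ := ρ) hσ ((1 - α) / α)) hρ
    (sandOp_mul_supp hρ.1 _) (s := 1 / α - 1) (by linarith)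
  rw [trace_sandOp_mul_self hρ.1 _ (by linarith), add_sub_cancel, one_div_one_div,
    ← sandQ_eq hρ.1 hσ hα.ne' h1.ne] at this
  have e : (1 - α) / α = 1 - (2 - 1 / α) := by field_simp; ring
  have e2 : 1 + -(1 / α - 1) = 2 - 1 / α := by ring
  rw [e, e2] at this
  have hS : 0 ≤ sandQ ρ σ α := by
    rw [sandQ_eq hρ.1 hσ hα.ne' h1.ne]
    exact trace_mpow_nonneg (posSemidef_sandOp hσ _) _
  calc _ = (sandQ ρ σ α ^ (1 / α)) ^ α := by
        rw [← Real.rpow_mul hS, one_div_mul_cancel hα.ne', Real.rpow_one]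
    _ ≤ _ := Real.rpow_le_rpow (Real.rpow_nonneg hS _) this hα.le

theorem mul_eq_zero_of_mpow {A : Matrix n n ℂ} {B : Matrix n n ℂ} (hA : A.PosSemidef)
    (hB : B.PosSemidef) {p q : ℝ} (h : mpow A p * mpow B q = 0) : A * B = 0 := by
  have e1 : A = mpow A (1 - p) * mpow A p := by
    rw [mpow_mul_mpow hA (by simp), sub_add_cancel, mpow_one hA]
  have e2 : B = mpow B q * mpow B (1 - q) := by
    rw [mpow_mul_mpow hB (by simp), add_sub_cancel, mpow_one hB]
  have : A * B = mpow A (1 - p) * (mpow A p * mpow B q) * mpow B (1 - q) := by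
    conv_lhs => rw [e1, e2]
    simp only [Matrix.mul_assoc]
  rw [this, h]
  simp

theorem sandOp_ne_zero (hρ : ρ.PosSemidef) (hσ : σ.PosSemidef) (h : ρ * σ ≠ 0) {u : ℝ}
    (hu : u ≠ 0) : sandOp ρ σ u ≠ 0 := by
  intro h0
  have e : sandOp ρ σ u = (mpow ρ (1 / 2) * mpow σ (u / 2)) *
      (mpow ρ (1 / 2) * mpow σ (u / 2))ᴴ := by
    rw [Matrix.conjTranspose_mul, (isHermitian_mpow ρ _).eq, (isHermitian_mpow σ _).eq, sandOp,
      ← mpow_half_mul_self hσ u hu]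
    simp only [Matrix.mul_assoc]
  rw [e, Matrix.self_mul_conjTranspose_eq_zero] at h0
  exact h (mul_eq_zero_of_mpow hρ hσ h0)

theorem sandQ_pos (hρ : ρ.PosSemidef) (hσ : σ.PosSemidef) (h : ρ * σ ≠ 0) {α : ℝ} (h0 : α ≠ 0)
    (h1 : α ≠ 1) : 0 < sandQ ρ σ α := by
  rw [sandQ_eq hρ hσ h0 h1]
  exact trace_mpow_pos (posSemidef_sandOp hσ _)
    (sandOp_ne_zero hρ hσ h (div_ne_zero (sub_ne_zero.mpr h1.symm) h0)) _

/-- The trace is a sum of nonnegative terms; if it vanished, every entry of ρ^α σ^{1-α} in the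
eigenbases would vanish, and ρσ with it. -/
theorem petzQ_pos (hρ : ρ.PosSemidef) (hσ : σ.PosSemidef) (h : ρ * σ ≠ 0) (α : ℝ) :
    0 < petzQ ρ σ α := by
  refine lt_of_le_of_ne (petzQ_nonneg hρ hσ α) fun h0 => h ?_
  have h1 := trace_mpow_mul_mpow hρ.1 hσ.1 1 α (1 - α)
  simp only [Matrix.mul_one, Matrix.conjTranspose_one] at h1
  rw [petzQ, h1] at h0
  have h2 := (Finset.sum_eq_zero_iff_of_nonneg fun r _ => mul_nonneg (overlap_nonneg _ _ _ _)
    (mul_nonneg (Real.rpow_nonneg (hρ.eigenvalues_nonneg _) _)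
      (Real.rpow_nonneg (hσ.eigenvalues_nonneg _) _))).mp h0.symm
  apply mul_eq_zero_of_mpow hρ hσ (p := α) (q := 1 - α)
  apply ext_of_eigU hρ.1 hσ.1
  ext i j
  have e1 : mpow ρ α * mpow σ (1 - α) = cfc (fun x : ℝ => x ^ α) ρ *
    (1 * cfc (fun x : ℝ => x ^ (1 - α)) σ) := by rw [Matrix.one_mul]; rfl
  rw [e1, eigU_sandwich_cfc_left, eigU_sandwich_cfc_right, Matrix.mul_zero, Matrix.zero_mul,
    Matrix.zero_apply]
  have h3 := h2 (i, j) (Finset.mem_univ _)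
  rcases mul_eq_zero.mp h3 with h4 | h4
  · rw [overlap, Complex.normSq_eq_zero] at h4
    rw [h4, zero_mul, mul_zero]
  · rcases mul_eq_zero.mp h4 with h4 | h4 <;> simp only at h4 <;> simp [h4]

end Traces

/-! ### Partial traces, the complementary operator and duality. -/

section Bipartite

variable {a b c d : Type*} [Fintype a] [DecidableEq a] [Fintype b] [DecidableEq b]
  [Fintype c] [DecidableEq c] [Fintype d] [DecidableEq d]

/-- Moving the first tensor factor from the output to the input of an operator. -/
def reshape (X : Matrix (a × b) c ℂ) : Matrix b (a × c) ℂ :=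
  Matrix.of fun j p => X (p.1, j) p.2

/-- A partial trace becomes a product RRᴴ, whose swapped product RᴴR lives on the complementary
side. -/
theorem reshape_mul_conjTranspose (X Y : Matrix (a × b) c ℂ) :
    reshape X * (reshape Y)ᴴ = marginalB (X * Yᴴ) := by
  ext j k
  simp only [Matrix.mul_apply, reshape, marginalB, Matrix.of_apply, Matrix.conjTranspose_apply,
    Fintype.sum_prod_type]

theorem reshape_mul (X : Matrix (a × b) c ℂ) (Y : Matrix c d ℂ) :
    reshape (X * Y) = reshape X * ((1 : Matrix a a ℂ) ⊗ₖ Y) := by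
  ext j ⟨i, k⟩
  simp only [Matrix.mul_apply, reshape, Matrix.of_apply, Fintype.sum_prod_type,
    Matrix.kronecker_apply, Matrix.one_apply, ite_mul, one_mul, zero_mul, mul_ite, mul_zero]
  rw [Finset.sum_comm]
  simp

theorem reshape_kronecker_mul (Y : Matrix b b ℂ) (X : Matrix (a × b) c ℂ) :
    reshape (((1 : Matrix a a ℂ) ⊗ₖ Y) * X) = Y * reshape X := by
  ext j ⟨i, k⟩
  simp only [Matrix.mul_apply, reshape, Matrix.of_apply, Fintype.sum_prod_type,
    Matrix.kronecker_apply, Matrix.one_apply, ite_mul, one_mul, zero_mul]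
  rw [Finset.sum_comm]
  simp

theorem marginalB_conj_reshape (X : Matrix (a × b) c ℂ) (Y : Matrix b b ℂ) :
    marginalB (a := a) ((reshape X)ᴴ * Y * reshape X) = Xᴴ * ((1 : Matrix a a ℂ) ⊗ₖ Y) * X := by
  rw [Matrix.mul_assoc, Matrix.mul_assoc, ← reshape_kronecker_mul]
  set Z := ((1 : Matrix a a ℂ) ⊗ₖ Y) * X
  ext j k
  simp only [Matrix.mul_apply, reshape, marginalB,
    Matrix.of_apply, Matrix.conjTranspose_apply, Fintype.sum_prod_type]

theorem reshape_injective {X Y : Matrix (a × b) c ℂ} (h : reshape X = reshape Y) : X = Y := by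
  ext ⟨i, j⟩ k
  exact congrFun (congrFun h j) (i, k)

theorem trace_marginalB (X : Matrix (a × b) (a × b) ℂ) : (marginalB X).trace = X.trace := by
  simp only [Matrix.trace, marginalB, Matrix.diag_apply, Matrix.of_apply, Fintype.sum_prod_type]
  exact Finset.sum_comm

theorem marginalB_mul_kronecker (X : Matrix (a × b) (a × b) ℂ) (Y : Matrix b b ℂ) :
    marginalB (X * ((1 : Matrix a a ℂ) ⊗ₖ Y)) = marginalB X * Y := by
  ext j k
  have h : ∀ i, (X * ((1 : Matrix a a ℂ) ⊗ₖ Y)) (i, j) (i, k) = ∑ l, X (i, j) (i, l) * Y l k := by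
    intro i
    simp only [Matrix.mul_apply, Fintype.sum_prod_type, Matrix.kronecker_apply, Matrix.one_apply,
      ite_mul, one_mul, zero_mul, mul_ite, mul_zero]
    rw [Finset.sum_comm]
    simp
  simp only [marginalB, Matrix.of_apply, h]
  rw [Matrix.mul_apply, Finset.sum_comm]
  simp only [Matrix.of_apply, Finset.sum_mul]

theorem trace_mul_kronecker (X : Matrix (a × b) (a × b) ℂ) (Y : Matrix b b ℂ) :
    (X * ((1 : Matrix a a ℂ) ⊗ₖ Y)).trace = (marginalB X * Y).trace := by
  rw [← marginalB_mul_kronecker, trace_marginalB]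

theorem posSemidef_marginalB {X : Matrix (a × b) (a × b) ℂ} (hX : X.PosSemidef) :
    (marginalB X).PosSemidef := by
  have := Matrix.posSemidef_self_mul_conjTranspose (reshape (mpow X (1 / 2)))
  rwa [reshape_mul_conjTranspose, (isHermitian_mpow X _).eq, sqrt_mul_self hX] at this

theorem isState_marginalB {X : Matrix (a × b) (a × b) ℂ} (hX : IsState X) :
    IsState (marginalB X) :=
  ⟨posSemidef_marginalB hX.1, by rw [trace_marginalB, hX.2]⟩

theorem posSemidef_one_kronecker {σ : Matrix b b ℂ} (hσ : σ.PosSemidef) :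
    ((1 : Matrix a a ℂ) ⊗ₖ σ).PosSemidef :=
  Matrix.PosSemidef.one.kronecker hσ

/-- The embedding M of the i-th block intertwines 1⊗σ with σ, so the functional calculus passes
through it. -/
theorem cfc_one_kronecker {σ : Matrix b b ℂ} (hσ : σ.PosSemidef) (f : ℝ → ℝ) :
    cfc f ((1 : Matrix a a ℂ) ⊗ₖ σ) = (1 : Matrix a a ℂ) ⊗ₖ cfc f σ := by
  ext p ⟨i, j⟩
  set M : Matrix (a × b) b ℂ := Matrix.of fun q k => if q.1 = i then (1 : Matrix b b ℂ) q.2 k else 0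
    with hM
  have hl : ∀ (N : Matrix (a × b) (a × b) ℂ) (q : a × b) (k : b), (N * M) q k = N q (i, k) := by
    intro N q k
    simp [Matrix.mul_apply, hM, Fintype.sum_prod_type, Matrix.one_apply]
  have hr : ∀ (N : Matrix b b ℂ) (q : a × b) (k : b),
      (M * N) q k = ((1 : Matrix a a ℂ) ⊗ₖ N) q (i, k) := by
    intro N q k
    simp only [Matrix.mul_apply, hM, Matrix.of_apply]
    by_cases h : q.1 = i <;> simp [h, Matrix.one_apply]
  have h1 : ((1 : Matrix a a ℂ) ⊗ₖ σ) * M = M * σ := by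
    ext q k
    rw [hl, hr]
  have h2 := cfc_mul_eq_mul_cfc (posSemidef_one_kronecker hσ).1 hσ.1 h1 f
  have h3 := congrFun (congrFun h2 p) j
  rwa [hl, hr] at h3

theorem mpow_one_kronecker {σ : Matrix b b ℂ} (hσ : σ.PosSemidef) (p : ℝ) :
    mpow ((1 : Matrix a a ℂ) ⊗ₖ σ) p = (1 : Matrix a a ℂ) ⊗ₖ mpow σ p :=
  cfc_one_kronecker hσ _

theorem supp_one_kronecker {σ : Matrix b b ℂ} (hσ : σ.PosSemidef) :
    supp ((1 : Matrix a a ℂ) ⊗ₖ σ) = (1 : Matrix a a ℂ) ⊗ₖ supp σ :=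
  cfc_one_kronecker hσ _

theorem supp_mul_conjTranspose_mul (M : Matrix c d ℂ) : supp (M * Mᴴ) * M = M := by
  have hP := Matrix.posSemidef_self_mul_conjTranspose M
  have h1 : (supp (M * Mᴴ) * M - M) * (supp (M * Mᴴ) * M - M)ᴴ = 0 := by
    have h2 : supp (M * Mᴴ) * (M * Mᴴ) = M * Mᴴ := by
      have := supp_mul_mpow hP one_ne_zero
      rwa [mpow_one hP] at this
    have h3 : supp (M * Mᴴ) * M * Mᴴ = M * Mᴴ := by rw [Matrix.mul_assoc, h2]
    rw [Matrix.conjTranspose_sub, Matrix.conjTranspose_mul, (isHermitian_supp _).eq,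
      Matrix.sub_mul, Matrix.mul_sub, Matrix.mul_sub, ← Matrix.mul_assoc, h3,
      ← Matrix.mul_assoc M, self_mul_supp hP]
    simp
  rw [Matrix.self_mul_conjTranspose_eq_zero] at h1
  exact sub_eq_zero.mp h1

theorem mul_ne_zero_of_mul_supp {ρ σ : Matrix c c ℂ} (hσ : σ.PosSemidef)
    (h : ρ * supp σ = ρ) (h0 : ρ ≠ 0) : ρ * σ ≠ 0 := by
  intro h1
  have h2 := mpow_mul_mpow_neg hσ one_ne_zero
  rw [mpow_one hσ] at h2
  rw [← h2, ← Matrix.mul_assoc, h1, Matrix.zero_mul] at h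
  exact h0 h.symm

theorem IsState.ne_zero {ρ : Matrix c c ℂ} (hρ : IsState ρ) : ρ ≠ 0 := by
  rintro rfl
  have := hρ.2
  simp at this

/-- The operator is GᴴG with G = σ^{u/2} ρ^{1/2}, so it has the kernel of G. Under the support
condition G determines ρ^{1/2} = σ^{-u/2} G. -/
theorem mul_eq_self_of_sandOp_mul_eq {ρ σ P : Matrix c c ℂ} (hρ : ρ.PosSemidef)
    (hσ : σ.PosSemidef) (h : supp σ * mpow ρ (1 / 2) = mpow ρ (1 / 2)) {u : ℝ} (hu : u ≠ 0)
    (hP : sandOp ρ σ u * P = sandOp ρ σ u) : ρ * P = ρ := by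
  set G := mpow σ (u / 2) * mpow ρ (1 / 2) with hG
  have e : sandOp ρ σ u = Gᴴ * G := by
    rw [hG, Matrix.conjTranspose_mul, (isHermitian_mpow ρ _).eq, (isHermitian_mpow σ _).eq,
      sandOp, ← mpow_half_mul_self hσ u hu]
    simp only [Matrix.mul_assoc]
  have h1 : Gᴴ * G * (P - 1) = 0 := by
    rw [← e, Matrix.mul_sub, hP, Matrix.mul_one, sub_self]
  rw [Matrix.conjTranspose_mul_self_mul_eq_zero] at h1
  have h2 : mpow ρ (1 / 2) = mpow σ (-(u / 2)) * G := by
    have := mpow_mul_mpow_neg hσ (p := -(u / 2)) (by simpa using hu)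
    rw [neg_neg] at this
    rw [hG, ← Matrix.mul_assoc, this, h]
  have h3 : mpow ρ (1 / 2) * (P - 1) = 0 := by rw [h2, Matrix.mul_assoc, h1, Matrix.mul_zero]
  have h4 : ρ * (P - 1) = 0 := by
    conv_lhs => rw [← sqrt_mul_self hρ]
    rw [Matrix.mul_assoc, h3, Matrix.mul_zero]
  rwa [Matrix.mul_sub, Matrix.mul_one, sub_eq_zero] at h4

variable {ρ : Matrix (a × b) (a × b) ℂ} {σ : Matrix b b ℂ}

/-- After reshaping, ρ_B = RRᴴ, and the support of RRᴴ fixes R. -/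
theorem sqrt_eq_supp_marginalB_mul (hρ : ρ.PosSemidef) :
    supp ((1 : Matrix a a ℂ) ⊗ₖ marginalB ρ) * mpow ρ (1 / 2) = mpow ρ (1 / 2) := by
  apply reshape_injective
  have h := supp_mul_conjTranspose_mul (reshape (mpow ρ (1 / 2)))
  rw [reshape_mul_conjTranspose, (isHermitian_mpow ρ _).eq, sqrt_mul_self hρ] at h
  rw [supp_one_kronecker (posSemidef_marginalB hρ), reshape_kronecker_mul, h]

theorem mul_supp_marginalB (hρ : ρ.PosSemidef) :
    ρ * supp ((1 : Matrix a a ℂ) ⊗ₖ marginalB ρ) = ρ := by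
  have h := congrArg Matrix.conjTranspose (sqrt_eq_supp_marginalB_mul hρ)
  rw [Matrix.conjTranspose_mul, (isHermitian_mpow ρ _).eq, (isHermitian_supp _).eq] at h
  rw [← sqrt_mul_self hρ, Matrix.mul_assoc]
  conv_lhs => rw [sqrt_mul_self hρ]
  rw [h]

theorem isDominatedBy_marginalB (hρ : ρ.PosSemidef) :
    IsDominatedBy ρ ((1 : Matrix a a ℂ) ⊗ₖ marginalB ρ) :=
  (isDominatedBy_iff (posSemidef_one_kronecker (posSemidef_marginalB hρ))).mpr
    (mul_supp_marginalB hρ)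

/-- The operator on `a × (a × b)` that has, in a purification of `ρ`, the role of the marginal on
the first factor and the purifying system. -/
def complement (ρ : Matrix (a × b) (a × b) ℂ) : Matrix (a × (a × b)) (a × (a × b)) ℂ :=
  (reshape (mpow ρ (1 / 2)))ᴴ * reshape (mpow ρ (1 / 2))

theorem posSemidef_complement (ρ : Matrix (a × b) (a × b) ℂ) : (complement ρ).PosSemidef :=
  Matrix.posSemidef_conjTranspose_mul_self _

/-- With R the reshaped root, (RᴴR)^p = Rᴴ(RRᴴ)^{p-1}R by intertwining, and RRᴴ = ρ_B. -/
theorem mpow_complement (hρ : ρ.PosSemidef) {p : ℝ} (hp : p ≠ 0) :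
    mpow (complement ρ) p = (reshape (mpow ρ (1 / 2)))ᴴ * mpow (marginalB ρ) (p - 1) *
      reshape (mpow ρ (1 / 2)) := by
  have hm : marginalB ρ = reshape (mpow ρ (1 / 2)) * (reshape (mpow ρ (1 / 2)))ᴴ := by
    rw [reshape_mul_conjTranspose, (isHermitian_mpow ρ _).eq, sqrt_mul_self hρ]
  have hc := posSemidef_complement ρ
  rw [hm, Matrix.mul_assoc, mpow_mul_self_conjTranspose, ← Matrix.mul_assoc]
  have : mpow (complement ρ) p = complement ρ * mpow (complement ρ) (p - 1) := by
    conv_rhs => rw [← mpow_one hc, mpow_mpow hc, one_mul, mpow_mul_mpow hc (by simpa using hp)]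
    congr 1; ring
  rw [this]
  rfl

theorem marginalB_mpow_complement (hρ : ρ.PosSemidef) {p : ℝ} (hp : p ≠ 0) :
    marginalB (a := a) (mpow (complement ρ) p) =
      sandOp ρ ((1 : Matrix a a ℂ) ⊗ₖ marginalB ρ) (p - 1) := by
  rw [mpow_complement hρ hp, marginalB_conj_reshape, (isHermitian_mpow ρ _).eq, sandOp,
    mpow_one_kronecker (posSemidef_marginalB hρ)]

/-- Duality for the Petz trace: the partial trace of the γ-th power of the complement is
ρ^{1/2}(1⊗ρ_B^{γ-1})ρ^{1/2}, which is then paired with ρ^{1-γ}. -/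
theorem petzQ_complement (hρ : ρ.PosSemidef) {γ : ℝ} (h0 : γ ≠ 0) (h2 : γ ≠ 2) :
    petzQ (complement ρ) ((1 : Matrix a a ℂ) ⊗ₖ ρ) γ =
      petzQ ρ ((1 : Matrix a a ℂ) ⊗ₖ marginalB ρ) (2 - γ) := by
  rw [petzQ, petzQ, mpow_one_kronecker hρ, mpow_one_kronecker (posSemidef_marginalB hρ),
    trace_mul_kronecker, marginalB_mpow_complement hρ h0,
    trace_sandOp_mul_self hρ _ (v := 1 - γ) (by intro h; apply h2; linarith),
    mpow_one_kronecker (posSemidef_marginalB hρ)]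
  have e1 : 1 + (1 - γ) = 2 - γ := by ring
  have e2 : 1 - (2 - γ) = γ - 1 := by ring
  rw [e1, e2]

/-- The trace of a power of `tr_A (X (1 ⊗ Y Yᴴ) Xᴴ)` for `X = ρ^{1/2}` as a sandwiched trace. -/
theorem trace_mpow_marginalB {τ : Matrix (a × b) (a × b) ℂ} (hτ : τ.PosSemidef) {γ : ℝ}
    (h0 : γ ≠ 0) (h1 : γ ≠ 1) :
    (mpow (marginalB (sandOp ρ τ ((1 - γ) / γ))) γ).trace.re =
      sandQ (complement ρ) ((1 : Matrix a a ℂ) ⊗ₖ τ) γ := by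
  set t := (1 - γ) / γ with ht
  have ht0 : t ≠ 0 := div_ne_zero (sub_ne_zero.mpr h1.symm) h0
  have h := trace_mpow_mul_conjTranspose (reshape (mpow ρ (1 / 2) * mpow τ (t / 2))) h0
  have e1 : reshape (mpow ρ (1 / 2) * mpow τ (t / 2)) *
      (reshape (mpow ρ (1 / 2) * mpow τ (t / 2)))ᴴ = marginalB (sandOp ρ τ t) := by
    rw [reshape_mul_conjTranspose, Matrix.conjTranspose_mul, (isHermitian_mpow ρ _).eq,
      (isHermitian_mpow τ _).eq, sandOp, ← mpow_half_mul_self hτ t ht0]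
    simp only [Matrix.mul_assoc]
  have e2 : (reshape (mpow ρ (1 / 2) * mpow τ (t / 2)))ᴴ *
      reshape (mpow ρ (1 / 2) * mpow τ (t / 2)) =
      mpow ((1 : Matrix a a ℂ) ⊗ₖ τ) ((1 - γ) / (2 * γ)) * complement ρ *
        mpow ((1 : Matrix a a ℂ) ⊗ₖ τ) ((1 - γ) / (2 * γ)) := by
    have e3 : t / 2 = (1 - γ) / (2 * γ) := by rw [ht, div_div, mul_comm γ 2]
    rw [reshape_mul, ← mpow_one_kronecker hτ, Matrix.conjTranspose_mul,
      (isHermitian_mpow _ _).eq, complement, e3]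
    simp only [Matrix.mul_assoc]
  rw [e1, e2] at h
  rw [h, sandQ]

theorem mul_supp_of_sandOp {n : Type*} [Fintype n] [DecidableEq n] {ρ ω τ : Matrix n n ℂ}
    (hρ : ρ.PosSemidef) (h : ρ * supp ω = ρ) (u : ℝ) :
    sandOp ρ τ u * supp ω = sandOp ρ τ u := by
  have h1 : mpow ρ (1 / 2) * supp ω = mpow ρ (1 / 2) := by
    have : mpow ρ (1 / 2) = mpow ρ (-(1 / 2)) * ρ := by
      conv_rhs => rw [← mpow_one hρ, mpow_mpow hρ, one_mul, mpow_mul_mpow hρ (by norm_num)]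
      norm_num
    rw [this, Matrix.mul_assoc, h]
  rw [sandOp, Matrix.mul_assoc, h1]

theorem marginalB_mul_supp (hσ : σ.PosSemidef) {X : Matrix (a × b) (a × b) ℂ}
    (h : X * supp ((1 : Matrix a a ℂ) ⊗ₖ σ) = X) : marginalB X * supp σ = marginalB X := by
  rw [← marginalB_mul_kronecker, ← supp_one_kronecker hσ, h]

theorem sandOp_self (hρ : ρ.PosSemidef) {u : ℝ} (hu : 1 + u ≠ 0) :
    sandOp ρ ρ u = mpow ρ (1 + u) := by
  rw [sandOp, mpow_mul_mpow_mul_mpow hρ (by convert hu using 1; ring)]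
  congr 1; ring

theorem petzQ_kronecker (hσ : σ.PosSemidef) (α : ℝ) :
    petzQ ρ ((1 : Matrix a a ℂ) ⊗ₖ σ) α = (marginalB (mpow ρ α) * mpow σ (1 - α)).trace.re := by
  rw [petzQ, mpow_one_kronecker hσ, trace_mul_kronecker]

/-- The case τ = ρ of `trace_mpow_marginalB`, where the powers of ρ merge into ρ^α. The left side is
what remains after optimizing over σ_B. -/
theorem trace_mpow_marginalB_self (hρ : ρ.PosSemidef) {α : ℝ} (h0 : α ≠ 0) (h1 : α ≠ 1) :
    (mpow (marginalB (mpow ρ α)) (1 / α)).trace.re =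
      sandQ (complement ρ) ((1 : Matrix a a ℂ) ⊗ₖ ρ) (1 / α) := by
  rw [← trace_mpow_marginalB hρ (one_div_ne_zero h0) (by
    intro h; rw [div_eq_one_iff_eq h0] at h; exact h1 h.symm)]
  have : 1 + (1 - 1 / α) / (1 / α) = α := by field_simp; ring
  rw [sandOp_self hρ (by rw [this]; exact h0), this]

/-- Reverse Hölder removes σ_B, leaving a sandwiched trace of the complement at order 1/α < 1.
Araki-Lieb-Thirring bounds it below by a Petz trace, and duality identifies the latter. -/
theorem petzQ_marginal_rpow_le (hρ : IsState ρ) (hσ : IsState σ)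
    (hd : IsDominatedBy ρ ((1 : Matrix a a ℂ) ⊗ₖ σ)) {α : ℝ} (h : 1 < α) :
    petzQ ρ ((1 : Matrix a a ℂ) ⊗ₖ marginalB ρ) (2 - 1 / α) ^ α ≤
      petzQ ρ ((1 : Matrix a a ℂ) ⊗ₖ σ) α := by
  have h0 : 0 < α := by linarith
  have hs0 : 0 < 1 / α := by positivity
  have hs1 : 1 / α < 1 := by rw [div_lt_one h0]; exact h
  rw [isDominatedBy_iff (posSemidef_one_kronecker hσ.1)] at hd
  have hsupp : marginalB (mpow ρ α) * supp σ = marginalB (mpow ρ α) := by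
    apply marginalB_mul_supp hσ.1
    have : mpow ρ α = mpow ρ (α - 1) * ρ := by
      conv_rhs => rw [← mpow_one hρ.1, mpow_mpow hρ.1, one_mul, mpow_mul_mpow hρ.1 (by linarith)]
      congr 1; ring
    rw [this, Matrix.mul_assoc, hd]
  have h1 := le_trace_mul_mpow_neg (posSemidef_marginalB (posSemidef_mpow hρ.1 α)) hσ hsupp
    (s := α - 1) (by linarith)
  rw [add_sub_cancel, neg_sub, ← petzQ_kronecker hσ.1,
    trace_mpow_marginalB_self hρ.1 h0.ne' h.ne'] at h1
  refine le_trans (Real.rpow_le_rpow (petzQ_nonneg hρ.1 (posSemidef_one_kronecker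
    (posSemidef_marginalB hρ.1)) _) ?_ h0.le) h1
  rw [← petzQ_complement hρ.1 hs0.ne' (by linarith)]
  exact petzQ_le_sandQ (posSemidef_complement ρ) (posSemidef_one_kronecker hρ.1) hs0 hs1

/-- Mirror image of the preceding argument: Hölder instead of its reverse, and Araki-Lieb-Thirring
at order 1/α > 1. -/
theorem petzQ_le_marginal_rpow (hρ : IsState ρ) (hσ : IsState σ) {α : ℝ} (h0 : 1 / 2 < α)
    (h1 : α < 1) :
    petzQ ρ ((1 : Matrix a a ℂ) ⊗ₖ σ) α ≤
      petzQ ρ ((1 : Matrix a a ℂ) ⊗ₖ marginalB ρ) (2 - 1 / α) ^ α := by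
  have hα : 0 < α := by linarith
  have hs1 : 1 < 1 / α := by rw [lt_div_iff₀ hα]; linarith
  have hs2 : 1 / α < 2 := by rw [div_lt_iff₀ hα]; linarith
  have h2 := trace_mul_mpow_le (posSemidef_marginalB (posSemidef_mpow hρ.1 α)) hσ
    (s := 1 - α) (by linarith) (by linarith)
  rw [sub_sub_cancel, ← petzQ_kronecker hσ.1,
    trace_mpow_marginalB_self hρ.1 hα.ne' h1.ne] at h2
  refine h2.trans (Real.rpow_le_rpow ?_ ?_ hα.le)
  · rw [← trace_mpow_marginalB_self hρ.1 hα.ne' h1.ne]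
    exact trace_mpow_nonneg (posSemidef_marginalB (posSemidef_mpow hρ.1 α)) _
  · rw [← petzQ_complement hρ.1 (by linarith) hs2.ne]
    exact sandQ_le_petzQ (posSemidef_complement ρ) (posSemidef_one_kronecker hρ.1) hs1

/-- The optimal state on the complementary side. -/
theorem exists_optimal_complement (hρ : IsState ρ) {β : ℝ} (h0 : 0 < β) (h1 : β ≠ 1) :
    ∃ τ : Matrix (a × b) (a × b) ℂ, IsState τ ∧
      sandOp ρ ((1 : Matrix a a ℂ) ⊗ₖ marginalB ρ) (β - 1) * supp τ =
        sandOp ρ ((1 : Matrix a a ℂ) ⊗ₖ marginalB ρ) (β - 1) ∧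
      petzQ (complement ρ) ((1 : Matrix a a ℂ) ⊗ₖ τ) β =
        sandQ ρ ((1 : Matrix a a ℂ) ⊗ₖ marginalB ρ) (1 / β) ^ β := by
  have hB := posSemidef_one_kronecker (a := a) (posSemidef_marginalB hρ.1)
  have hne : ρ * ((1 : Matrix a a ℂ) ⊗ₖ marginalB ρ) ≠ 0 :=
    mul_ne_zero_of_mul_supp hB (mul_supp_marginalB hρ.1) hρ.ne_zero
  set T := sandOp ρ ((1 : Matrix a a ℂ) ⊗ₖ marginalB ρ) (β - 1) with hT
  have hT0 : T ≠ 0 := sandOp_ne_zero hρ.1 hB hne (sub_ne_zero.mpr h1)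
  have hTp : T.PosSemidef := posSemidef_sandOp hB _
  -- The Petz trace of the complement relative to 1⊗τ is tr(T τ^{1-β}); the state proportional to
  -- T^{1/β} is its Hölder equality case.
  refine ⟨powState T (1 / β), isState_powState hTp hT0 _,
    mul_supp_powState hTp hT0 (by positivity), ?_⟩
  rw [petzQ_kronecker (isState_powState hTp hT0 _).1, marginalB_mpow_complement hρ.1 h0.ne',
    ← hT, trace_mul_mpow_powState hTp hT0 (by field_simp; ring) (by positivity), sub_sub_cancel,
    sandQ_eq hρ.1 hB (by positivity) (by
      intro h; rw [div_eq_one_iff_eq h0.ne'] at h; exact h1 h.symm)]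
  have : (1 - 1 / β) / (1 / β) = β - 1 := by field_simp
  rw [this]

/-- Cyclicity exchanges the roles of σ on B and τ on the complementary side, so Hölder can be
applied to either. -/
theorem trace_sandOp_mul_mpow (hσ : σ.PosSemidef) (τ : Matrix (a × b) (a × b) ℂ) (u v : ℝ) :
    (sandOp ρ ((1 : Matrix a a ℂ) ⊗ₖ σ) u * mpow τ v).trace =
      (marginalB (sandOp ρ τ v) * mpow σ u).trace := by
  rw [← trace_mul_kronecker, ← mpow_one_kronecker hσ, sandOp, sandOp, Matrix.mul_assoc,
    Matrix.mul_assoc, Matrix.trace_mul_comm]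
  simp only [Matrix.mul_assoc]
  rw [Matrix.trace_mul_comm]
  simp only [Matrix.mul_assoc]

/-- With s = 1-1/α and β = 1/(1+s), Hölder against τ^s bounds a mixed trace from above. Reverse
Hölder against σ^{-s} bounds the same trace from below by a sandwiched trace of the complement at
order β. For the optimal τ, Araki-Lieb-Thirring turns this into the trace with ρ_B. -/
theorem sandQ_marginal_rpow_le (hρ : IsState ρ) (hσ : IsState σ)
    (hd : IsDominatedBy ρ ((1 : Matrix a a ℂ) ⊗ₖ σ)) {α : ℝ} (h : 1 < α) :
    sandQ ρ ((1 : Matrix a a ℂ) ⊗ₖ marginalB ρ) (2 - 1 / α) ^ α ≤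
      sandQ ρ ((1 : Matrix a a ℂ) ⊗ₖ σ) α := by
  have h0 : 0 < α := by linarith
  have hi0 : 0 < 1 / α := by positivity
  have hi1 : 1 / α < 1 := by rw [div_lt_one h0]; exact h
  rw [isDominatedBy_iff (posSemidef_one_kronecker hσ.1)] at hd
  have hσ' := posSemidef_one_kronecker (a := a) hσ.1
  set s := 1 - 1 / α with hs
  have hs1 : 0 < 1 + s := by linarith
  set β := 1 / (1 + s) with hβ
  have hβ0 : 0 < β := by positivity
  have hβ1 : β < 1 := by rw [hβ, div_lt_one hs1]; linarith
  have hβs : (1 - β) / β = s := by rw [hβ]; field_simp; ring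
  have hβ' : 1 / β = 2 - 1 / α := by rw [hβ, one_div_one_div, hs]; ring
  obtain ⟨τ, hτ, -, hopt⟩ := exists_optimal_complement hρ hβ0 hβ1.ne
  rw [hβ'] at hopt
  set N := sandQ ρ ((1 : Matrix a a ℂ) ⊗ₖ marginalB ρ) (2 - 1 / α) with hN
  have hN0 : 0 < N := sandQ_pos hρ.1 (posSemidef_one_kronecker (posSemidef_marginalB hρ.1))
    (mul_ne_zero_of_mul_supp (posSemidef_one_kronecker (posSemidef_marginalB hρ.1))
      (mul_supp_marginalB hρ.1) hρ.ne_zero) (by linarith) (by linarith)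
  have hQ0 : 0 ≤ sandQ ρ ((1 : Matrix a a ℂ) ⊗ₖ σ) α := by
    rw [sandQ_eq hρ.1 hσ' h0.ne' h.ne']
    exact trace_mpow_nonneg (posSemidef_sandOp hσ' _) _
  have h1 := trace_mul_mpow_le (posSemidef_sandOp (ρ := ρ) hσ' ((1 - α) / α)) hτ (s := s)
    (by linarith) (by linarith)
  have e1 : 1 - s = 1 / α := by rw [hs]; ring
  have e2 : (1 - α) / α = -s := by rw [hs]; field_simp; ring
  rw [e1, one_div_one_div, ← sandQ_eq hρ.1 hσ' h0.ne' h.ne', trace_sandOp_mul_mpow hσ.1, e2] at h1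
  have h2 := le_trace_mul_mpow_neg (posSemidef_marginalB (posSemidef_sandOp (ρ := ρ) hτ.1 s)) hσ
    (marginalB_mul_supp hσ.1 (mul_supp_of_sandOp hρ.1 hd s)) (s := s) (by linarith)
  have h3 := trace_mpow_marginalB (ρ := ρ) hτ.1 hβ0.ne' hβ1.ne
  rw [hβs] at h3
  rw [← hβ, h3] at h2
  have h4 := petzQ_le_sandQ (posSemidef_complement ρ) (posSemidef_one_kronecker (a := a) hτ.1)
    hβ0 hβ1
  rw [hopt] at h4
  have h5 : N ≤ sandQ ρ ((1 : Matrix a a ℂ) ⊗ₖ σ) α ^ (1 / α) := by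
    calc N = (N ^ β) ^ (1 + s) := by
          rw [← Real.rpow_mul hN0.le, hβ, one_div_mul_cancel hs1.ne', Real.rpow_one]
      _ ≤ _ := (Real.rpow_le_rpow (Real.rpow_nonneg hN0.le _) h4 hs1.le).trans (h2.trans h1)
  calc _ ≤ (sandQ ρ ((1 : Matrix a a ℂ) ⊗ₖ σ) α ^ (1 / α)) ^ α :=
        Real.rpow_le_rpow hN0.le h5 h0.le
    _ = _ := by rw [← Real.rpow_mul hQ0, one_div_mul_cancel h0.ne', Real.rpow_one]

/-- The same scheme with s = 1/α-1, β = 1/(1-s) and all inequalities reversed. -/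
theorem sandQ_le_marginal_rpow (hρ : IsState ρ) (hσ : IsState σ) {α : ℝ} (h0 : 1 / 2 < α)
    (h1 : α < 1) :
    sandQ ρ ((1 : Matrix a a ℂ) ⊗ₖ σ) α ≤
      sandQ ρ ((1 : Matrix a a ℂ) ⊗ₖ marginalB ρ) (2 - 1 / α) ^ α := by
  have hα : 0 < α := by linarith
  have hi1 : 1 < 1 / α := by rw [lt_div_iff₀ hα]; linarith
  have hi2 : 1 / α < 2 := by rw [div_lt_iff₀ hα]; linarith
  have hσ' := posSemidef_one_kronecker (a := a) hσ.1
  have hB := posSemidef_one_kronecker (a := a) (posSemidef_marginalB hρ.1)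
  set s := 1 / α - 1 with hs
  have hs1 : 0 < 1 - s := by linarith
  set β := 1 / (1 - s) with hβ
  have hβ0 : 0 < β := by positivity
  have hβ1 : 1 < β := by rw [hβ, lt_div_iff₀ hs1]; linarith
  have hβs : (1 - β) / β = -s := by rw [hβ]; field_simp; ring
  have hβ' : 1 / β = 2 - 1 / α := by rw [hβ, one_div_one_div, hs]; ring
  obtain ⟨τ, hτ, hsupp, hopt⟩ := exists_optimal_complement hρ hβ0 hβ1.ne'
  rw [hβ'] at hopt
  set N := sandQ ρ ((1 : Matrix a a ℂ) ⊗ₖ marginalB ρ) (2 - 1 / α) with hN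
  have hN0 : 0 < N := sandQ_pos hρ.1 hB
    (mul_ne_zero_of_mul_supp hB (mul_supp_marginalB hρ.1) hρ.ne_zero) (by linarith) (by linarith)
  have hQ0 : 0 ≤ sandQ ρ ((1 : Matrix a a ℂ) ⊗ₖ σ) α := by
    rw [sandQ_eq hρ.1 hσ' hα.ne' h1.ne]
    exact trace_mpow_nonneg (posSemidef_sandOp hσ' _) _
  -- Reverse Hölder against τ needs this support condition; it is inherited from the optimality of
  -- τ.
  have hρτ : ρ * supp τ = ρ := mul_eq_self_of_sandOp_mul_eq hρ.1
    (posSemidef_marginalB hρ.1 |> posSemidef_one_kronecker) (sqrt_eq_supp_marginalB_mul hρ.1)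
    (sub_ne_zero.mpr hβ1.ne') hsupp
  have h2 := le_trace_mul_mpow_neg (posSemidef_sandOp (ρ := ρ) hσ' ((1 - α) / α)) hτ
    (mul_supp_of_sandOp hρ.1 hρτ _) (s := s) (by linarith)
  have e1 : 1 + s = 1 / α := by rw [hs]; ring
  have e2 : (1 - α) / α = s := by rw [hs]; field_simp
  rw [e1, one_div_one_div, ← sandQ_eq hρ.1 hσ' hα.ne' h1.ne, trace_sandOp_mul_mpow hσ.1, e2] at h2
  have h3 := trace_mul_mpow_le (posSemidef_marginalB (posSemidef_sandOp (ρ := ρ) hτ.1 (-s))) hσ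
    (s := s) (by linarith) (by linarith)
  have h4 := trace_mpow_marginalB (ρ := ρ) hτ.1 hβ0.ne' hβ1.ne'
  rw [hβs] at h4
  rw [← hβ, h4] at h3
  have h5 := sandQ_le_petzQ (posSemidef_complement ρ) (posSemidef_one_kronecker (a := a) hτ.1) hβ1
  rw [hopt] at h5
  have h6 : 0 ≤ sandQ (complement ρ) ((1 : Matrix a a ℂ) ⊗ₖ τ) β := by
    rw [← h4]
    exact trace_mpow_nonneg (posSemidef_marginalB (posSemidef_sandOp hτ.1 _)) _
  have h7 : sandQ ρ ((1 : Matrix a a ℂ) ⊗ₖ σ) α ^ (1 / α) ≤ N := by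
    calc _ ≤ (N ^ β) ^ (1 - s) := (h2.trans h3).trans (Real.rpow_le_rpow h6 h5 hs1.le)
      _ = N := by rw [← Real.rpow_mul hN0.le, hβ, one_div_mul_cancel hs1.ne', Real.rpow_one]
  calc _ = (sandQ ρ ((1 : Matrix a a ℂ) ⊗ₖ σ) α ^ (1 / α)) ^ α := by
        rw [← Real.rpow_mul hQ0, one_div_mul_cancel hα.ne', Real.rpow_one]
    _ ≤ _ := Real.rpow_le_rpow (Real.rpow_nonneg hQ0 _) h7 hα.le

end Bipartite

/-! ### From traces to divergences; the Petz family near the orders 0 and 1. -/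

section Divergences

variable {n : Type*} [Fintype n] [DecidableEq n] {ρ σ : Matrix n n ℂ}

/-- The value `(α - 1)⁻¹ log₂ q` as an extended real. -/
def orderLog (α q : ℝ) : EReal := (((α - 1)⁻¹ * Real.logb 2 q : ℝ) : EReal)

theorem orderLog_mono {α q r : ℝ} (hα : 1 < α) (hq : 0 < q) (h : q ≤ r) :
    orderLog α q ≤ orderLog α r := by
  rw [orderLog, orderLog, EReal.coe_le_coe_iff]
  exact mul_le_mul_of_nonneg_left (Real.logb_le_logb_of_le (by norm_num) hq h)
    (inv_nonneg.mpr (by linarith))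

theorem orderLog_anti {α q r : ℝ} (hα : α < 1) (hq : 0 < q) (h : q ≤ r) :
    orderLog α r ≤ orderLog α q := by
  rw [orderLog, orderLog, EReal.coe_le_coe_iff]
  exact mul_le_mul_of_nonpos_left (Real.logb_le_logb_of_le (by norm_num) hq h)
    (inv_nonpos.mpr (by linarith))

theorem orderLog_rpow {α β t q : ℝ} (hq : 0 < q) (h : (α - 1)⁻¹ * t = (β - 1)⁻¹) :
    orderLog α (q ^ t) = orderLog β q := by
  rw [orderLog, orderLog, Real.logb_rpow_eq_mul_logb_of_pos hq, ← h, mul_assoc]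

/-- Since (2-1/α) - 1 = (α-1)/α, the exponent α in the trace inequalities is exactly the change of
prefactor. -/
theorem orderLog_two_sub {α q : ℝ} (h0 : 0 < α) (h1 : α ≠ 1) (hq : 0 < q) :
    orderLog α (q ^ α) = orderLog (2 - 1 / α) q := by
  refine orderLog_rpow hq ?_
  have : α - 1 ≠ 0 := sub_ne_zero.mpr h1
  have e : 2 - 1 / α - 1 = (α - 1) / α := by field_simp; ring
  rw [e, inv_div]
  field_simp

theorem IsDominatedBy.mul_ne_zero (hρ : ρ ≠ 0) (hσ : σ.PosSemidef) (h : IsDominatedBy ρ σ) :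
    ρ * σ ≠ 0 :=
  mul_ne_zero_of_mul_supp hσ ((isDominatedBy_iff hσ).mp h) hρ

theorem divReal_of_dominated (h : IsDominatedBy ρ σ) (α : ℝ) :
    divReal ρ σ α = orderLog α (petzQ ρ σ α) := by
  rw [divReal, if_pos (Or.inl h)]; rfl

theorem divReal_of_mul_ne_zero (h : ρ * σ ≠ 0) {α : ℝ} (hα : α < 1) :
    divReal ρ σ α = orderLog α (petzQ ρ σ α) := by
  rw [divReal, if_pos (Or.inr ⟨hα, h⟩)]; rfl

theorem divReal_eq_top_of_le (h : ¬IsDominatedBy ρ σ) {α : ℝ} (hα : 1 ≤ α) :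
    divReal ρ σ α = ⊤ := by
  rw [divReal, if_neg]
  rintro (h1 | h1)
  · exact h h1
  · linarith [h1.1]

theorem divReal_eq_top (hρ : ρ ≠ 0) (hσ : σ.PosSemidef) (h : ρ * σ = 0) (α : ℝ) :
    divReal ρ σ α = ⊤ := by
  rw [divReal, if_neg]
  rintro (h1 | h1)
  · exact h1.mul_ne_zero hρ hσ h
  · exact h1.2 h

theorem sandwichedReal_of_dominated (h : IsDominatedBy ρ σ) (α : ℝ) :
    sandwichedReal ρ σ α = orderLog α (sandQ ρ σ α) := by
  rw [sandwichedReal, if_pos (Or.inl h)]; rfl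

theorem sandwichedReal_of_mul_ne_zero (h : ρ * σ ≠ 0) {α : ℝ} (hα : α < 1) :
    sandwichedReal ρ σ α = orderLog α (sandQ ρ σ α) := by
  rw [sandwichedReal, if_pos (Or.inr ⟨hα, h⟩)]; rfl

theorem sandwichedReal_eq_top_of_le (h : ¬IsDominatedBy ρ σ) {α : ℝ} (hα : 1 ≤ α) :
    sandwichedReal ρ σ α = ⊤ := by
  rw [sandwichedReal, if_neg]
  rintro (h1 | h1)
  · exact h h1
  · linarith [h1.1]

theorem sandwichedReal_eq_top (hρ : ρ ≠ 0) (hσ : σ.PosSemidef) (h : ρ * σ = 0) (α : ℝ) :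
    sandwichedReal ρ σ α = ⊤ := by
  rw [sandwichedReal, if_neg]
  rintro (h1 | h1)
  · exact h1.mul_ne_zero hρ hσ h
  · exact h1.2 h

theorem sandwichedReal_le_divReal (hρ : IsState ρ) (hσ : σ.PosSemidef) {α : ℝ} (h0 : 0 < α)
    (h1 : α ≠ 1) : sandwichedReal ρ σ α ≤ divReal ρ σ α := by
  rcases h1.lt_or_gt with h1 | h1
  · by_cases h : ρ * σ = 0
    · rw [divReal_eq_top hρ.ne_zero hσ h]; exact le_top
    · rw [divReal_of_mul_ne_zero h h1, sandwichedReal_of_mul_ne_zero h h1]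
      exact orderLog_anti h1 (petzQ_pos hρ.1 hσ h α) (petzQ_le_sandQ hρ.1 hσ h0 h1)
  · by_cases h : IsDominatedBy ρ σ
    · rw [divReal_of_dominated h, sandwichedReal_of_dominated h]
      exact orderLog_mono h1 (sandQ_pos hρ.1 hσ (h.mul_ne_zero hρ.ne_zero hσ) h0.ne' h1.ne')
        (sandQ_le_petzQ hρ.1 hσ h1)
    · rw [divReal_eq_top_of_le h h1.le]; exact le_top

theorem two_sub_one_div_lt_one {α : ℝ} (h0 : 0 < α) (h1 : α < 1) : 2 - 1 / α < 1 := by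
  have : 1 < 1 / α := by rw [lt_div_iff₀ h0]; linarith
  linarith

theorem divReal_two_sub_le (hρ : IsState ρ) (hσ : σ.PosSemidef) {α : ℝ} (h0 : 1 / 2 < α)
    (h1 : α ≠ 1) : divReal ρ σ (2 - 1 / α) ≤ sandwichedReal ρ σ α := by
  have hα : 0 < α := by linarith
  rcases h1.lt_or_gt with h1 | h1
  · by_cases h : ρ * σ = 0
    · rw [sandwichedReal_eq_top hρ.ne_zero hσ h]; exact le_top
    · rw [divReal_of_mul_ne_zero h (two_sub_one_div_lt_one hα h1),
        sandwichedReal_of_mul_ne_zero h h1, ← orderLog_two_sub hα h1.ne (petzQ_pos hρ.1 hσ h _)]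
      exact orderLog_anti h1 (sandQ_pos hρ.1 hσ h hα.ne' h1.ne) (sandQ_le_petzQ_rpow hρ hσ h0 h1)
  · by_cases h : IsDominatedBy ρ σ
    · have hne := h.mul_ne_zero hρ.ne_zero hσ
      rw [divReal_of_dominated h, sandwichedReal_of_dominated h,
        ← orderLog_two_sub hα h1.ne' (petzQ_pos hρ.1 hσ hne _)]
      exact orderLog_mono h1 (Real.rpow_pos_of_pos (petzQ_pos hρ.1 hσ hne _) _)
        (petzQ_rpow_le_sandQ hρ hσ h1)
    · rw [sandwichedReal_eq_top_of_le h h1.le]; exact le_top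

section Marginal

variable {a b : Type*} [Fintype a] [DecidableEq a] [Fintype b] [DecidableEq b]
  {ρ : Matrix (a × b) (a × b) ℂ} {σ : Matrix b b ℂ}

theorem divReal_marginalB_two_sub_le (hρ : IsState ρ) (hσ : IsState σ) {α : ℝ} (h0 : 1 / 2 < α)
    (h1 : α ≠ 1) : divReal ρ ((1 : Matrix a a ℂ) ⊗ₖ marginalB ρ) (2 - 1 / α) ≤
      divReal ρ ((1 : Matrix a a ℂ) ⊗ₖ σ) α := by
  have hα : 0 < α := by linarith
  have hB := posSemidef_one_kronecker (a := a) (posSemidef_marginalB hρ.1)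
  have hd := isDominatedBy_marginalB hρ.1
  have hne := hd.mul_ne_zero hρ.ne_zero hB
  have hσ' := posSemidef_one_kronecker (a := a) hσ.1
  rw [divReal_of_dominated hd, ← orderLog_two_sub hα h1 (petzQ_pos hρ.1 hB hne _)]
  rcases h1.lt_or_gt with h1 | h1
  · by_cases h : ρ * ((1 : Matrix a a ℂ) ⊗ₖ σ) = 0
    · rw [divReal_eq_top hρ.ne_zero hσ' h]; exact le_top
    · rw [divReal_of_mul_ne_zero h h1]
      exact orderLog_anti h1 (petzQ_pos hρ.1 hσ' h _) (petzQ_le_marginal_rpow hρ hσ h0 h1)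
  · by_cases h : IsDominatedBy ρ ((1 : Matrix a a ℂ) ⊗ₖ σ)
    · rw [divReal_of_dominated h]
      exact orderLog_mono h1 (Real.rpow_pos_of_pos (petzQ_pos hρ.1 hB hne _) _)
        (petzQ_marginal_rpow_le hρ hσ h h1)
    · rw [divReal_eq_top_of_le h h1.le]; exact le_top

theorem sandwichedReal_marginalB_two_sub_le (hρ : IsState ρ) (hσ : IsState σ) {α : ℝ}
    (h0 : 1 / 2 < α) (h1 : α ≠ 1) :
    sandwichedReal ρ ((1 : Matrix a a ℂ) ⊗ₖ marginalB ρ) (2 - 1 / α) ≤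
      sandwichedReal ρ ((1 : Matrix a a ℂ) ⊗ₖ σ) α := by
  have hα : 0 < α := by linarith
  have hB := posSemidef_one_kronecker (a := a) (posSemidef_marginalB hρ.1)
  have hd := isDominatedBy_marginalB hρ.1
  have hne := hd.mul_ne_zero hρ.ne_zero hB
  have hσ' := posSemidef_one_kronecker (a := a) hσ.1
  have hinv : 1 / α < 2 := by rw [div_lt_iff₀ hα]; linarith
  have hne1 : 2 - 1 / α ≠ 1 := by
    intro h
    have h2 : 1 / α = 1 := by linarith
    rw [div_eq_one_iff_eq hα.ne'] at h2
    exact h1 h2.symm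
  have hpos := sandQ_pos hρ.1 hB hne (α := 2 - 1 / α) (by linarith) hne1
  rw [sandwichedReal_of_dominated hd, ← orderLog_two_sub hα h1 hpos]
  rcases h1.lt_or_gt with h1 | h1
  · by_cases h : ρ * ((1 : Matrix a a ℂ) ⊗ₖ σ) = 0
    · rw [sandwichedReal_eq_top hρ.ne_zero hσ' h]; exact le_top
    · rw [sandwichedReal_of_mul_ne_zero h h1]
      exact orderLog_anti h1 (sandQ_pos hρ.1 hσ' h hα.ne' h1.ne)
        (sandQ_le_marginal_rpow hρ hσ h0 h1)
  · by_cases h : IsDominatedBy ρ ((1 : Matrix a a ℂ) ⊗ₖ σ)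
    · rw [sandwichedReal_of_dominated h]
      exact orderLog_mono h1 (Real.rpow_pos_of_pos hpos _) (sandQ_marginal_rpow_le hρ hσ h h1)
    · rw [sandwichedReal_eq_top_of_le h h1.le]; exact le_top

end Marginal

/-- An entire extension of `α ↦ tr (ρ ^ α σ ^ (1 - α))` from the orders `α ∉ {0, 1}`. -/
def petzExp (hρ : ρ.PosSemidef) (hσ : σ.PosSemidef) (α : ℝ) : ℝ :=
  ∑ r : n × n, if overlap hρ.1 hσ.1 1 r * hρ.1.eigenvalues r.1 * hσ.1.eigenvalues r.2 = 0 then 0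
    else overlap hρ.1 hσ.1 1 r * (hρ.1.eigenvalues r.1 ^ α * hσ.1.eigenvalues r.2 ^ (1 - α))

theorem petzQ_eq_sum (hρ : ρ.PosSemidef) (hσ : σ.PosSemidef) (α : ℝ) :
    petzQ ρ σ α = ∑ r : n × n, overlap hρ.1 hσ.1 1 r *
      (hρ.1.eigenvalues r.1 ^ α * hσ.1.eigenvalues r.2 ^ (1 - α)) := by
  have h1 := trace_mpow_mul_mpow hρ.1 hσ.1 1 α (1 - α)
  rw [petzQ]
  simpa only [Matrix.mul_one, Matrix.conjTranspose_one] using h1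

theorem petzQ_eq_petzExp (hρ : ρ.PosSemidef) (hσ : σ.PosSemidef) {α : ℝ} (h0 : α ≠ 0)
    (h1 : α ≠ 1) : petzQ ρ σ α = petzExp hρ hσ α := by
  rw [petzQ_eq_sum hρ hσ, petzExp]
  refine Finset.sum_congr rfl fun r _ => ?_
  split_ifs with h
  · rcases mul_eq_zero.mp h with h | h
    · rcases mul_eq_zero.mp h with h | h
      · rw [h, zero_mul]
      · rw [h, Real.zero_rpow h0, zero_mul, mul_zero]
    · rw [h, Real.zero_rpow (sub_ne_zero.mpr h1.symm), mul_zero, mul_zero]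
  · rfl

theorem differentiable_petzExp (hρ : ρ.PosSemidef) (hσ : σ.PosSemidef) :
    Differentiable ℝ (petzExp hρ hσ) := by
  unfold petzExp
  refine Differentiable.fun_sum fun r _ => ?_
  by_cases h : overlap hρ.1 hσ.1 1 r * hρ.1.eigenvalues r.1 * hσ.1.eigenvalues r.2 = 0
  · simp only [if_pos h]; exact differentiable_const _
  · simp only [if_neg h]
    have h1 : 0 < hρ.1.eigenvalues r.1 := lt_of_le_of_ne (hρ.eigenvalues_nonneg _)
      (fun h' => h (by rw [← h', mul_zero, zero_mul]))
    have h2 : 0 < hσ.1.eigenvalues r.2 := lt_of_le_of_ne (hσ.eigenvalues_nonneg _)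
      (fun h' => h (by rw [← h', mul_zero]))
    simp only [Real.rpow_def_of_pos h1, Real.rpow_def_of_pos h2]
    fun_prop

/-- Which terms are nonzero does not depend on α, so positivity at order 2 suffices. -/
theorem petzExp_pos (hρ : ρ.PosSemidef) (hσ : σ.PosSemidef) (h : ρ * σ ≠ 0) (α : ℝ) :
    0 < petzExp hρ hσ α := by
  have h2 := petzQ_pos hρ hσ h 2
  rw [petzQ_eq_petzExp hρ hσ (by norm_num) (by norm_num), petzExp] at h2
  obtain ⟨r, hr, hr2⟩ := Finset.exists_ne_zero_of_sum_ne_zero h2.ne'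
  have hr3 : overlap hρ.1 hσ.1 1 r * hρ.1.eigenvalues r.1 * hσ.1.eigenvalues r.2 ≠ 0 := by
    intro h'; exact hr2 (if_pos h')
  refine Finset.sum_pos' (fun s _ => ?_) ⟨r, Finset.mem_univ _, ?_⟩
  · split_ifs
    · exact le_rfl
    · exact mul_nonneg (overlap_nonneg _ _ _ _)
        (mul_nonneg (Real.rpow_nonneg (hρ.eigenvalues_nonneg _) _)
        (Real.rpow_nonneg (hσ.eigenvalues_nonneg _) _))
  · rw [if_neg hr3]
    have h4 := left_ne_zero_of_mul hr3
    exact mul_pos (lt_of_le_of_ne (overlap_nonneg _ _ _ _) (left_ne_zero_of_mul h4).symm)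
      (mul_pos (Real.rpow_pos_of_pos (lt_of_le_of_ne (hρ.eigenvalues_nonneg _)
        (right_ne_zero_of_mul h4).symm) _)
        (Real.rpow_pos_of_pos (lt_of_le_of_ne (hσ.eigenvalues_nonneg _)
        (right_ne_zero_of_mul hr3).symm) _))

theorem sum_overlap_mul (hρ : IsState ρ) (hσ : σ.PosSemidef) :
    ∑ r : n × n, overlap hρ.1.1 hσ.1 1 r * hρ.1.1.eigenvalues r.1 = 1 := by
  have h1 := trace_mpow_left hρ.1 hσ 1
  have h2 : (mpow ρ 1).trace.re = 1 := by rw [mpow_one hρ.1, hρ.2, Complex.one_re]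
  simp only [Real.rpow_one] at h1
  exact h1.symm.trans h2

theorem petzExp_one_term (hρ : ρ.PosSemidef) (hσ : σ.PosSemidef) (r : n × n) :
    (if overlap hρ.1 hσ.1 1 r * hρ.1.eigenvalues r.1 * hσ.1.eigenvalues r.2 = 0 then 0
    else overlap hρ.1 hσ.1 1 r * (hρ.1.eigenvalues r.1 ^ (1 : ℝ) *
      hσ.1.eigenvalues r.2 ^ (1 - 1 : ℝ))) ≤ overlap hρ.1 hσ.1 1 r * hρ.1.eigenvalues r.1 := by
  split_ifs
  · exact mul_nonneg (overlap_nonneg _ _ _ _) (hρ.eigenvalues_nonneg _)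
  · simp

theorem petzExp_one_of_dominated (hρ : IsState ρ) (hσ : σ.PosSemidef) (h : IsDominatedBy ρ σ) :
    petzExp hρ.1 hσ 1 = 1 := by
  rw [isDominatedBy_iff hσ] at h
  rw [petzExp]
  refine (Finset.sum_congr rfl fun r _ => ?_).trans (sum_overlap_mul hρ hσ)
  split_ifs with h0
  · rcases mul_eq_zero.mp h0 with h1 | h1
    · exact h1.symm
    · rw [mul_comm, overlap_eq_zero hρ.1.1 hσ.1 (M := 1) (by simpa using h) h1]
  · simp

/-- The value at 1 is the weight of ρ on the support of σ; it equals 1 only if ρ has no weight on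
the kernel of σ. This strictness drives the divergence to +∞ from the left. -/
theorem petzExp_one_lt (hρ : IsState ρ) (hσ : σ.PosSemidef) (h : ¬IsDominatedBy ρ σ) :
    petzExp hρ.1 hσ 1 < 1 := by
  have hle : petzExp hρ.1 hσ 1 ≤ 1 := by
    rw [petzExp]
    exact (Finset.sum_le_sum fun r _ => petzExp_one_term hρ.1 hσ r).trans_eq
      (sum_overlap_mul hρ hσ)
  refine lt_of_le_of_ne hle fun heq => h ?_
  rw [petzExp] at heq
  replace heq := heq.trans (sum_overlap_mul hρ hσ).symm
  rw [Finset.sum_eq_sum_iff_of_le fun r _ => petzExp_one_term hρ.1 hσ r] at heq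
  rw [isDominatedBy_iff hσ]
  apply ext_of_eigU hρ.1.1 hσ.1
  ext i j
  rw [supp, eigU_sandwich_cfc_right]
  by_cases hj : hσ.1.eigenvalues j = 0
  · have h1 := heq (i, j) (Finset.mem_univ _)
    simp only [hj, mul_zero, if_true] at h1
    have h2 := eigU_sandwich_cfc_left hρ.1.1 hσ.1 1 id i j
    rw [cfc_id ℝ ρ hρ.1.1.isSelfAdjoint, Matrix.mul_one] at h2
    simp only [hj, if_true, Complex.ofReal_zero, mul_zero]
    rw [h2]
    rcases mul_eq_zero.mp h1.symm with h3 | h3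
    · rw [overlap, Complex.normSq_eq_zero] at h3
      rw [h3, mul_zero]
    · simp [h3]
  · simp [hj]

theorem tendsto_coe_orderLog {l : Filter ℝ} {f : ℝ → ℝ} {α q : ℝ} (hα : α ≠ 1) (hq : 0 < q)
    (hl : l ≤ 𝓝 α) (hf : Tendsto f l (𝓝 q)) :
    Tendsto (fun x => orderLog x (f x)) l (𝓝 (orderLog α q)) := by
  unfold orderLog
  refine (continuous_coe_real_ereal.tendsto _).comp ?_
  have h1 : Tendsto (fun x : ℝ => (x - 1)⁻¹) l (𝓝 (α - 1)⁻¹) :=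
    ((tendsto_id.sub_const 1).inv₀ (sub_ne_zero.mpr hα)).mono_left hl
  exact h1.mul (hf.logb hq.ne')

theorem continuousAt_divReal (hρ : IsState ρ) (hσ : σ.PosSemidef) {α : ℝ} (h0 : α ≠ 0)
    (h1 : α ≠ 1) : ContinuousAt (divReal ρ σ) α := by
  have main : ρ * σ ≠ 0 →
      (∀ᶠ x in 𝓝 α, divReal ρ σ x = orderLog x (petzQ ρ σ x)) → ContinuousAt (divReal ρ σ) α := by
    intro hne h
    have h2 : (fun x => orderLog x (petzExp hρ.1 hσ x)) =ᶠ[𝓝 α] divReal ρ σ := by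
      filter_upwards [h, eventually_ne_nhds h0, eventually_ne_nhds h1] with x hx hx0 hx1
      rw [hx, petzQ_eq_petzExp hρ.1 hσ hx0 hx1]
    have h3 := tendsto_coe_orderLog h1 (petzExp_pos hρ.1 hσ hne α) le_rfl
      (differentiable_petzExp hρ.1 hσ).continuous.continuousAt
    rw [ContinuousAt, ← h2.self_of_nhds]
    exact h3.congr' h2
  by_cases hd : IsDominatedBy ρ σ
  · exact main (hd.mul_ne_zero hρ.ne_zero hσ) (Eventually.of_forall (divReal_of_dominated hd))
  by_cases hne : ρ * σ = 0
  · rw [funext (divReal_eq_top hρ.ne_zero hσ hne)]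
    exact continuousAt_const
  rcases h1.lt_or_gt with h1 | h1
  · refine main hne ?_
    filter_upwards [eventually_lt_nhds h1] with x hx
    exact divReal_of_mul_ne_zero hne hx
  · have : (fun _ => (⊤ : EReal)) =ᶠ[𝓝 α] divReal ρ σ := by
      filter_upwards [eventually_gt_nhds h1] with x hx
      rw [divReal_eq_top_of_le hd hx.le]
    exact continuousAt_const.congr this

theorem exists_tendsto_divReal_zero (hρ : IsState ρ) (hσ : σ.PosSemidef) :
    ∃ l, Tendsto (divReal ρ σ) (𝓝[>] 0) (𝓝 l) := by
  by_cases hne : ρ * σ = 0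
  · rw [funext (divReal_eq_top hρ.ne_zero hσ hne)]
    exact ⟨_, tendsto_const_nhds⟩
  · refine ⟨orderLog 0 (petzExp hρ.1 hσ 0), ?_⟩
    have h3 := tendsto_coe_orderLog zero_ne_one (petzExp_pos hρ.1 hσ hne 0) nhdsWithin_le_nhds
      ((differentiable_petzExp hρ.1 hσ).continuous.continuousWithinAt (s := Set.Ioi 0))
    refine h3.congr' ?_
    filter_upwards [Ioo_mem_nhdsGT (zero_lt_one' ℝ)] with x hx
    rw [divReal_of_mul_ne_zero hne hx.2, petzQ_eq_petzExp hρ.1 hσ hx.1.ne' hx.2.ne]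

/-- Under domination the trace is 1 at order 1, so the divergence is a difference quotient of its
logarithm. Otherwise the limit is +∞: from the left a negative logarithm is divided by α-1 → 0⁻ (or
ρσ = 0), and from the right the value is constantly +∞. -/
theorem exists_tendsto_divReal_one (hρ : IsState ρ) (hσ : σ.PosSemidef) :
    ∃ l, Tendsto (divReal ρ σ) (𝓝[≠] 1) (𝓝 l) := by
  by_cases hd : IsDominatedBy ρ σ
  · have hne := hd.mul_ne_zero hρ.ne_zero hσ
    have h1 := petzExp_one_of_dominated hρ hσ hd
    have hdiff : DifferentiableAt ℝ (fun x => Real.logb 2 (petzExp hρ.1 hσ x)) 1 := by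
      unfold Real.logb
      exact (((differentiable_petzExp hρ.1 hσ) 1).log (by rw [h1]; norm_num)).div_const _
    have h2 := (hasDerivAt_iff_tendsto_slope.mp hdiff.hasDerivAt)
    refine ⟨_, ((continuous_coe_real_ereal.tendsto _).comp h2).congr' ?_⟩
    filter_upwards [self_mem_nhdsWithin, nhdsWithin_le_nhds (eventually_ne_nhds one_ne_zero)]
      with x hx hx0
    rw [divReal_of_dominated hd, petzQ_eq_petzExp hρ.1 hσ hx0 hx]
    simp [slope, orderLog, h1]
  · refine ⟨⊤, ?_⟩
    by_cases hne : ρ * σ = 0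
    · rw [funext (divReal_eq_top hρ.ne_zero hσ hne)]
      exact tendsto_const_nhds
    rw [← nhdsLT_sup_nhdsGT, tendsto_sup]
    constructor
    · have h1 : Tendsto (fun x : ℝ => (x - 1)⁻¹) (𝓝[<] 1) atBot := by
        refine tendsto_inv_nhdsLT_zero.comp ?_
        refine tendsto_nhdsWithin_iff.mpr ⟨?_, ?_⟩
        · have : Tendsto (fun x : ℝ => x - 1) (𝓝 1) (𝓝 (1 - 1)) := tendsto_id.sub_const 1
          rw [sub_self] at this
          exact this.mono_left nhdsWithin_le_nhds
        · filter_upwards [self_mem_nhdsWithin] with x hx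
          have : x < 1 := hx
          simpa using this
      have h2 : Tendsto (fun x => Real.logb 2 (petzExp hρ.1 hσ x)) (𝓝[<] 1)
          (𝓝 (Real.logb 2 (petzExp hρ.1 hσ 1))) :=
        (((differentiable_petzExp hρ.1 hσ).continuous.tendsto 1).mono_left
          nhdsWithin_le_nhds).logb (petzExp_pos hρ.1 hσ hne 1).ne'
      have h3 := h1.atBot_mul_neg (Real.logb_neg (by norm_num) (petzExp_pos hρ.1 hσ hne 1)
        (petzExp_one_lt hρ hσ hd)) h2
      have h4 : Tendsto (fun x => orderLog x (petzExp hρ.1 hσ x)) (𝓝[<] 1) (𝓝 ⊤) :=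
        EReal.tendsto_coe_nhds_top_iff.mpr h3
      refine h4.congr' ?_
      filter_upwards [Ioo_mem_nhdsLT (zero_lt_one' ℝ)] with x hx
      rw [divReal_of_mul_ne_zero hne hx.2, petzQ_eq_petzExp hρ.1 hσ hx.1.ne' hx.2.ne]
    · refine tendsto_const_nhds.congr' ?_
      filter_upwards [self_mem_nhdsWithin] with x hx
      rw [divReal_eq_top_of_le hd (le_of_lt hx)]

end Divergences

/-! ### Monotonicity in the order, existence of limits, and one-sided bounds at 2 and 1/2. -/

section Monotonicity

variable {n : Type*} [Fintype n] [DecidableEq n] {ρ σ : Matrix n n ℂ}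

/-- Jensen's inequality for powers and subprobability weights. -/
theorem sum_mul_rpow_le_rpow {ι : Type*} (S : Finset ι) {c y : ι → ℝ} (hc : ∀ i ∈ S, 0 ≤ c i)
    (hc1 : ∑ i ∈ S, c i ≤ 1) (hy : ∀ i ∈ S, 0 ≤ y i) {s t : ℝ} (hs : 0 < s) (hst : s < t) :
    ∑ i ∈ S, c i * y i ^ s ≤ (∑ i ∈ S, c i * y i ^ t) ^ (s / t) := by
  have ht : 0 < t := hs.trans hst
  have hlt : s / t < 1 := by rw [div_lt_one ht]; exact hst
  have h := sum_mul_rpow_mul_rpow_le S (c := c) (u := fun i => y i ^ t) (v := fun _ => 1) hc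
    (fun i hi => Real.rpow_nonneg (hy i hi) t) (fun _ _ => zero_le_one) (p := s / t)
    (by positivity) hlt
  have h0 : 0 ≤ ∑ i ∈ S, c i * y i ^ t :=
    Finset.sum_nonneg fun i hi => mul_nonneg (hc i hi) (Real.rpow_nonneg (hy i hi) t)
  refine (le_of_eq (Finset.sum_congr rfl fun i hi => ?_)).trans (h.trans ?_)
  · rw [← Real.rpow_mul (hy i hi), mul_div_cancel₀ _ ht.ne', Real.one_rpow, mul_one]
  · refine mul_le_of_le_one_right (Real.rpow_nonneg h0 _) (Real.rpow_le_one ?_ ?_ (by linarith))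
    · exact Finset.sum_nonneg fun i hi => mul_nonneg (hc i hi) zero_le_one
    · simpa using hc1

/-- The weights do not depend on u and v and sum to tr ρ = 1, so Jensen's inequality can compare
different exponents. -/
theorem trace_sandOp_mul_mpow_eq_sum {ω : Matrix n n ℂ} (hω : ω.PosSemidef) (hσ : σ.PosSemidef)
    (u v : ℝ) : (sandOp ρ σ u * mpow ω v).trace.re =
      ∑ r : n × n, overlap hω.1 hσ.1 (mpow ρ (1 / 2)) r *
        (hω.1.eigenvalues r.1 ^ v * hσ.1.eigenvalues r.2 ^ u) := by
  rw [← trace_mpow_mul_mpow hω.1 hσ.1, (isHermitian_mpow ρ _).eq, Matrix.trace_mul_comm, sandOp]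
  simp only [Matrix.mul_assoc]

theorem sum_overlap_sqrt {ω : Matrix n n ℂ} (hρ : IsState ρ) (hω : ω.PosSemidef)
    (hσ : σ.PosSemidef) : ∑ r : n × n, overlap hω.1 hσ.1 (mpow ρ (1 / 2)) r = 1 := by
  have h := trace_sandOp_mul_mpow_eq_sum (ρ := ρ) hω hσ 0 0
  rw [mpow_zero hω, Matrix.mul_one, sandOp, mpow_zero hσ, Matrix.mul_one, sqrt_mul_self hρ.1] at h
  have h2 : ρ.trace.re = 1 := by rw [hρ.2, Complex.one_re]
  simp only [Real.rpow_zero, mul_one] at h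
  exact h.symm.trans h2

/-- The variational functional for the sandwiched divergence is monotone. -/
theorem trace_sandOp_jensen {ω : Matrix n n ℂ} (hρ : IsState ρ) (hω : ω.PosSemidef)
    (hσ : σ.PosSemidef) {u v : ℝ} (h : (0 < u ∧ u < v) ∨ (v < u ∧ u < 0)) :
    (sandOp ρ σ u * mpow ω (-u)).trace.re ≤ (sandOp ρ σ v * mpow ω (-v)).trace.re ^ (u / v) := by
  have h1 := (sum_overlap_sqrt hρ hω hσ).le
  rw [trace_sandOp_mul_mpow_eq_sum hω hσ, trace_sandOp_mul_mpow_eq_sum hω hσ]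
  rcases h with ⟨hu, huv⟩ | ⟨hvu, hu⟩
  · have h2 := sum_mul_rpow_le_rpow Finset.univ
      (c := overlap hω.1 hσ.1 (mpow ρ (1 / 2)))
      (y := fun r => hσ.1.eigenvalues r.2 / hω.1.eigenvalues r.1)
      (fun r _ => overlap_nonneg _ _ _ r) h1
      (fun r _ => div_nonneg (hσ.eigenvalues_nonneg _) (hω.eigenvalues_nonneg _)) hu huv
    have e : ∀ (w : ℝ) (r : n × n), (hσ.1.eigenvalues r.2 / hω.1.eigenvalues r.1) ^ w =
        hω.1.eigenvalues r.1 ^ (-w) * hσ.1.eigenvalues r.2 ^ w := by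
      intro w r
      rw [Real.div_rpow (hσ.eigenvalues_nonneg _) (hω.eigenvalues_nonneg _),
        Real.rpow_neg (hω.eigenvalues_nonneg _), div_eq_mul_inv, mul_comm]
    simpa only [e] using h2
  -- For negative exponents the inverted ratio of eigenvalues makes the Jensen exponents -u < -v
  -- positive.
  · have h2 := sum_mul_rpow_le_rpow Finset.univ
      (c := overlap hω.1 hσ.1 (mpow ρ (1 / 2)))
      (y := fun r => hω.1.eigenvalues r.1 / hσ.1.eigenvalues r.2)
      (fun r _ => overlap_nonneg _ _ _ r) h1
      (fun r _ => div_nonneg (hω.eigenvalues_nonneg _) (hσ.eigenvalues_nonneg _))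
      (s := -u) (t := -v) (by linarith) (by linarith)
    have e : ∀ (w : ℝ) (r : n × n), (hω.1.eigenvalues r.1 / hσ.1.eigenvalues r.2) ^ (-w) =
        hω.1.eigenvalues r.1 ^ (-w) * hσ.1.eigenvalues r.2 ^ w := by
      intro w r
      rw [Real.div_rpow (hω.eigenvalues_nonneg _) (hσ.eigenvalues_nonneg _),
        Real.rpow_neg (hσ.eigenvalues_nonneg _), div_inv_eq_mul]
    simpa only [e, neg_div_neg_eq] using h2

/-- Attainment in the variational formula for (tr Z^α)^{1/α}, by the equality case of Hölder. -/
theorem exists_state_trace_sandOp_eq (hρ : IsState ρ) (hσ : σ.PosSemidef) (h : ρ * σ ≠ 0) {α : ℝ}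
    (h0 : α ≠ 0) (h1 : α ≠ 1) :
    ∃ ω : Matrix n n ℂ, IsState ω ∧
      sandOp ρ σ ((1 - α) / α) * supp ω = sandOp ρ σ ((1 - α) / α) ∧
      (sandOp ρ σ ((1 - α) / α) * mpow ω (-((1 - α) / α))).trace.re =
        sandQ ρ σ α ^ (1 / α) := by
  have hZ0 := sandOp_ne_zero hρ.1 hσ h (div_ne_zero (sub_ne_zero.mpr h1.symm) h0)
  have hZ := posSemidef_sandOp (ρ := ρ) hσ ((1 - α) / α)
  refine ⟨powState (sandOp ρ σ ((1 - α) / α)) α, isState_powState hZ hZ0 α,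
    mul_supp_powState hZ hZ0 h0, ?_⟩
  rw [trace_mul_mpow_powState hZ hZ0 (by field_simp; ring) h0, ← sandQ_eq hρ.1 hσ h0 h1]
  congr 1
  field_simp
  ring

theorem sandQ_nonneg (hρ : ρ.PosSemidef) (hσ : σ.PosSemidef) {α : ℝ} (h0 : α ≠ 0)
    (h1 : α ≠ 1) : 0 ≤ sandQ ρ σ α := by
  rw [sandQ_eq hρ hσ h0 h1]
  exact trace_mpow_nonneg (posSemidef_sandOp hσ _) _

theorem trace_sandOp_le_of_one_lt {ω : Matrix n n ℂ} (hρ : IsState ρ) (hσ : σ.PosSemidef)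
    (hω : IsState ω) {α : ℝ} (h1 : 1 < α) :
    (sandOp ρ σ ((1 - α) / α) * mpow ω (-((1 - α) / α))).trace.re ≤ sandQ ρ σ α ^ (1 / α) := by
  have h0 : 0 < α := by linarith
  have hi : 1 / α < 1 := by rw [div_lt_one h0]; exact h1
  have hi0 : 0 < 1 / α := by positivity
  have h := trace_mul_mpow_le (posSemidef_sandOp (ρ := ρ) hσ ((1 - α) / α)) hω (s := 1 - 1 / α)
    (by linarith) (by linarith)
  rw [sub_sub_cancel, one_div_one_div, ← sandQ_eq hρ.1 hσ h0.ne' h1.ne'] at h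
  have e : -((1 - α) / α) = 1 - 1 / α := by field_simp; ring
  rwa [e]

theorem rpow_le_trace_mul_mpow {Z ω : Matrix n n ℂ} (hZ : Z.PosSemidef) (hω : IsState ω)
    (h : Z * supp ω = Z) {α : ℝ} (h0 : 0 < α) (h1 : α < 1) :
    (mpow Z α).trace.re ^ (1 / α) ≤ (Z * mpow ω (-((1 - α) / α))).trace.re := by
  have h2 := le_trace_mul_mpow_neg hZ hω h (s := (1 - α) / α)
    (div_pos (by linarith) h0)
  have e : 1 + (1 - α) / α = 1 / α := by field_simp; ring
  rwa [e, one_div_one_div] at h2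

/-- The kernel of ρ^{1/2}σ^uρ^{1/2} is that of σ^{u/2}ρ^{1/2}, which is the same for all u ≠ 0. -/
theorem sandOp_mul_eq_of_sandOp_mul_eq {P : Matrix n n ℂ} (hσ : σ.PosSemidef) {u v : ℝ}
    (hu : u ≠ 0) (hv : v ≠ 0) (hP : sandOp ρ σ u * P = sandOp ρ σ u) :
    sandOp ρ σ v * P = sandOp ρ σ v := by
  set G := mpow σ (u / 2) * mpow ρ (1 / 2) with hG
  have e : sandOp ρ σ u = Gᴴ * G := by
    rw [hG, Matrix.conjTranspose_mul, (isHermitian_mpow ρ _).eq, (isHermitian_mpow σ _).eq,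
      sandOp, ← mpow_half_mul_self hσ u hu]
    simp only [Matrix.mul_assoc]
  have h1 : Gᴴ * G * (P - 1) = 0 := by
    rw [← e, Matrix.mul_sub, hP, Matrix.mul_one, sub_self]
  rw [Matrix.conjTranspose_mul_self_mul_eq_zero] at h1
  have h2 : sandOp ρ σ v = mpow ρ (1 / 2) * mpow σ (v - u / 2) * G := by
    have : mpow σ v = mpow σ (v - u / 2) * mpow σ (u / 2) := by
      rw [mpow_mul_mpow hσ (by simpa using hv)]; congr 1; ring
    rw [sandOp, this, hG]
    simp only [Matrix.mul_assoc]
  have h3 : sandOp ρ σ v * (P - 1) = 0 := by rw [h2, Matrix.mul_assoc, h1, Matrix.mul_zero]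
  rwa [Matrix.mul_sub, Matrix.mul_one, sub_eq_zero] at h3

/-- Take ω optimal at order α, pass to β by Jensen at fixed ω, and bound by the trace at β through
Hölder. -/
theorem sandQ_le_rpow_of_one_lt (hρ : IsState ρ) (hσ : σ.PosSemidef) (h : ρ * σ ≠ 0) {α β : ℝ}
    (h1 : 1 < α) (hαβ : α < β) : sandQ ρ σ α ≤ sandQ ρ σ β ^ ((α - 1) / (β - 1)) := by
  have h0 : 0 < α := by linarith
  have h0' : 0 < β := by linarith
  obtain ⟨ω, hω, -, heq⟩ := exists_state_trace_sandOp_eq hρ hσ h h0.ne' h1.ne'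
  have hQ := sandQ_nonneg hρ.1 hσ h0.ne' h1.ne'
  have hQ' := sandQ_nonneg hρ.1 hσ h0'.ne' (by linarith : β ≠ 1)
  have hu : (1 - α) / α < 0 := div_neg_of_neg_of_pos (by linarith) h0
  have hv : (1 - β) / β < (1 - α) / α := by
    rw [div_lt_div_iff₀ h0' h0]; nlinarith
  have h2 := trace_sandOp_jensen hρ hω.1 hσ (Or.inr ⟨hv, hu⟩)
  have h3 := trace_sandOp_le_of_one_lt hρ hσ hω (h1.trans hαβ)
  have hK : 0 ≤ (sandOp ρ σ ((1 - β) / β) * mpow ω (-((1 - β) / β))).trace.re := by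
    rw [trace_sandOp_mul_mpow_eq_sum hω.1 hσ]
    exact Finset.sum_nonneg fun r _ => mul_nonneg (overlap_nonneg _ _ _ _)
      (mul_nonneg (Real.rpow_nonneg (hω.1.eigenvalues_nonneg _) _)
        (Real.rpow_nonneg (hσ.eigenvalues_nonneg _) _))
  have hp : 0 ≤ (1 - α) / α / ((1 - β) / β) := by
    rw [div_nonneg_iff]; right; constructor <;> linarith
  have h4 := h2.trans (Real.rpow_le_rpow hK h3 hp)
  rw [heq] at h4
  have h5 := Real.rpow_le_rpow (Real.rpow_nonneg hQ _) h4 h0.le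
  rw [← Real.rpow_mul hQ, one_div_mul_cancel h0.ne', Real.rpow_one, ← Real.rpow_mul hQ',
    ← Real.rpow_mul hQ'] at h5
  refine h5.trans (le_of_eq ?_)
  congr 1
  have : 1 - β ≠ 0 := by linarith
  have : β - 1 ≠ 0 := by linarith
  field_simp
  ring

/-- Again ω is optimal at order α, but reverse Hölder at β comes before Jensen; it needs the support
condition at the exponent of β. -/
theorem sandQ_le_rpow_of_lt_one (hρ : IsState ρ) (hσ : σ.PosSemidef) (h : ρ * σ ≠ 0) {α β : ℝ}
    (h0 : 0 < α) (hαβ : α < β) (h1 : β < 1) :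
    sandQ ρ σ β ≤ sandQ ρ σ α ^ ((β - 1) / (α - 1)) := by
  have h0' : 0 < β := by linarith
  have h1' : α ≠ 1 := by linarith
  obtain ⟨ω, hω, hsupp, heq⟩ := exists_state_trace_sandOp_eq hρ hσ h h0.ne' h1'
  have hQ := sandQ_nonneg hρ.1 hσ h0.ne' h1'
  have hQ' := sandQ_nonneg hρ.1 hσ h0'.ne' h1.ne
  have hu : 0 < (1 - β) / β := div_pos (by linarith) h0'
  have hv : (1 - β) / β < (1 - α) / α := by
    rw [div_lt_div_iff₀ h0' h0]; nlinarith
  have h2 := trace_sandOp_jensen hρ hω.1 hσ (Or.inl ⟨hu, hv⟩)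
  have hs2 := sandOp_mul_eq_of_sandOp_mul_eq hσ (by linarith) hu.ne' hsupp
  have h3 := (rpow_le_trace_mul_mpow (posSemidef_sandOp hσ _) hω hs2 h0' h1).trans h2
  rw [heq, ← sandQ_eq hρ.1 hσ h0'.ne' h1.ne] at h3
  have h5 := Real.rpow_le_rpow (Real.rpow_nonneg hQ' _) h3 h0'.le
  rw [← Real.rpow_mul hQ', one_div_mul_cancel h0'.ne', Real.rpow_one, ← Real.rpow_mul hQ,
    ← Real.rpow_mul hQ] at h5
  refine h5.trans (le_of_eq ?_)
  congr 1
  have : 1 - α ≠ 0 := by linarith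
  have : α - 1 ≠ 0 := by linarith
  field_simp
  ring

/-- Jensen for the ratio λ/μ of eigenvalues of ρ and σ, raised to α-1, under the weights overlap · λ
of total mass 1. -/
theorem petzQ_le_rpow_of_one_lt (hρ : IsState ρ) (hσ : σ.PosSemidef) {α β : ℝ}
    (h1 : 1 < α) (hαβ : α < β) : petzQ ρ σ α ≤ petzQ ρ σ β ^ ((α - 1) / (β - 1)) := by
  rw [petzQ_eq_sum hρ.1 hσ, petzQ_eq_sum hρ.1 hσ]
  have h2 := sum_mul_rpow_le_rpow Finset.univ
    (c := fun r => overlap hρ.1.1 hσ.1 1 r * hρ.1.1.eigenvalues r.1)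
    (y := fun r => hρ.1.1.eigenvalues r.1 / hσ.1.eigenvalues r.2)
    (fun r _ => mul_nonneg (overlap_nonneg _ _ _ r) (hρ.1.eigenvalues_nonneg _))
    (sum_overlap_mul hρ hσ).le
    (fun r _ => div_nonneg (hρ.1.eigenvalues_nonneg _) (hσ.eigenvalues_nonneg _))
    (s := α - 1) (t := β - 1) (by linarith) (by linarith)
  have e : ∀ (γ : ℝ) (r : n × n), γ ≠ 0 → overlap hρ.1.1 hσ.1 1 r * hρ.1.1.eigenvalues r.1 *
      (hρ.1.1.eigenvalues r.1 / hσ.1.eigenvalues r.2) ^ (γ - 1) =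
      overlap hρ.1.1 hσ.1 1 r *
        (hρ.1.1.eigenvalues r.1 ^ γ * hσ.1.eigenvalues r.2 ^ (1 - γ)) := by
    intro γ r hγ
    rw [Real.div_rpow (hρ.1.eigenvalues_nonneg _) (hσ.eigenvalues_nonneg _), ← neg_sub γ 1,
      Real.rpow_neg (hσ.eigenvalues_nonneg _)]
    have : hρ.1.1.eigenvalues r.1 ^ γ =
        hρ.1.1.eigenvalues r.1 * hρ.1.1.eigenvalues r.1 ^ (γ - 1) := by
      conv_rhs => rw [← Real.rpow_one_add' (hρ.1.eigenvalues_nonneg _) (by simpa using hγ)]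
      congr 1; ring
    rw [this, div_eq_mul_inv]
    ring
  have h0 : α ≠ 0 := by linarith
  have h0' : β ≠ 0 := by linarith
  simpa only [e α _ h0, e β _ h0'] using h2

theorem orderLog_ratio {α β q : ℝ} (hα : α ≠ 1) (hq : 0 < q) :
    orderLog α (q ^ ((α - 1) / (β - 1))) = orderLog β q := by
  refine orderLog_rpow hq ?_
  rw [mul_div_assoc', inv_mul_cancel₀ (sub_ne_zero.mpr hα), one_div]

theorem monotoneOn_divReal (hρ : IsState ρ) (hσ : σ.PosSemidef) :
    MonotoneOn (divReal ρ σ) (Set.Ioi 1) := by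
  intro α hα β hβ hαβ
  have hα : 1 < α := hα
  rcases hαβ.eq_or_lt with rfl | hlt
  · exact le_rfl
  by_cases hd : IsDominatedBy ρ σ
  · have hne := hd.mul_ne_zero hρ.ne_zero hσ
    rw [divReal_of_dominated hd, divReal_of_dominated hd,
      ← orderLog_ratio hα.ne' (petzQ_pos hρ.1 hσ hne β)]
    exact orderLog_mono hα (petzQ_pos hρ.1 hσ hne α) (petzQ_le_rpow_of_one_lt hρ hσ hα hlt)
  · rw [divReal_eq_top_of_le hd (hα.trans hlt).le]; exact le_top

theorem monotoneOn_sandwichedReal (hρ : IsState ρ) (hσ : σ.PosSemidef) :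
    MonotoneOn (sandwichedReal ρ σ) (Set.Ioi 1) := by
  intro α hα β hβ hαβ
  have hα : 1 < α := hα
  rcases hαβ.eq_or_lt with rfl | hlt
  · exact le_rfl
  by_cases hd : IsDominatedBy ρ σ
  · have hne := hd.mul_ne_zero hρ.ne_zero hσ
    have hpos : ∀ γ, 1 < γ → 0 < sandQ ρ σ γ := fun γ hγ =>
      sandQ_pos hρ.1 hσ hne (by linarith) hγ.ne'
    rw [sandwichedReal_of_dominated hd, sandwichedReal_of_dominated hd,
      ← orderLog_ratio hα.ne' (hpos β (hα.trans hlt))]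
    exact orderLog_mono hα (hpos α hα) (sandQ_le_rpow_of_one_lt hρ hσ hne hα hlt)
  · rw [sandwichedReal_eq_top_of_le hd (hα.trans hlt).le]; exact le_top

theorem monotoneOn_sandwichedReal_Ioo (hρ : IsState ρ) (hσ : σ.PosSemidef) :
    MonotoneOn (sandwichedReal ρ σ) (Set.Ioo 0 1) := by
  intro α hα β hβ hαβ
  rcases hαβ.eq_or_lt with rfl | hlt
  · exact le_rfl
  by_cases hne : ρ * σ = 0
  · rw [sandwichedReal_eq_top hρ.ne_zero hσ hne β]; exact le_top
  · have hpos : ∀ γ ∈ Set.Ioo (0 : ℝ) 1, 0 < sandQ ρ σ γ := fun γ hγ =>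
      sandQ_pos hρ.1 hσ hne hγ.1.ne' hγ.2.ne
    rw [sandwichedReal_of_mul_ne_zero hne hα.2, sandwichedReal_of_mul_ne_zero hne hβ.2,
      ← orderLog_ratio hβ.2.ne (hpos α hα)]
    exact orderLog_anti hβ.2 (hpos β hβ) (sandQ_le_rpow_of_lt_one hρ hσ hne hα.1 hlt hβ.2)

theorem exists_tendsto_atTop_of_monotoneOn {f : ℝ → EReal} (hf : MonotoneOn f (Set.Ioi 1)) :
    ∃ l, Tendsto f atTop (𝓝 l) := by
  have hm : Monotone fun x : ℝ => f (max x 2) := fun x y hxy =>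
    hf (Set.mem_Ioi.mpr (lt_max_of_lt_right one_lt_two))
      (Set.mem_Ioi.mpr (lt_max_of_lt_right one_lt_two)) (max_le_max_right 2 hxy)
  refine ⟨_, (tendsto_atTop_iSup hm).congr' ?_⟩
  filter_upwards [eventually_ge_atTop 2] with x hx
  rw [max_eq_left hx]

theorem tendsto_two_sub_one_div {α : ℝ} (h : α ≠ 0) :
    Tendsto (fun x : ℝ => 2 - 1 / x) (𝓝 α) (𝓝 (2 - 1 / α)) :=
  tendsto_const_nhds.sub (tendsto_const_nhds.div tendsto_id h)

theorem tendsto_two_sub_one_div_one :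
    Tendsto (fun x : ℝ => 2 - 1 / x) (𝓝[≠] 1) (𝓝[≠] 1) := by
  refine tendsto_nhdsWithin_iff.mpr ⟨?_, ?_⟩
  · have := tendsto_two_sub_one_div one_ne_zero
    norm_num at this
    simpa using this.mono_left nhdsWithin_le_nhds
  · filter_upwards [self_mem_nhdsWithin, nhdsWithin_le_nhds (eventually_ne_nhds one_ne_zero)]
      with x hx hx0 h
    have h2 : 1 / x = 1 := by
      have : 2 - 1 / x = 1 := h
      linarith
    rw [div_eq_one_iff_eq hx0] at h2
    exact hx h2.symm

/-- Squeezed between the Petz divergences at 2-1/α and at α, both orders tending to 1. -/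
theorem exists_tendsto_sandwichedReal_one (hρ : IsState ρ) (hσ : σ.PosSemidef) :
    ∃ l, Tendsto (sandwichedReal ρ σ) (𝓝[≠] 1) (𝓝 l) := by
  obtain ⟨l, hl⟩ := exists_tendsto_divReal_one hρ hσ
  refine ⟨l, tendsto_of_tendsto_of_tendsto_of_le_of_le' (hl.comp tendsto_two_sub_one_div_one) hl
    ?_ ?_⟩
  · filter_upwards [self_mem_nhdsWithin,
      nhdsWithin_le_nhds (eventually_gt_nhds (by norm_num : (1 / 2 : ℝ) < 1))] with x hx hx0
    exact divReal_two_sub_le hρ hσ hx0 hx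
  · filter_upwards [self_mem_nhdsWithin,
      nhdsWithin_le_nhds (eventually_gt_nhds (by norm_num : (1 / 2 : ℝ) < 1))] with x hx hx0
    exact sandwichedReal_le_divReal hρ hσ (by linarith) hx

theorem exists_tendsto_sandwichedReal_zero (hρ : IsState ρ) (hσ : σ.PosSemidef) :
    ∃ l, Tendsto (sandwichedReal ρ σ) (𝓝[>] 0) (𝓝 l) :=
  ⟨_, (monotoneOn_sandwichedReal_Ioo hρ hσ).tendsto_nhdsWithin_Ioo_right
    ⟨1 / 2, by norm_num, by norm_num⟩ (OrderBot.bddBelow _)⟩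

/-- A lower bound for the sandwiched divergence that is continuous at `2`. -/
theorem exists_tendsto_le_sandwichedReal_two (hρ : IsState ρ) (hσ : σ.PosSemidef)
    (hd : IsDominatedBy ρ σ) :
    ∃ φ : ℝ → EReal, Tendsto φ (𝓝 2) (𝓝 (sandwichedReal ρ σ 2)) ∧
      ∀ᶠ α in 𝓝 2, φ α ≤ sandwichedReal ρ σ α := by
  have hne := hd.mul_ne_zero hρ.ne_zero hσ
  obtain ⟨ω, hω, -, heq⟩ := exists_state_trace_sandOp_eq hρ hσ hne two_ne_zero (by norm_num)
  have hQ := sandQ_pos hρ.1 hσ hne two_ne_zero (by norm_num)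
  -- Freezing ω at the optimizer for order 2 gives a function continuous in α. By Hölder it is a
  -- lower bound at nearby orders, with equality at 2.
  set K : ℝ → ℝ := fun α => (sandOp ρ σ ((1 - α) / α) * mpow ω (-((1 - α) / α))).trace.re with hK
  have hK2 : K 2 = sandQ ρ σ 2 ^ (1 / 2 : ℝ) := heq
  have hK2pos : 0 < K 2 := by rw [hK2]; exact Real.rpow_pos_of_pos hQ _
  have hu : Tendsto (fun α : ℝ => (1 - α) / α) (𝓝 2) (𝓝 ((1 - 2) / 2)) :=
    (tendsto_const_nhds.sub tendsto_id).div tendsto_id two_ne_zero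
  have hKc : Tendsto K (𝓝 2) (𝓝 (K 2)) := by
    simp only [hK, trace_sandOp_mul_mpow_eq_sum hω.1 hσ]
    refine tendsto_finsetSum _ fun r _ => tendsto_const_nhds.mul (Tendsto.mul ?_ ?_)
    · exact (Real.continuousAt_const_rpow' (by norm_num)).tendsto.comp hu.neg
    · exact (Real.continuousAt_const_rpow' (by norm_num)).tendsto.comp hu
  refine ⟨fun α => orderLog α (K α ^ α), ?_, ?_⟩
  · have h1 : K 2 ^ (2 : ℝ) = sandQ ρ σ 2 := by
      rw [hK2, ← Real.rpow_mul hQ.le]; norm_num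
    rw [sandwichedReal_of_dominated hd]
    refine tendsto_coe_orderLog (by norm_num) hQ le_rfl ?_
    rw [← h1]
    exact hKc.rpow tendsto_id (Or.inl hK2pos.ne')
  · filter_upwards [hKc.eventually (eventually_gt_nhds hK2pos), eventually_gt_nhds one_lt_two] with α h1 h2
    have h0 : 0 < α := by linarith
    rw [sandwichedReal_of_dominated hd]
    refine orderLog_mono h2 (Real.rpow_pos_of_pos h1 _) ?_
    have h3 := Real.rpow_le_rpow h1.le (trace_sandOp_le_of_one_lt hρ hσ hω h2) h0.le
    rwa [← Real.rpow_mul (sandQ_nonneg hρ.1 hσ h0.ne' h2.ne'), one_div_mul_cancel h0.ne',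
      Real.rpow_one] at h3

/-- An upper bound for the sandwiched divergence that is continuous at `1 / 2`. -/
theorem exists_tendsto_ge_sandwichedReal_half (hρ : IsState ρ) (hσ : σ.PosSemidef) :
    ∃ ψ : ℝ → EReal, Tendsto ψ (𝓝[>] (1 / 2)) (𝓝 (sandwichedReal ρ σ (1 / 2))) ∧
      ∀ᶠ α in 𝓝[>] (1 / 2), sandwichedReal ρ σ α ≤ ψ α := by
  by_cases hne : ρ * σ = 0
  · refine ⟨fun _ => ⊤, ?_, Eventually.of_forall fun _ => le_top⟩
    rw [sandwichedReal_eq_top hρ.ne_zero hσ hne]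
    exact tendsto_const_nhds
  have hZ := posSemidef_sandOp (ρ := ρ) hσ 1
  have hZ0 := sandOp_ne_zero hρ.1 hσ hne one_ne_zero
  -- L is a strictly positive bound for the eigenvalues of σ. For α > 1/2 the exponent u = (1-α)/α
  -- is below 1, and μ ≤ L^{1-u} μ^u trades it for its value 1 at order 1/2.
  set L : ℝ := 1 + ∑ i, hσ.1.eigenvalues i with hL
  have hLi : ∀ i, hσ.1.eigenvalues i ≤ L := fun i => by
    have := Finset.single_le_sum (fun j _ => hσ.eigenvalues_nonneg j) (Finset.mem_univ i)
    linarith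
  have hLpos : 0 < L := by
    have := Finset.sum_nonneg fun (j : n) (_ : j ∈ Finset.univ) => hσ.eigenvalues_nonneg j
    linarith
  refine ⟨fun α => orderLog α (L ^ (1 - 2 * α) * (mpow (sandOp ρ σ 1) α).trace.re), ?_, ?_⟩
  · rw [sandwichedReal_of_mul_ne_zero hne (by norm_num)]
    refine tendsto_coe_orderLog (by norm_num)
      (sandQ_pos hρ.1 hσ hne (by norm_num) (by norm_num)) nhdsWithin_le_nhds ?_
    have e : sandQ ρ σ (1 / 2) = L ^ (1 - 2 * (1 / 2) : ℝ) *
        (mpow (sandOp ρ σ 1) (1 / 2)).trace.re := by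
      rw [sandQ_eq hρ.1 hσ (by norm_num) (by norm_num)]
      norm_num
    rw [e]
    refine Tendsto.mono_left ?_ nhdsWithin_le_nhds
    refine Tendsto.mul ?_ ?_
    · have h1 : Tendsto (fun α : ℝ => 1 - 2 * α) (𝓝 (1 / 2)) (𝓝 (1 - 2 * (1 / 2))) :=
        tendsto_const_nhds.sub (tendsto_const_nhds.mul tendsto_id)
      exact (Real.continuousAt_const_rpow hLpos.ne').tendsto.comp h1
    · simp only [trace_mpow_eq hZ.1]
      exact tendsto_finsetSum _ fun r _ => (Real.continuousAt_const_rpow' (by norm_num)).tendsto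
  · filter_upwards [Ioo_mem_nhdsGT (by norm_num : (1 / 2 : ℝ) < 1)] with α hα
    have h0 : 0 < α := by linarith [hα.1]
    have h1 := hα.2
    have hu0 : 0 < (1 - α) / α := div_pos (by linarith) h0
    have hu1 : (1 - α) / α < 1 := by rw [div_lt_one h0]; linarith [hα.1]
    obtain ⟨ω, hω, hsupp, heq⟩ := exists_state_trace_sandOp_eq hρ hσ hne h0.ne' h1.ne
    rw [sandwichedReal_of_mul_ne_zero hne h1]
    refine orderLog_anti h1 (mul_pos (Real.rpow_pos_of_pos hLpos _) (trace_mpow_pos hZ hZ0 _)) ?_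
    have hs2 := sandOp_mul_eq_of_sandOp_mul_eq hσ hu0.ne' one_ne_zero hsupp
    have h2 := rpow_le_trace_mul_mpow hZ hω hs2 h0 h1
    have h3 : (sandOp ρ σ 1 * mpow ω (-((1 - α) / α))).trace.re ≤
        L ^ (1 - (1 - α) / α) *
          (sandOp ρ σ ((1 - α) / α) * mpow ω (-((1 - α) / α))).trace.re := by
      rw [trace_sandOp_mul_mpow_eq_sum hω.1 hσ, trace_sandOp_mul_mpow_eq_sum hω.1 hσ,
        Finset.mul_sum]
      refine Finset.sum_le_sum fun r _ => ?_
      have hμ := hσ.eigenvalues_nonneg r.2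
      have h4 : hσ.1.eigenvalues r.2 ^ (1 : ℝ) ≤
          L ^ (1 - (1 - α) / α) * hσ.1.eigenvalues r.2 ^ ((1 - α) / α) := by
        have e : (1 : ℝ) = (1 - (1 - α) / α) + (1 - α) / α := by ring
        conv_lhs => rw [e, Real.rpow_add' hμ (by rw [← e]; norm_num)]
        exact mul_le_mul_of_nonneg_right (Real.rpow_le_rpow hμ (hLi _) (by linarith))
          (Real.rpow_nonneg hμ _)
      have h5 := mul_le_mul_of_nonneg_left h4 (mul_nonneg (overlap_nonneg hω.1.1 hσ.1
        (mpow ρ (1 / 2)) r) (Real.rpow_nonneg (hω.1.eigenvalues_nonneg r.1) (-((1 - α) / α))))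
      refine (le_of_eq ?_).trans (h5.trans (le_of_eq ?_)) <;> ring
    rw [heq] at h3
    have hQ := sandQ_nonneg hρ.1 hσ h0.ne' h1.ne
    have hT := trace_mpow_nonneg hZ α
    have h6 := Real.rpow_le_rpow (Real.rpow_nonneg hT _) (h2.trans h3) h0.le
    rw [← Real.rpow_mul hT, one_div_mul_cancel h0.ne', Real.rpow_one,
      Real.mul_rpow (Real.rpow_nonneg hLpos.le _) (Real.rpow_nonneg hQ _), ← Real.rpow_mul hQ,
      one_div_mul_cancel h0.ne', Real.rpow_one, ← Real.rpow_mul hLpos.le] at h6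
    have e : (1 - (1 - α) / α) * α = -(1 - 2 * α) := by field_simp; ring
    rw [e, Real.rpow_neg hLpos.le] at h6
    have hLp := Real.rpow_pos_of_pos hLpos (1 - 2 * α)
    calc _ ≤ L ^ (1 - 2 * α) * ((L ^ (1 - 2 * α))⁻¹ * sandQ ρ σ α) :=
          mul_le_mul_of_nonneg_left h6 hLp.le
      _ = _ := by rw [mul_inv_cancel_left₀ hLp.ne']

end Monotonicity

/-! ### Extension of the comparisons to all orders in [1/2, ∞]. -/

section Orders

/-- `limUnder` is an actual limit only when one exists, hence the hypothesis. -/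
theorem tendsto_extendOrder_zero {D : ℝ → EReal} (h : ∃ l, Tendsto D (𝓝[>] 0) (𝓝 l)) :
    Tendsto D (𝓝[>] 0) (𝓝 (extendOrder D 0)) := by
  rw [extendOrder, if_pos rfl]
  exact tendsto_nhds_limUnder h

theorem tendsto_extendOrder_one {D : ℝ → EReal} (h : ∃ l, Tendsto D (𝓝[≠] 1) (𝓝 l)) :
    Tendsto D (𝓝[≠] 1) (𝓝 (extendOrder D 1)) := by
  rw [extendOrder, if_neg one_ne_zero, if_pos rfl]
  exact tendsto_nhds_limUnder h

theorem tendsto_extendOrder_top {D : ℝ → EReal} (h : ∃ l, Tendsto D atTop (𝓝 l)) :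
    Tendsto D atTop (𝓝 (extendOrder D ∞)) := by
  rw [extendOrder, if_neg ENNReal.top_ne_zero, if_neg ENNReal.top_ne_one, if_pos rfl]
  exact tendsto_nhds_limUnder h

theorem extendOrder_ofReal {D : ℝ → EReal} {α : ℝ} (h0 : 0 < α) (h1 : α ≠ 1) :
    extendOrder D (ENNReal.ofReal α) = D α := by
  rw [extendOrder, if_neg (by simpa using h0), if_neg (by simpa using h1),
    if_neg ENNReal.ofReal_ne_top, ENNReal.toReal_ofReal h0.le]

/-- Comparison of two families at all orders, from the comparison at generic orders. -/
theorem extendOrder_le {f g : ℝ → EReal} (h : ∀ α, 1 / 2 ≤ α → α ≠ 1 → f α ≤ g α)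
    (f1 : ∃ l, Tendsto f (𝓝[≠] 1) (𝓝 l)) (g1 : ∃ l, Tendsto g (𝓝[≠] 1) (𝓝 l))
    (ft : ∃ l, Tendsto f atTop (𝓝 l)) (gt : ∃ l, Tendsto g atTop (𝓝 l)) {α : ℝ≥0∞}
    (hα : 1 / 2 ≤ α) : extendOrder f α ≤ extendOrder g α := by
  by_cases ht : α = ∞
  · subst ht
    refine le_of_tendsto_of_tendsto (tendsto_extendOrder_top ft) (tendsto_extendOrder_top gt) ?_
    filter_upwards [eventually_gt_atTop 1] with x hx
    exact h x (by linarith) hx.ne'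
  lift α to NNReal using ht
  have hα' : (1 / 2 : ℝ) ≤ α := by
    have h2 := ENNReal.toReal_mono ENNReal.coe_ne_top hα
    simpa using h2
  rcases eq_or_ne (α : ℝ) 1 with h1 | h1
  · have : α = 1 := by exact_mod_cast h1
    subst this
    rw [ENNReal.coe_one]
    refine le_of_tendsto_of_tendsto (tendsto_extendOrder_one f1) (tendsto_extendOrder_one g1) ?_
    filter_upwards [self_mem_nhdsWithin,
      nhdsWithin_le_nhds (eventually_gt_nhds (by norm_num : (1 / 2 : ℝ) < 1))] with x hx hx0
    exact h x hx0.le hx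
  · rw [← ENNReal.ofReal_coe_nnreal, extendOrder_ofReal (by linarith) h1,
      extendOrder_ofReal (by linarith) h1]
    exact h _ hα' h1

/-- Comparison of two families at the orders `2 - 1 / α` and `α`, from the comparison at generic
orders. -/
theorem extendOrder_two_sub_le {f g φ ψ : ℝ → EReal}
    (h : ∀ α, 1 / 2 < α → α ≠ 1 → f (2 - 1 / α) ≤ g α)
    (f0 : ∃ l, Tendsto f (𝓝[>] 0) (𝓝 l)) (f1 : ∃ l, Tendsto f (𝓝[≠] 1) (𝓝 l))
    (g1 : ∃ l, Tendsto g (𝓝[≠] 1) (𝓝 l)) (gt : ∃ l, Tendsto g atTop (𝓝 l))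
    (hφ : Tendsto φ (𝓝 2) (𝓝 (f 2))) (hφf : ∀ᶠ α in 𝓝 2, φ α ≤ f α)
    (hψ : Tendsto ψ (𝓝[>] (1 / 2)) (𝓝 (g (1 / 2)))) (hgψ : ∀ᶠ α in 𝓝[>] (1 / 2), g α ≤ ψ α)
    {α : ℝ≥0∞} (hα : 1 / 2 ≤ α) : extendOrder f (2 - 1 / α) ≤ extendOrder g α := by
  by_cases ht : α = ∞
  · subst ht
    have e : extendOrder f (2 - 1 / ∞) = f 2 := by
      have := extendOrder_ofReal (D := f) (two_pos) (by norm_num)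
      simpa using this
    rw [e]
    have hlim : Tendsto (fun x : ℝ => 2 - 1 / x) atTop (𝓝 2) := by
      have := (tendsto_const_nhds (x := (2 : ℝ))).sub
        (tendsto_const_nhds (x := (1 : ℝ)).div_atTop tendsto_id)
      simpa using this
    -- On the left the order tends to the interior value 2, where f need not be known continuous;
    -- the lower bound φ recovers f 2 in the limit.
    refine le_of_tendsto_of_tendsto (hφ.comp hlim) (tendsto_extendOrder_top gt) ?_
    filter_upwards [hlim.eventually hφf, eventually_gt_atTop 1] with x hx hx1
    exact hx.trans (h x (by linarith) hx1.ne')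
  lift α to NNReal using ht
  have hα' : (1 / 2 : ℝ) ≤ α := by
    have h2 := ENNReal.toReal_mono ENNReal.coe_ne_top hα
    simpa using h2
  have hpos : (0 : ℝ) < α := by linarith
  -- Truncated subtraction causes no loss here, since 1/α ≤ 2.
  have e : (2 - 1 / (α : ℝ≥0∞)) = ENNReal.ofReal (2 - 1 / (α : ℝ)) := by
    rw [ENNReal.ofReal_sub _ (by positivity), ENNReal.ofReal_div_of_pos hpos]
    simp
  rw [e]
  rcases hα'.eq_or_lt with h2 | h2
  · have e1 : (α : ℝ≥0∞) = ENNReal.ofReal (1 / 2) := by rw [h2, ENNReal.ofReal_coe_nnreal]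
    have e2 : (2 - 1 / (1 / 2) : ℝ) = 0 := by norm_num
    have eL : extendOrder f (ENNReal.ofReal (2 - 1 / (α : ℝ))) = extendOrder f 0 := by
      rw [← h2, e2, ENNReal.ofReal_zero]
    have eR : extendOrder g (α : ℝ≥0∞) = g (1 / 2) := by
      rw [e1, extendOrder_ofReal (by norm_num) (by norm_num)]
    rw [eL, eR]
    have hlim : Tendsto (fun x : ℝ => 2 - 1 / x) (𝓝[>] (1 / 2)) (𝓝[>] 0) := by
      refine tendsto_nhdsWithin_iff.mpr ⟨?_, ?_⟩
      · have := tendsto_two_sub_one_div (α := 1 / 2) (by norm_num)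
        rw [e2] at this
        exact this.mono_left nhdsWithin_le_nhds
      · filter_upwards [self_mem_nhdsWithin] with x hx
        have hx : 1 / 2 < x := hx
        have : 1 / x < 2 := by rw [div_lt_iff₀ (by linarith)]; linarith
        simpa using this
    -- At α = 1/2 the left order is 0, reached from above; ψ replaces continuity of g on the right.
    refine le_of_tendsto_of_tendsto ((tendsto_extendOrder_zero f0).comp hlim) hψ ?_
    filter_upwards [hgψ, Ioo_mem_nhdsGT (by norm_num : (1 / 2 : ℝ) < 1)] with x hx hx1
    exact (h x hx1.1 hx1.2.ne).trans hx
  rcases eq_or_ne (α : ℝ) 1 with h1 | h1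
  · have : α = 1 := by exact_mod_cast h1
    subst this
    have e2 : (2 - 1 / ((1 : NNReal) : ℝ) : ℝ) = 1 := by norm_num
    rw [e2, ENNReal.coe_one, ENNReal.ofReal_one]
    refine le_of_tendsto_of_tendsto ((tendsto_extendOrder_one f1).comp
      tendsto_two_sub_one_div_one) (tendsto_extendOrder_one g1) ?_
    filter_upwards [self_mem_nhdsWithin,
      nhdsWithin_le_nhds (eventually_gt_nhds (by norm_num : (1 / 2 : ℝ) < 1))] with x hx hx0
    exact h x hx0 hx
  · have hlt : 1 / (α : ℝ) < 2 := by rw [div_lt_iff₀ hpos]; linarith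
    rw [extendOrder_ofReal (by linarith), ← ENNReal.ofReal_coe_nnreal,
      extendOrder_ofReal hpos h1]
    · exact h _ h2 h1
    · intro h3
      have h4 : 1 / (α : ℝ) = 1 := by linarith
      rw [div_eq_one_iff_eq hpos.ne'] at h4
      exact h1 h4.symm

variable {n : Type*} [Fintype n] [DecidableEq n] {ρ σ : Matrix n n ℂ} {α : ℝ≥0∞}

theorem sandwichedDiv_le_renyiDiv (hρ : IsState ρ) (hσ : σ.PosSemidef) (hα : 1 / 2 ≤ α) :
    sandwichedDiv α ρ σ ≤ renyiDiv α ρ σ :=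
  extendOrder_le (fun _ h0 h1 => sandwichedReal_le_divReal hρ hσ (by linarith) h1)
    (exists_tendsto_sandwichedReal_one hρ hσ) (exists_tendsto_divReal_one hρ hσ)
    (exists_tendsto_atTop_of_monotoneOn (monotoneOn_sandwichedReal hρ hσ))
    (exists_tendsto_atTop_of_monotoneOn (monotoneOn_divReal hρ hσ)) hα

theorem renyiDiv_two_sub_le_sandwichedDiv (hρ : IsState ρ) (hσ : σ.PosSemidef)
    (hα : 1 / 2 ≤ α) : renyiDiv (2 - 1 / α) ρ σ ≤ sandwichedDiv α ρ σ := by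
  obtain ⟨ψ, hψ, hψ'⟩ := exists_tendsto_ge_sandwichedReal_half hρ hσ
  exact extendOrder_two_sub_le (fun _ h0 h1 => divReal_two_sub_le hρ hσ h0 h1)
    (exists_tendsto_divReal_zero hρ hσ) (exists_tendsto_divReal_one hρ hσ)
    (exists_tendsto_sandwichedReal_one hρ hσ)
    (exists_tendsto_atTop_of_monotoneOn (monotoneOn_sandwichedReal hρ hσ))
    (continuousAt_divReal hρ hσ two_ne_zero (by norm_num)) (Eventually.of_forall fun _ => le_rfl)
    hψ hψ' hα

section Marginal

variable {a b : Type*} [Fintype a] [DecidableEq a] [Fintype b] [DecidableEq b]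
  {ρ : Matrix (a × b) (a × b) ℂ} {σ : Matrix b b ℂ}

theorem renyiDiv_marginalB_two_sub_le (hρ : IsState ρ) (hσ : IsState σ) (hα : 1 / 2 ≤ α) :
    renyiDiv (2 - 1 / α) ρ ((1 : Matrix a a ℂ) ⊗ₖ marginalB ρ) ≤
      renyiDiv α ρ ((1 : Matrix a a ℂ) ⊗ₖ σ) := by
  have hB := posSemidef_one_kronecker (a := a) (posSemidef_marginalB hρ.1)
  have hσ' := posSemidef_one_kronecker (a := a) hσ.1
  exact extendOrder_two_sub_le (fun _ h0 h1 => divReal_marginalB_two_sub_le hρ hσ h0 h1)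
    (exists_tendsto_divReal_zero hρ hB) (exists_tendsto_divReal_one hρ hB)
    (exists_tendsto_divReal_one hρ hσ')
    (exists_tendsto_atTop_of_monotoneOn (monotoneOn_divReal hρ hσ'))
    (continuousAt_divReal hρ hB two_ne_zero (by norm_num)) (Eventually.of_forall fun _ => le_rfl)
    ((continuousAt_divReal hρ hσ' (by norm_num) (by norm_num)).mono_left nhdsWithin_le_nhds)
    (Eventually.of_forall fun _ => le_rfl) hα

theorem sandwichedDiv_marginalB_two_sub_le (hρ : IsState ρ) (hσ : IsState σ)
    (hα : 1 / 2 ≤ α) :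
    sandwichedDiv (2 - 1 / α) ρ ((1 : Matrix a a ℂ) ⊗ₖ marginalB ρ) ≤
      sandwichedDiv α ρ ((1 : Matrix a a ℂ) ⊗ₖ σ) := by
  have hB := posSemidef_one_kronecker (a := a) (posSemidef_marginalB hρ.1)
  have hσ' := posSemidef_one_kronecker (a := a) hσ.1
  obtain ⟨φ, hφ, hφ'⟩ :=
    exists_tendsto_le_sandwichedReal_two hρ hB (isDominatedBy_marginalB hρ.1)
  obtain ⟨ψ, hψ, hψ'⟩ := exists_tendsto_ge_sandwichedReal_half hρ hσ'
  exact extendOrder_two_sub_le (fun _ h0 h1 => sandwichedReal_marginalB_two_sub_le hρ hσ h0 h1)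
    (exists_tendsto_sandwichedReal_zero hρ hB) (exists_tendsto_sandwichedReal_one hρ hB)
    (exists_tendsto_sandwichedReal_one hρ hσ')
    (exists_tendsto_atTop_of_monotoneOn (monotoneOn_sandwichedReal hρ hσ'))
    hφ hφ' hψ hψ' hα

end Marginal

end Orders

end QRenyi

end

/-! ### The eight inequalities, from the four comparisons of divergences. -/

theorem mainTheorem3 {a b : Type*} [Fintype a] [DecidableEq a] [Fintype b] [DecidableEq b]
    (ρ : Matrix (a × b) (a × b) ℂ) (hρ : QRenyi.IsState ρ)
    (α : ℝ≥0∞) (hα : 1 / 2 ≤ α) :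
    (QRenyi.condUp α ρ ≤ QRenyi.sandwichedCondUp α ρ ∧
      QRenyi.sandwichedCondUp α ρ ≤ QRenyi.condUp (2 - 1 / α) ρ) ∧
    (QRenyi.condDown α ρ ≤ QRenyi.condUp α ρ ∧
      QRenyi.condUp α ρ ≤ QRenyi.condDown (2 - 1 / α) ρ) ∧
    (QRenyi.sandwichedCondDown α ρ ≤ QRenyi.sandwichedCondUp α ρ ∧
      QRenyi.sandwichedCondUp α ρ ≤ QRenyi.sandwichedCondDown (2 - 1 / α) ρ) ∧
    (QRenyi.condDown α ρ ≤ QRenyi.sandwichedCondDown α ρ ∧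
      QRenyi.sandwichedCondDown α ρ ≤ QRenyi.condDown (2 - 1 / α) ρ) := by
  have hB := QRenyi.posSemidef_one_kronecker (a := a) (QRenyi.posSemidef_marginalB hρ.1)
  have hS := QRenyi.isState_marginalB hρ
  refine ⟨⟨?_, ?_⟩, ⟨?_, ?_⟩, ⟨?_, ?_⟩, ?_, ?_⟩
  · exact iSup₂_mono fun σ hσ => EReal.neg_le_neg_iff.mpr
      (QRenyi.sandwichedDiv_le_renyiDiv hρ (QRenyi.posSemidef_one_kronecker hσ.1) hα)
  · exact iSup₂_mono fun σ hσ => EReal.neg_le_neg_iff.mpr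
      (QRenyi.renyiDiv_two_sub_le_sandwichedDiv hρ (QRenyi.posSemidef_one_kronecker hσ.1) hα)
  · exact le_iSup₂_of_le (QRenyi.marginalB ρ) hS le_rfl
  · exact iSup₂_le fun σ hσ => EReal.neg_le_neg_iff.mpr
      (QRenyi.renyiDiv_marginalB_two_sub_le hρ hσ hα)
  · exact le_iSup₂_of_le (QRenyi.marginalB ρ) hS le_rfl
  · exact iSup₂_le fun σ hσ => EReal.neg_le_neg_iff.mpr
      (QRenyi.sandwichedDiv_marginalB_two_sub_le hρ hσ hα)
  · exact EReal.neg_le_neg_iff.mpr (QRenyi.sandwichedDiv_le_renyiDiv hρ hB hα)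
  · exact EReal.neg_le_neg_iff.mpr (QRenyi.renyiDiv_two_sub_le_sandwichedDiv hρ hB hα)
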